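/- Fix $T>0$, a filtered probability space $(\Omega,\mathcal F,(\mathcal F_t)_{t\in[0,T]},\mathbb P)$ satisfying the usual conditions, a standard $(\mathcal F_t)$-Brownian motion $W$ on $[0,T]$, and constants $\mu,S_0,X_0\in\mathbb R$, $\sigma\ge 0$, $\nu\ge 0$ (permanent impact), $\eta>0$ (temporary impact), $\lambda>0$ (risk aversion). For a trading speed $\theta$ put $$S_t=S_0+\mu t+\sigma W_t,\qquad X^\theta_t=X_0+\int_0^t\theta_s\,ds,\qquad P^\theta_t=S_t+\nu(X^\theta_t-X_0).$$ Let $\hat{\mathbb P}^\theta_{s,t}$ be the Stratonovich signature over $[s,t]$ of the time-augmented price $(t,P^\theta_t)$ (letters $1$ for time and $2$ for price), and $\hat{\mathbb P}^\theta_t=\hat{\mathbb P}^\theta_{0,t}$. Let $\xi$ be a finite linear combination of words in the letters $1,2$, let $\mathcal E_t=\exp_\otimes\big((1+\tfrac{\sigma^2}{2}\,22)\,t\big)$, where $1$ and $22$ denote words, and let $\xi_t=\xi|_{\mathcal E_{T-t}}$, that is $\xi_t^{v}=\sum_u\xi^{vu}\mathcal E_{T-t}^{u}$; let $\xi_t|_2$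 have coefficients $(\xi_t|_2)^v=\xi_t^{v2}$. Let $\tilde M$ be the smallest integer such that $\xi_t|_2$ has no nonzero coefficient on words longer than $\tilde M$ for any $t\in[0,T]$, let $p=2\vee 2\tilde M\mathbf 1_{\{\nu>0\}}$, and let $\mathcal A$ be the set of progressively measurable $\theta$ with $\|\theta\|_{\mathcal A}^p:=\mathbb E\int_0^T\theta_t^p\,dt<\infty$ (identified $dt\otimes\mathbb P$-a.e.). With $\Delta^\theta_t=\langle\xi_t|_2,\hat{\mathbb P}^\theta_t\rangle$, define the objective of the mean-quadratic variation hedging problem $$J(\theta)=\mathbb E\int_0^T\Big[(\mu+\nu\theta_t)(X^\theta_t-\Delta^\theta_t)-\eta\theta_t^2-\tfrac{\lambda}{2}\sigma^2(X^\theta_t-\Delta^\theta_t)^2\Big]dt,\qquad\theta\in\mathcal A,$$ and $\nabla J(\theta)=-2\eta\theta+\nu\mathbf A\theta-\lambda\sigma^2\mathbf B\theta+\mu\mathbf C\theta$, where $$(\mathbf A\theta)_t=X^\theta_t-\Delta^\theta_t+\int_t^T\mathbb E\big(\theta_s(1-\nu\Gamma^\theta_{t,s})\,|\,\mathcal F_t\big)ds,$$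 $$(\mathbf B\theta)_t=\int_t^T\mathbb E\big(X^\theta_s(1-\nu\Gamma^\theta_{t,s})\,|\,\mathcal F_t\big)ds+\int_t^T\mathbb E\big(\tfrac12\nu\tilde\Gamma^\theta_{t,s}-\Delta^\theta_s\,|\,\mathcal F_t\big)ds,$$ $$(\mathbf C\theta)_t=(T-t)-\int_t^T\mathbb E(\nu\Gamma^\theta_{t,s}\,|\,\mathcal F_t)\,ds,$$ with $\Gamma^\theta_{t,s}=\langle\xi_s|_2,\hat{\mathbb P}^\theta_t\otimes 2\otimes\hat{\mathbb P}^\theta_{t,s}\rangle$ and $\tilde\Gamma^\theta_{t,s}$ the same with $\xi_s|_2$ replaced by its shuffle square. Write $\langle f,g\rangle_{L_2}=\mathbb E\int_0^Tf_tg_t\,dt$. If $\nu=0$, then the reward integrated in $J(\theta)$ is $dt\otimes\mathbb P$-integrable for every $\theta\in\mathcal A$, and for every $\varepsilon$ with $0<\varepsilon<2\eta$ the monotonicity condition holds: for all $\theta,\phi\in\mathcal A$, $$\Big\langle -2\eta(\theta-\phi)+\varepsilon\big(\|\theta\|_{\mathcal A}^{2-p}\theta^{p-1}-\|\phi\|_{\mathcal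 A}^{2-p}\phi^{p-1}\big)+\nu(\mathbf A\theta-\mathbf A\phi)-\lambda\sigma^2(\mathbf B\theta-\mathbf B\phi)+\mu(\mathbf C\theta-\mathbf C\phi),\ \theta-\phi\Big\rangle_{L_2}\le 0 .$$ Moreover, for each such $\varepsilon$, $J$ is $\varepsilon$-strongly concave on $\mathcal A$: for all $\theta,\phi\in\mathcal A$ and $\alpha\in[0,1]$, $$J(\alpha\theta+(1-\alpha)\phi)\ge\alpha J(\theta)+(1-\alpha)J(\phi)+\tfrac{\varepsilon\alpha(1-\alpha)}{2}\|\theta-\phi\|_{\mathcal A}^2 .$$ Consequently there is a unique (up to $dt\otimes\mathbb P$-null sets) maximizer $\theta^*\in\mathcal A$ of $J$, and $\theta^*$ is also the unique solution in $\mathcal A$ of $\nabla J(\theta^*)=0$. -/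

import Mathlib

open MeasureTheory ProbabilityTheory Filter Topology

noncomputable section

namespace SigHedging

/-! ### The extended tensor algebra over the plane

The alphabet has two letters: `time` (letter 1) and `price` (letter 2).  A word is stored with its
LAST letter first: the word `i₁ i₂ ⋯ iₙ` is the list `[iₙ, …, i₂, i₁]`.  So `v i` (append the
letter `i` on the right) is `i :: v`, and the concatenation `v u` is `u ++ v`.  An element of the
extended tensor algebra is the family of its coefficients in the basis of words. -/

abbrev Letter := Fin 2

abbrev time : Letter := 0

abbrev price : Letter := 1

abbrev Word := List Letter

abbrev Tensor := Word → ℝ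

/-- Membership in the truncated tensor algebra of order `M`. -/
def IsTrunc (M : ℕ) (l : Tensor) : Prop := ∀ w : Word, M < w.length → l w = 0

/-- The basis element attached to a word. -/
def ofWord (u : Word) : Tensor := fun w => if w = u then 1 else 0

/-- Tensor product: the coefficient at `w` is the sum of `l^v p^u` over all splittings `w = v u`. -/
def tmul (l p : Tensor) : Tensor := fun w =>
  ∑ k ∈ Finset.range (w.length + 1), l (w.drop k) * p (w.take k)

def tpow (l : Tensor) : ℕ → Tensor
  | 0 => ofWord []
  | k + 1 => tmul (tpow l k) l

/-- Tensor exponential (used for `l` with zero constant term, where each coefficient is a finite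
sum). -/
def texp (l : Tensor) : Tensor := fun w => ∑' k : ℕ, tpow l k w / (k.factorial : ℝ)

/-- Projection by a word: the coefficient at `v` is `l^{v u}`. -/
def proj (l : Tensor) (u : Word) : Tensor := fun v => l (u ++ v)

/-- Projection by a tensor: the coefficient at `v` is the sum of `l^{v u} q^u` over all words `u`
(a finite sum when `l` has finitely many nonzero coefficients). -/
def projTensor (l q : Tensor) : Tensor := fun v => ∑' u : Word, l (u ++ v) * q u

/-- The bracket `⟨l, q⟩` (a finite sum when `l` has finitely many nonzero coefficients). -/
def bracket (l q : Tensor) : ℝ := ∑' w : Word, l w * q w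

/-- The shuffle of two words, as the list (with multiplicity) of the words in it:
`(v i) ⧢ (w j) = (v ⧢ (w j)) i + ((v i) ⧢ w) j`. -/
def shuffleWord : Word → Word → List Word
  | [], w => [w]
  | i :: v, [] => [i :: v]
  | i :: v, j :: w =>
      (shuffleWord v (j :: w)).map (fun x => i :: x) ++
        (shuffleWord (i :: v) w).map (fun x => j :: x)
termination_by v w => v.length + w.length

/-- Shuffle product of tensors, by bilinearity (at each word only finitely many pairs count). -/
def shuffle (l q : Tensor) : Tensor := fun w =>
  ∑' x : Word × Word, l x.1 * q x.2 * ((shuffleWord x.1 x.2).count w : ℝ)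

/-! ### The market -/

/-- The time interval `[0, T]`. -/
abbrev Time (T : ℝ) := Set.Icc (0 : ℝ) T

/-- Lebesgue measure on `[0, T]`. -/
def leb (T : ℝ) : Measure (Time T) := Measure.comap (Subtype.val : Time T → ℝ) volume

/-- The usual conditions on `[0, T]`: the filtration is right-continuous and its first
sigma-algebra contains all null sets (so that the probability space is complete as well). -/
structure UsualConditions {Ω : Type*} {mΩ : MeasurableSpace Ω} {T : ℝ}
    (P : Measure Ω) (F : Filtration (Time T) mΩ) : Prop where
  right_cont : F.IsRightContinuous
  complete : ∀ t : Time T, ∀ N : Set Ω, P N = 0 → MeasurableSet[F t] N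

/-- `W` is a standard Brownian motion on `[0, T]` relative to the filtration `F`. -/
structure IsBrownianOn {Ω : Type*} {mΩ : MeasurableSpace Ω} {T : ℝ}
    (P : Measure Ω) (F : Filtration (Time T) mΩ) (W : Time T → Ω → ℝ) : Prop where
  adapted : StronglyAdapted F W
  start : ∀ t : Time T, (t : ℝ) = 0 → ∀ᵐ ω ∂P, W t ω = 0
  continuous : ∀ᵐ ω ∂P, Continuous fun t => W t ω
  law : ∀ s t : Time T, s ≤ t →
    P.map (fun ω => W t ω - W s ω) = gaussianReal 0 (Real.toNNReal ((t : ℝ) - s))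
  indep : ∀ s t : Time T, s ≤ t →
    Indep (MeasurableSpace.comap (fun ω => W t ω - W s ω) inferInstance) (F s) P

/-- The Bachelier market with market impact on a filtered probability space, together with the
risk aversion `lam` and the initial inventory `X0` of the trader. -/
structure Market (Ω : Type*) [mΩ : MeasurableSpace Ω] where
  T : ℝ
  T_pos : 0 < T
  P : Measure Ω
  prob : IsProbabilityMeasure P
  F : Filtration (Time T) mΩ
  usual : UsualConditions P F
  W : Time T → Ω → ℝ
  brownian : IsBrownianOn P F W
  /-- drift of the unaffected price -/
  mu : ℝ
  /-- volatility of the unaffected price -/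
  sigma : ℝ
  sigma_nonneg : 0 ≤ sigma
  /-- permanent impact parameter -/
  nu : ℝ
  nu_nonneg : 0 ≤ nu
  /-- temporary impact parameter -/
  eta : ℝ
  eta_pos : 0 < eta
  /-- risk aversion -/
  lam : ℝ
  lam_pos : 0 < lam
  /-- initial unaffected price -/
  S0 : ℝ
  /-- initial inventory -/
  X0 : ℝ

attribute [instance] Market.prob

namespace Market

variable {Ω : Type*} [mΩ : MeasurableSpace Ω] (m : Market Ω)

/-- The initial time. -/
def t0 : Time m.T := ⟨0, le_rfl, m.T_pos.le⟩

/-- The terminal time. -/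
def tT : Time m.T := ⟨m.T, m.T_pos.le, le_rfl⟩

/-- The unaffected price `S`, that is `dS = mu dt + sigma dW`. -/
def S (t : Time m.T) (ω : Ω) : ℝ := m.S0 + m.mu * (t : ℝ) + m.sigma * m.W t ω

/-- The inventory `X^θ`. -/
def X (θ : Time m.T → Ω → ℝ) (t : Time m.T) (ω : Ω) : ℝ :=
  m.X0 + ∫ s in Set.Iic t, θ s ω ∂(leb m.T)

/-- The price `P^θ` including permanent impact. -/
def Pr (θ : Time m.T → Ω → ℝ) (t : Time m.T) (ω : Ω) : ℝ :=
  m.S t ω + m.nu * (m.X θ t ω - m.X0)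

/-- The two coordinates of the time-augmented price `(t, P^θ_t)`. -/
def augmented (θ : Time m.T → Ω → ℝ) (i : Letter) (t : Time m.T) (ω : Ω) : ℝ :=
  if i = time then (t : ℝ) else m.Pr θ t ω

/-! ### Stratonovich integrals and the signature -/

/-- `τ 0 ≤ τ 1 ≤ ⋯ ≤ τ N` is a partition of `[0, T]`. -/
def IsPartition (τ : ℕ → Time m.T) (N : ℕ) : Prop :=
  Monotone τ ∧ τ 0 = m.t0 ∧ τ N = m.tT

/-- The trapezoidal Riemann sum of `Y` against `Z` over `[u, t]` along a partition of `[0, T]`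
(the partition points are moved into `[u, t]`; the sum is `0` for `t ≤ u`). -/
def trapezoid (u : Time m.T) (Y Z : Time m.T → Ω → ℝ) (τ : ℕ → Time m.T) (N : ℕ)
    (t : Time m.T) (ω : Ω) : ℝ :=
  ∑ k ∈ Finset.range N,
    (Y (max u (min (τ k) t)) ω + Y (max u (min (τ (k + 1)) t)) ω) / 2 *
      (Z (max u (min (τ (k + 1)) t)) ω - Z (max u (min (τ k) t)) ω)

/-- `I` is a version of the Stratonovich integral `t ↦ ∫_u^t Y ∘ dZ`: it is continuous, adapted,
and at each time it is the limit in probability of the trapezoidal sums along every sequence of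
partitions whose mesh tends to zero. -/
structure IsStratonovich (u : Time m.T) (Y Z I : Time m.T → Ω → ℝ) : Prop where
  continuous : ∀ ω, Continuous fun t => I t ω
  adapted : StronglyAdapted m.F I
  limit : ∀ (τ : ℕ → ℕ → Time m.T) (N : ℕ → ℕ), (∀ n, m.IsPartition (τ n) (N n)) →
    (∀ δ : ℝ, 0 < δ → ∀ᶠ n in atTop, ∀ k < N n, ((τ n (k + 1) : ℝ) - τ n k) < δ) →
    ∀ t, TendstoInMeasure m.P (fun n => m.trapezoid u Y Z (τ n) (N n) t) atTop (I t)

open Classical in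
/-- The Stratonovich integral `t ↦ ∫_u^t Y ∘ dZ` (it exists for continuous semimartingales and is
unique up to indistinguishability; set to zero if it does not exist). -/
def stratonovich (u : Time m.T) (Y Z : Time m.T → Ω → ℝ) : Time m.T → Ω → ℝ :=
  if h : ∃ I, m.IsStratonovich u Y Z I then h.choose else fun _ _ => 0

/-- The coefficient at a word of the signature over `[u, t]` of the time-augmented price. -/
def sigWord (θ : Time m.T → Ω → ℝ) (u : Time m.T) : Word → Time m.T → Ω → ℝ
  | [] => fun _ _ => 1
  | i :: v => m.stratonovich u (sigWord θ u v) (m.augmented θ i)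

/-- The signature over `[u, t]` of the time-augmented price. -/
def sig (θ : Time m.T → Ω → ℝ) (u t : Time m.T) (ω : Ω) : Tensor := fun w => m.sigWord θ u w t ω

/-! ### The hedging problem for the payoff with coefficients `ξ` -/

/-- The expected signature `exp_⊗ (t (1 + σ²/2 22))`. -/
def expectedSig (t : ℝ) : Tensor :=
  texp (t • (ofWord [time] + (m.sigma ^ 2 / 2) • ofWord [price, price]))

/-- `ξ_t`, the projection of `ξ` by the expected signature of the remaining time. -/
def xiAt (ξ : Tensor) (t : Time m.T) : Tensor := projTensor ξ (m.expectedSig (m.T - t))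

/-- `ξ_t|_2`, the projection of `ξ_t` by the price letter. -/
def deltaCoef (ξ : Tensor) (t : Time m.T) : Tensor := proj (m.xiAt ξ t) [price]

/-- The tracked frictionless delta `⟨ξ_t|_2, sig_t⟩`, evaluated at the impacted price. -/
def delta (ξ : Tensor) (θ : Time m.T → Ω → ℝ) (t : Time m.T) (ω : Ω) : ℝ :=
  bracket (m.deltaCoef ξ t) (m.sig θ m.t0 t ω)

/-- The truncation order of `ξ_t|_2`. -/
def truncOrder (ξ : Tensor) : ℕ := sInf {N | ∀ t, IsTrunc N (m.deltaCoef ξ t)}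

/-- The integrability exponent. -/
def exponent (ξ : Tensor) : ℕ := max 2 (if 0 < m.nu then 2 * m.truncOrder ξ else 0)

/-- The admissible trading speeds: progressively measurable with `E ∫ θ^p dt < ∞`. -/
def Admissible (ξ : Tensor) (θ : Time m.T → Ω → ℝ) : Prop :=
  IsStronglyProgressive m.F θ ∧
    MemLp (fun z : Time m.T × Ω => θ z.1 z.2) (m.exponent ξ : ENNReal) ((leb m.T).prod m.P)

/-- The norm of the space of admissible trading speeds (the exponent is even). -/
def admNorm (ξ : Tensor) (θ : Time m.T → Ω → ℝ) : ℝ :=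
  (∫ ω, ∫ t, θ t ω ^ m.exponent ξ ∂(leb m.T) ∂m.P) ^ (1 / (m.exponent ξ : ℝ))

/-- The running reward of the control problem. -/
def reward (ξ : Tensor) (θ : Time m.T → Ω → ℝ) (t : Time m.T) (ω : Ω) : ℝ :=
  (m.mu + m.nu * θ t ω) * (m.X θ t ω - m.delta ξ θ t ω) - m.eta * θ t ω ^ 2
    - m.lam / 2 * m.sigma ^ 2 * (m.X θ t ω - m.delta ξ θ t ω) ^ 2

/-- The mean-quadratic variation objective `J`. -/
def J (ξ : Tensor) (θ : Time m.T → Ω → ℝ) : ℝ := ∫ ω, ∫ t, m.reward ξ θ t ω ∂(leb m.T) ∂m.P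

/-! ### The operators in the derivative of `J` -/

/-- The random variable `∫_t^T E(Z_s | F_t) ds`, as the Bochner integral over `s` of the classes
`E(Z_s | F_t)` in `L¹(P)`; it is determined up to a null set for each `t`. -/
def condInt (t : Time m.T) (Z : Time m.T → Ω → ℝ) : Ω → ℝ :=
  ⇑(∫ s in Set.Ioi t, condExpL1 (m.F.le t) m.P (Z s) ∂(leb m.T))

/-- `Γ^θ_{t,s} = ⟨ξ_s|_2, sig_t ⊗ 2 ⊗ sig_{t,s}⟩`. -/
def Gam (ξ : Tensor) (θ : Time m.T → Ω → ℝ) (t s : Time m.T) (ω : Ω) : ℝ :=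
  bracket (m.deltaCoef ξ s)
    (tmul (tmul (m.sig θ m.t0 t ω) (ofWord [price])) (m.sig θ t s ω))

/-- The same quantity with the shuffle square of `ξ_s|_2`. -/
def GamTilde (ξ : Tensor) (θ : Time m.T → Ω → ℝ) (t s : Time m.T) (ω : Ω) : ℝ :=
  bracket (shuffle (m.deltaCoef ξ s) (m.deltaCoef ξ s))
    (tmul (tmul (m.sig θ m.t0 t ω) (ofWord [price])) (m.sig θ t s ω))

def opA (ξ : Tensor) (θ : Time m.T → Ω → ℝ) (t : Time m.T) (ω : Ω) : ℝ :=
  m.X θ t ω - m.delta ξ θ t ω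
    + m.condInt t (fun s ω' => θ s ω' * (1 - m.nu * m.Gam ξ θ t s ω')) ω

def opB (ξ : Tensor) (θ : Time m.T → Ω → ℝ) (t : Time m.T) (ω : Ω) : ℝ :=
  m.condInt t (fun s ω' => m.X θ s ω' * (1 - m.nu * m.Gam ξ θ t s ω')) ω
    + m.condInt t (fun s ω' => 1 / 2 * m.nu * m.GamTilde ξ θ t s ω' - m.delta ξ θ s ω') ω

def opC (ξ : Tensor) (θ : Time m.T → Ω → ℝ) (t : Time m.T) (ω : Ω) : ℝ :=
  (m.T - (t : ℝ)) - m.condInt t (fun s ω' => m.nu * m.Gam ξ θ t s ω') ω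

/-- The gradient of `J`. -/
def gradJ (ξ : Tensor) (θ : Time m.T → Ω → ℝ) (t : Time m.T) (ω : Ω) : ℝ :=
  -2 * m.eta * θ t ω + m.nu * m.opA ξ θ t ω - m.lam * m.sigma ^ 2 * m.opB ξ θ t ω
    + m.mu * m.opC ξ θ t ω

/-- The `L²` pairing `E ∫ f_t g_t dt`, with the expectation taken first: the values of the
operators are random variables known up to a null set at each time, and `E (f_t g_t)` does not
depend on the choice of representatives.  See `pairing_eq` for the other order. -/
def pairing (f g : Time m.T → Ω → ℝ) : ℝ := ∫ t, ∫ ω, f t ω * g t ω ∂m.P ∂(leb m.T)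

instance leb_finite (T : ℝ) : IsFiniteMeasure (leb T) := by
  constructor
  unfold leb
  rw [(MeasurableEmbedding.subtype_coe measurableSet_Icc).comap_apply]
  refine lt_of_le_of_lt (measure_mono (t := Set.Icc 0 T) ?_) measure_Icc_lt_top
  rintro _ ⟨x, -, rfl⟩
  exact x.2

theorem pairing_eq (f g : Time m.T → Ω → ℝ)
    (h : Integrable (fun z : Time m.T × Ω => f z.1 z.2 * g z.1 z.2) ((leb m.T).prod m.P)) :
    m.pairing f g = ∫ ω, ∫ t, f t ω * g t ω ∂(leb m.T) ∂m.P :=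
  integral_integral_swap h

/-- The monotonicity condition with constant `ε`. -/
def MonotonicityCondition (ξ : Tensor) (ε : ℝ) : Prop :=
  ∀ θ φ : Time m.T → Ω → ℝ, m.Admissible ξ θ → m.Admissible ξ φ →
    m.pairing
      (fun t ω =>
        -2 * m.eta * (θ t ω - φ t ω)
        + ε * (m.admNorm ξ θ ^ (2 - (m.exponent ξ : ℤ)) * θ t ω ^ (m.exponent ξ - 1)
            - m.admNorm ξ φ ^ (2 - (m.exponent ξ : ℤ)) * φ t ω ^ (m.exponent ξ - 1))
        + m.nu * (m.opA ξ θ t ω - m.opA ξ φ t ω)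
        - m.lam * m.sigma ^ 2 * (m.opB ξ θ t ω - m.opB ξ φ t ω)
        + m.mu * (m.opC ξ θ t ω - m.opC ξ φ t ω))
      (fun t ω => θ t ω - φ t ω) ≤ 0

/-- `J` is `β`-strongly concave on the admissible trading speeds. -/
def StronglyConcaveJ (ξ : Tensor) (β : ℝ) : Prop :=
  ∀ θ φ : Time m.T → Ω → ℝ, m.Admissible ξ θ → m.Admissible ξ φ →
    ∀ α : ℝ, 0 ≤ α → α ≤ 1 →
      α * m.J ξ θ + (1 - α) * m.J ξ φ
          + β * α * (1 - α) / 2 * m.admNorm ξ (fun t ω => θ t ω - φ t ω) ^ 2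
        ≤ m.J ξ (fun t ω => α * θ t ω + (1 - α) * φ t ω)

/-- `θ` is an optimal control: it is admissible and maximizes `J`. -/
def IsOptimal (ξ : Tensor) (θ : Time m.T → Ω → ℝ) : Prop :=
  m.Admissible ξ θ ∧ ∀ φ : Time m.T → Ω → ℝ, m.Admissible ξ φ → m.J ξ φ ≤ m.J ξ θ

/-- The first-order condition: the gradient of `J` vanishes at `θ`. -/
def FirstOrder (ξ : Tensor) (θ : Time m.T → Ω → ℝ) : Prop :=
  ∀ᵐ t ∂(leb m.T), ∀ᵐ ω ∂m.P, m.gradJ ξ θ t ω = 0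

/-- Equality of two trading speeds `dt ⊗ P`-almost everywhere. -/
def SameSpeed (θ φ : Time m.T → Ω → ℝ) : Prop :=
  ∀ᵐ z ∂((leb m.T).prod m.P), θ z.1 z.2 = φ z.1 z.2

end Market

end SigHedging

end

/-! Without permanent impact the price, its signature and hence the tracked delta do not depend on
the trading speed, and the exponent is 2. Since `X` is affine in `θ`, `J` is a concave quadratic
functional on a Hilbert space whose curvature is at least `2η`, thanks to the temporary cost. The
argument has three ingredients.

The delta belongs to `L²(dt ⊗ P)` (`delta_memLp`). Its coefficients are continuous in time, so it
suffices to bound the moments of the signature, by induction on words. A Stratonovich integral is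
known only as a limit in probability of trapezoidal sums. Over an interval of length `L` such a sum
splits into a left-point sum against `W`, a drift sum and a discrete bracket. Its moment of order
`2r+2` is at most a constant times `L^(r+1)`, uniformly in the grid, by independence of increments
and a discrete Gronwall bound, and Fatou's lemma passes this to the limit. Existence of the
integrals is not needed: the default value zero satisfies the same bounds.

The derivative of `J` at `θ` in the direction `u` is the pairing of `u` with `rawGrad`, the gradient
before conditioning. The Euler equation asks that it vanish for all admissible `u`. It has a
solution by Lax–Milgram on the closed subspace of progressive classes (`exists_euler`). A concave
function lies below its tangents, so the solution is a maximizer; strong concavity, a pointwise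
quadratic identity, makes the maximizer unique.

The gradient at time `t` is the conditional expectation of `rawGrad` given `F t`, for almost every
`t` (`gradJ_ae`), because conditional expectation commutes with Bochner integration in `L¹(P)`. An
adapted direction cannot tell the two apart, so a vanishing gradient implies the Euler equation.
Conversely, testing with indicators of `[a, b] × A`, `A ∈ F a`, and differentiating in time an
`L¹(P)`-valued function recovers the vanishing of the gradient. The same projection reduces the
monotonicity pairing, for `u = θ - φ`, to `-(2η - ε)‖u‖² - λσ²‖∫u‖²`. -/

open MeasureTheory ProbabilityTheory Filter Topology

noncomputable section

namespace SigHedging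

/-! ### Random variables with all moments -/

section Moments

variable {Ω : Type*} {mΩ : MeasurableSpace Ω} {P : Measure Ω}

/-- `f` has moments of every order. -/
def AllMoments (P : Measure Ω) (f : Ω → ℝ) : Prop := ∀ p : ℕ, MemLp f p P

namespace AllMoments

variable {f g : Ω → ℝ}

theorem const [IsFiniteMeasure P] (c : ℝ) : AllMoments P (fun _ => c) := fun _ => memLp_const c

theorem add (hf : AllMoments P f) (hg : AllMoments P g) : AllMoments P (fun ω => f ω + g ω) :=
  fun p => (hf p).add (hg p)

theorem sub (hf : AllMoments P f) (hg : AllMoments P g) : AllMoments P (fun ω => f ω - g ω) :=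
  fun p => (hf p).sub (hg p)

theorem const_mul (hf : AllMoments P f) (c : ℝ) : AllMoments P (fun ω => c * f ω) :=
  fun p => (hf p).const_mul c

theorem mul (hf : AllMoments P f) (hg : AllMoments P g) : AllMoments P (fun ω => f ω * g ω) := by
  intro p
  -- Cauchy–Schwarz: a product of two elements of `L^(2p)` lies in `L^p`.
  have : ENNReal.HolderTriple ((2 * p : ℕ) : ENNReal) ((2 * p : ℕ) : ENNReal) (p : ENNReal) := by
    constructor
    push_cast
    rw [ENNReal.mul_inv (by simp) (by simp), ← add_mul, ENNReal.inv_two_add_inv_two, one_mul]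
  exact (hg (2 * p)).mul' (hf (2 * p))

theorem pow [IsFiniteMeasure P] (hf : AllMoments P f) (n : ℕ) :
    AllMoments P (fun ω => f ω ^ n) := by
  induction n with
  | zero => simpa using const 1
  | succ n ih => simpa only [pow_succ] using ih.mul hf

theorem sum {ι : Type*} {s : Finset ι} {f : ι → Ω → ℝ} (h : ∀ i ∈ s, AllMoments P (f i)) :
    AllMoments P (fun ω => ∑ i ∈ s, f i ω) := fun p => memLp_finsetSum s fun i hi => h i hi p

theorem integrable (hf : AllMoments P f) : Integrable f P :=
  memLp_one_iff_integrable.1 (by simpa using hf 1)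

theorem congr (hf : AllMoments P f) (h : f =ᵐ[P] g) : AllMoments P g :=
  fun p => (memLp_congr_ae h).1 (hf p)

theorem aestronglyMeasurable (hf : AllMoments P f) : AEStronglyMeasurable f P := (hf 0).1

theorem of_even [IsFiniteMeasure P] (h : ∀ r : ℕ, MemLp f ((2 * r + 2 : ℕ) : ENNReal) P) :
    AllMoments P f := fun p => (h p).mono_exponent (by norm_cast; omega)

end AllMoments

theorem even_exponent (r : ℕ) : Even (2 * r + 2) := ⟨r + 1, by ring⟩

/-- Fatou's lemma for even moments along a sequence converging in measure. -/
theorem memLp_of_tendstoInMeasure {f : ℕ → Ω → ℝ} {g : Ω → ℝ} {r : ℕ} {C : ℝ}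
    (hf : ∀ n, MemLp (f n) ((2 * r + 2 : ℕ) : ENNReal) P)
    (hC : ∀ n, ∫ ω, f n ω ^ (2 * r + 2) ∂P ≤ C) (hg : TendstoInMeasure P f atTop g) :
    MemLp g ((2 * r + 2 : ℕ) : ENNReal) P ∧ ∫ ω, g ω ^ (2 * r + 2) ∂P ≤ C := by
  have h0 : ((2 * r + 2 : ℕ) : ENNReal) ≠ 0 := by norm_cast
  have ht : ((2 * r + 2 : ℕ) : ENNReal) ≠ ⊤ := ENNReal.natCast_ne_top _
  have key : ∀ u : Ω → ℝ, MemLp u ((2 * r + 2 : ℕ) : ENNReal) P →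
      eLpNorm u ((2 * r + 2 : ℕ) : ENNReal) P
        = ENNReal.ofReal ((∫ ω, u ω ^ (2 * r + 2) ∂P) ^ (((2 * r + 2 : ℕ) : ℝ)⁻¹)) := by
    intro u hu
    rw [hu.eLpNorm_eq_integral_rpow_norm h0 ht]
    simp only [ENNReal.toReal_natCast, Real.rpow_natCast, Real.norm_eq_abs,
      (even_exponent r).pow_abs]
  have hnn : ∀ u : Ω → ℝ, 0 ≤ ∫ ω, u ω ^ (2 * r + 2) ∂P := fun u =>
    integral_nonneg fun ω => (even_exponent r).pow_nonneg _
  have hle : eLpNorm g ((2 * r + 2 : ℕ) : ENNReal) P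
      ≤ ENNReal.ofReal (C ^ (((2 * r + 2 : ℕ) : ℝ)⁻¹)) := by
    refine eLpNorm_le_of_tendstoInMeasure (Eventually.of_forall fun n => ?_) hg fun n => (hf n).1
    rw [key _ (hf n)]
    exact ENNReal.ofReal_le_ofReal (Real.rpow_le_rpow (hnn _) (hC n) (by positivity))
  have hC0 : 0 ≤ C := (hnn _).trans (hC 0)
  have hmem : MemLp g ((2 * r + 2 : ℕ) : ENNReal) P :=
    ⟨hg.aestronglyMeasurable fun n => (hf n).1, hle.trans_lt ENNReal.ofReal_lt_top⟩
  refine ⟨hmem, ?_⟩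
  rw [key _ hmem, ENNReal.ofReal_le_ofReal_iff (by positivity)] at hle
  exact (Real.rpow_le_rpow_iff (hnn _) hC0 (by positivity)).1 hle

/-! ### Elementary inequalities -/

theorem young_pow {a b : ℝ} (ha : 0 ≤ a) (hb : 0 ≤ b) (i j : ℕ) :
    a ^ i * b ^ j ≤ a ^ (i + j) + b ^ (i + j) := by
  rcases le_total a b with h | h
  · have : a ^ i * b ^ j ≤ b ^ i * b ^ j := by gcongr
    rw [← pow_add] at this
    have := pow_nonneg ha (i + j)
    linarith
  · have : a ^ i * b ^ j ≤ a ^ i * a ^ j := by gcongr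
    rw [← pow_add] at this
    have := pow_nonneg hb (i + j)
    linarith

/-- In the binomial expansion the terms of order 0 and 1 in `y` are kept exactly, because the linear
one will have mean zero when `y` carries a Brownian increment. Every other term contains `y ^ 2`,
and Young's inequality on the remaining factor reduces it to the two extreme monomials; the binomial
coefficients add up to at most `2 ^ (2r+2)`. -/
theorem add_pow_even_le (x y : ℝ) (r : ℕ) :
    (x + y) ^ (2 * r + 2) ≤ x ^ (2 * r + 2) + (2 * r + 2) * (x ^ (2 * r + 1) * y)
      + 2 ^ (2 * r + 2) * (x ^ (2 * r) * y ^ 2 + y ^ (2 * r + 2)) := by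
  have hB : 0 ≤ x ^ (2 * r) * y ^ 2 + y ^ (2 * r + 2) := by
    have h1 := (even_two_mul r).pow_nonneg x
    have h2 := (even_exponent r).pow_nonneg y
    positivity
  have hterm : ∀ i ∈ Finset.range (2 * r + 1),
      y ^ (i + 1 + 1) * x ^ (2 * r + 2 - (i + 1 + 1)) * ((2 * r + 2).choose (i + 1 + 1) : ℝ)
        ≤ ((2 * r + 2).choose (i + 1 + 1) : ℝ) * (x ^ (2 * r) * y ^ 2 + y ^ (2 * r + 2)) := by
    intro i hi
    rw [mul_comm]
    gcongr
    have hi' : i ≤ 2 * r := by simpa [Nat.lt_succ_iff] using hi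
    obtain ⟨j, hj⟩ := Nat.exists_eq_add_of_le hi'
    have e1 : 2 * r + 2 - (i + 1 + 1) = j := by omega
    rw [e1]
    have h := young_pow (abs_nonneg y) (abs_nonneg x) i j
    rw [← hj, (even_two_mul r).pow_abs, (even_two_mul r).pow_abs] at h
    calc y ^ (i + 1 + 1) * x ^ j = y ^ 2 * (y ^ i * x ^ j) := by ring
      _ ≤ y ^ 2 * (|y| ^ i * |x| ^ j) := by
          refine mul_le_mul_of_nonneg_left ?_ (sq_nonneg y)
          rw [← abs_pow, ← abs_pow, ← abs_mul]
          exact le_abs_self _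
      _ ≤ y ^ 2 * (y ^ (2 * r) + x ^ (2 * r)) := by gcongr
      _ = _ := by ring
  have hchoose : ∑ i ∈ Finset.range (2 * r + 1), ((2 * r + 2).choose (i + 1 + 1) : ℝ)
      ≤ 2 ^ (2 * r + 2) := by
    have h := Nat.sum_range_choose (2 * r + 2)
    rw [show 2 * r + 2 + 1 = 2 * r + 1 + 1 + 1 by ring, Finset.sum_range_succ',
      Finset.sum_range_succ'] at h
    have h' : ∑ i ∈ Finset.range (2 * r + 1), (2 * r + 2).choose (i + 1 + 1)
      ≤ 2 ^ (2 * r + 2) := by omega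
    exact_mod_cast h'
  rw [add_comm x y, add_pow, show 2 * r + 2 + 1 = 2 * r + 1 + 1 + 1 by ring,
    Finset.sum_range_succ', Finset.sum_range_succ']
  have hs := Finset.sum_le_sum hterm
  rw [← Finset.sum_mul] at hs
  have hs' := hs.trans (mul_le_mul_of_nonneg_right hchoose hB)
  have e : 2 * r + 2 - (0 + 1) = 2 * r + 1 := by omega
  simp only [e]
  generalize (∑ i ∈ Finset.range (2 * r + 1),
    y ^ (i + 1 + 1) * x ^ (2 * r + 2 - (i + 1 + 1)) * ((2 * r + 2).choose (i + 1 + 1) : ℝ)) = S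
    at hs' ⊢
  simp only [zero_add, pow_one, pow_zero, Nat.choose_one_right, Nat.choose_zero_right,
    Nat.sub_zero]
  push_cast
  linarith

/-- Discrete Gronwall bound with constant step. -/
theorem discrete_gronwall {a : ℕ → ℝ} {C K : ℝ} (hC : 0 ≤ C) (hK : 0 ≤ K) {n : ℕ} (hn : 0 < n)
    (h0 : a 0 = 0) (h : ∀ k < n, a (k + 1) ≤ (1 + C / n) * a k + C / n * K) :
    a n ≤ K * Real.exp C := by
  -- Adding `K` makes the recursion homogeneous with ratio `1 + C / n`.
  have key : ∀ k ≤ n, a k + K ≤ K * (1 + C / n) ^ k := by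
    intro k
    induction k with
    | zero => intro _; simp [h0]
    | succ k ih =>
      intro hk
      have h1 := ih (by omega)
      have h2 := h k (by omega)
      have h3 : (1 + C / n) * (a k + K) ≤ (1 + C / n) * (K * (1 + C / n) ^ k) := by gcongr
      rw [pow_succ]
      linarith
  have hn' : (0 : ℝ) < n := by exact_mod_cast hn
  have h1 : (1 + C / n) ^ n ≤ Real.exp C := by
    calc (1 + C / n) ^ n ≤ Real.exp (C / n) ^ n := by
          gcongr
          linarith [Real.add_one_le_exp (C / n)]
      _ = Real.exp C := by
          rw [← Real.exp_nat_mul]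
          congr 1
          field_simp
  have := key n le_rfl
  have := mul_le_mul_of_nonneg_left h1 hK
  linarith

/-- Jensen's inequality for the uniform weights `1 / n`. -/
theorem sum_pow_le_card_pow_mul {n : ℕ} (hn : 0 < n) (x : ℕ → ℝ) (r : ℕ) :
    (∑ k ∈ Finset.range n, x k) ^ (2 * r + 2)
      ≤ (n : ℝ) ^ (2 * r + 1) * ∑ k ∈ Finset.range n, x k ^ (2 * r + 2) := by
  have hn' : (0 : ℝ) < n := by exact_mod_cast hn
  have h := Real.pow_arith_mean_le_arith_mean_pow_of_even (Finset.range n) (fun _ => (n : ℝ)⁻¹) x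
    (fun _ _ => by positivity) (by simp [hn'.ne']) (even_exponent r)
  rw [← Finset.mul_sum, ← Finset.mul_sum, mul_pow] at h
  have h2 := mul_le_mul_of_nonneg_left h (by positivity : 0 ≤ (n : ℝ) ^ (2 * r + 2))
  calc _ = (n : ℝ) ^ (2 * r + 2) * ((n : ℝ)⁻¹ ^ (2 * r + 2)
        * (∑ k ∈ Finset.range n, x k) ^ (2 * r + 2)) := by
          rw [← mul_assoc, ← mul_pow, mul_inv_cancel₀ hn'.ne', one_pow, one_mul]
    _ ≤ _ := h2
    _ = _ := by rw [pow_succ (n : ℝ) (2 * r + 1)]; field_simp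

theorem add_pow_even_le_two (x y : ℝ) (r : ℕ) :
    (x + y) ^ (2 * r + 2) ≤ 2 ^ (2 * r + 1) * (x ^ (2 * r + 2) + y ^ (2 * r + 2)) := by
  simpa using (even_exponent r).add_pow_le (a := x) (b := y)

end Moments

/-! ### Increments of Brownian motion -/

section Brownian

variable {Ω : Type*} {mΩ : MeasurableSpace Ω} {T : ℝ} {P : Measure Ω}
  {F : Filtration (Time T) mΩ} {W : Time T → Ω → ℝ}

/-- The moments of the standard Gaussian law. -/
def gaussMoment (n : ℕ) : ℝ := ∫ x, x ^ n ∂(gaussianReal 0 1)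

theorem gaussMoment_one : gaussMoment 1 = 0 := by simp [gaussMoment, integral_id_gaussianReal]

theorem gaussMoment_even_nonneg (r : ℕ) : 0 ≤ gaussMoment (2 * r + 2) :=
  integral_nonneg fun _ => (even_exponent r).pow_nonneg _

/-- Scaling: the centred Gaussian law of variance `d` is the image of the standard one under
multiplication by `√d`. -/
theorem integral_pow_gaussianReal {d : ℝ} (hd : 0 ≤ d) (n : ℕ) :
    ∫ x, x ^ n ∂(gaussianReal 0 d.toNNReal) = Real.sqrt d ^ n * gaussMoment n := by
  have h := gaussianReal_map_const_mul (μ := 0) (v := 1) (Real.sqrt d)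
  have e : (NNReal.mk (Real.sqrt d ^ 2) (sq_nonneg _)) * 1 = d.toNNReal := by
    ext
    simp [Real.sq_sqrt hd, Real.coe_toNNReal d hd]
  rw [mul_zero, e] at h
  rw [← h, integral_map (by fun_prop) (by fun_prop)]
  simp only [mul_pow, gaussMoment, integral_const_mul]

namespace IsBrownianOn

theorem measurable_incr (hW : IsBrownianOn P F W) (s t : Time T) :
    Measurable fun ω => W t ω - W s ω :=
  ((hW.adapted t).measurable.mono (F.le t) le_rfl).sub
    ((hW.adapted s).measurable.mono (F.le s) le_rfl)

theorem allMoments_incr (hW : IsBrownianOn P F W) {s t : Time T} (hst : s ≤ t) :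
    AllMoments P fun ω => W t ω - W s ω := by
  intro p
  have h : MemLp id (p : ENNReal) (P.map fun ω => W t ω - W s ω) := by
    rw [hW.law s t hst]
    exact memLp_id_gaussianReal' _ (ENNReal.natCast_ne_top p)
  exact (memLp_map_measure_iff (by fun_prop) (hW.measurable_incr s t).aemeasurable).1 h

theorem integral_incr_pow (hW : IsBrownianOn P F W) {s t : Time T} (hst : s ≤ t) (n : ℕ) :
    ∫ ω, (W t ω - W s ω) ^ n ∂P = Real.sqrt ((t : ℝ) - s) ^ n * gaussMoment n := by
  have hst' : (0 : ℝ) ≤ (t : ℝ) - s := sub_nonneg.2 hst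
  rw [← integral_pow_gaussianReal hst', ← hW.law s t hst,
    integral_map (hW.measurable_incr s t).aemeasurable (by fun_prop)]

theorem integral_incr_pow_even (hW : IsBrownianOn P F W) {s t : Time T} (hst : s ≤ t) (r : ℕ) :
    ∫ ω, (W t ω - W s ω) ^ (2 * r + 2) ∂P
      = ((t : ℝ) - s) ^ (r + 1) * gaussMoment (2 * r + 2) := by
  have hst' : (0 : ℝ) ≤ (t : ℝ) - s := sub_nonneg.2 hst
  rw [hW.integral_incr_pow hst, show 2 * r + 2 = 2 * (r + 1) by ring, pow_mul, Real.sq_sqrt hst']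

theorem integral_mul_incr_pow (hW : IsBrownianOn P F W) {s t : Time T} (hst : s ≤ t)
    {N : Ω → ℝ} (hN : StronglyMeasurable[F s] N) (n : ℕ) :
    ∫ ω, N ω * (W t ω - W s ω) ^ n ∂P = (∫ ω, N ω ∂P) * ∫ ω, (W t ω - W s ω) ^ n ∂P := by
  have hind : IndepFun N (fun ω => W t ω - W s ω) P := by
    have h := (hW.indep s t hst).symm
    exact indep_of_indep_of_le_left h hN.measurable.comap_le
  have hind2 : IndepFun N (fun ω => (W t ω - W s ω) ^ n) P :=
    hind.comp measurable_id (measurable_id.pow_const n)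
  exact hind2.integral_fun_mul_eq_mul_integral (hN.mono (F.le s)).aestronglyMeasurable
    ((hW.measurable_incr s t).pow_const n).aestronglyMeasurable

/-- One step of the even moment recursion of a discrete stochastic integral. -/
theorem moment_step [IsProbabilityMeasure P] (hW : IsBrownianOn P F W) {s t : Time T}
    (hst : s ≤ t) {N Y : Ω → ℝ}
    (hN : StronglyMeasurable[F s] N) (hY : StronglyMeasurable[F s] Y)
    (hNm : AllMoments P N) (hYm : AllMoments P Y) {L : ℝ} (hL : 0 < L)
    (hsL : (t : ℝ) - s ≤ L) (r : ℕ) :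
    ∫ ω, (N ω + Y ω * (W t ω - W s ω)) ^ (2 * r + 2) ∂P ≤
      (1 + 2 ^ (2 * r + 2) * (gaussMoment 2 + gaussMoment (2 * r + 2)) * (((t : ℝ) - s) / L))
          * ∫ ω, N ω ^ (2 * r + 2) ∂P
        + 2 ^ (2 * r + 2) * (gaussMoment 2 + gaussMoment (2 * r + 2)) * (((t : ℝ) - s) / L)
          * (L ^ (r + 1) * ∫ ω, Y ω ^ (2 * r + 2) ∂P) := by
  set D : Ω → ℝ := fun ω => W t ω - W s ω with hD
  have hDm : AllMoments P D := hW.allMoments_incr hst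
  set d : ℝ := (t : ℝ) - s with hd
  have hd0 : 0 ≤ d := sub_nonneg.2 hst
  have g2 : 0 ≤ gaussMoment 2 := gaussMoment_even_nonneg 0
  have gr := gaussMoment_even_nonneg r
  have hEN : 0 ≤ ∫ ω, N ω ^ (2 * r + 2) ∂P :=
    integral_nonneg fun _ => (even_exponent r).pow_nonneg _
  have hEY : 0 ≤ ∫ ω, Y ω ^ (2 * r + 2) ∂P :=
    integral_nonneg fun _ => (even_exponent r).pow_nonneg _
  have iN := (hNm.pow (2 * r + 2)).integrable
  have iY := (hYm.pow (2 * r + 2)).integrable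
  have i1 : Integrable (fun ω => (N ω ^ (2 * r + 1) * Y ω) * D ω ^ 1) P :=
    (((hNm.pow _).mul hYm).mul (hDm.pow 1)).integrable
  have i2 : Integrable (fun ω => (N ω ^ (2 * r) * Y ω ^ 2) * D ω ^ 2) P :=
    (((hNm.pow _).mul (hYm.pow 2)).mul (hDm.pow 2)).integrable
  have i3 : Integrable (fun ω => Y ω ^ (2 * r + 2) * D ω ^ (2 * r + 2)) P :=
    ((hYm.pow _).mul (hDm.pow _)).integrable
  -- The linear term vanishes: the increment is centred and independent of `F s`.
  have e1 : ∫ ω, (N ω ^ (2 * r + 1) * Y ω) * D ω ^ 1 ∂P = 0 := by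
    rw [hW.integral_mul_incr_pow hst (N := fun ω => N ω ^ (2 * r + 1) * Y ω)
      ((hN.pow _).mul hY), hW.integral_incr_pow hst,
      gaussMoment_one]
    simp
  have e2 : ∫ ω, (N ω ^ (2 * r) * Y ω ^ 2) * D ω ^ 2 ∂P
      = (∫ ω, N ω ^ (2 * r) * Y ω ^ 2 ∂P) * (d * gaussMoment 2) := by
    rw [hW.integral_mul_incr_pow hst (N := fun ω => N ω ^ (2 * r) * Y ω ^ 2)
      ((hN.pow _).mul (hY.pow 2)),
      show (2 : ℕ) = 2 * 0 + 2 by rfl, hW.integral_incr_pow_even hst]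
    simp [hd]
  have e3 : ∫ ω, Y ω ^ (2 * r + 2) * D ω ^ (2 * r + 2) ∂P
      = (∫ ω, Y ω ^ (2 * r + 2) ∂P) * (d ^ (r + 1) * gaussMoment (2 * r + 2)) := by
    rw [hW.integral_mul_incr_pow hst (N := fun ω => Y ω ^ (2 * r + 2)) (hY.pow _),
      hW.integral_incr_pow_even hst]
  -- Young's inequality is applied to `N ^ 2` and `L * Y ^ 2`. With this weight the step contributes
  -- a factor `(t - s) / L`, and these factors add up to one over a grid of length `L`.
  have b2 : L * ∫ ω, N ω ^ (2 * r) * Y ω ^ 2 ∂P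
      ≤ (∫ ω, N ω ^ (2 * r + 2) ∂P) + L ^ (r + 1) * ∫ ω, Y ω ^ (2 * r + 2) ∂P := by
    rw [← integral_const_mul, ← integral_const_mul, ← integral_add iN (iY.const_mul _)]
    refine integral_mono (((hNm.pow _).mul (hYm.pow 2)).integrable.const_mul L)
      (iN.add (iY.const_mul _)) fun ω => ?_
    have h := young_pow (sq_nonneg (N ω)) (by positivity : 0 ≤ L * Y ω ^ 2) r 1
    calc L * (N ω ^ (2 * r) * Y ω ^ 2) = (N ω ^ 2) ^ r * (L * Y ω ^ 2) ^ 1 := by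
          rw [← pow_mul]; ring
      _ ≤ _ := h
      _ = _ := by rw [mul_pow, ← pow_mul, ← pow_mul]; ring_nf
  have b3 : d ^ (r + 1) ≤ d / L * L ^ (r + 1) := by
    have : d ^ r ≤ L ^ r := pow_le_pow_left₀ hd0 hsL r
    calc d ^ (r + 1) = d * d ^ r := by ring
      _ ≤ d * L ^ r := by gcongr
      _ = _ := by rw [pow_succ]; field_simp
  have main : ∫ ω, (N ω + Y ω * D ω) ^ (2 * r + 2) ∂P ≤
      ∫ ω, N ω ^ (2 * r + 2) ∂P
        + (2 * r + 2) * ∫ ω, (N ω ^ (2 * r + 1) * Y ω) * D ω ^ 1 ∂P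
        + 2 ^ (2 * r + 2) * ((∫ ω, (N ω ^ (2 * r) * Y ω ^ 2) * D ω ^ 2 ∂P)
          + ∫ ω, Y ω ^ (2 * r + 2) * D ω ^ (2 * r + 2) ∂P) := by
    have i4 := iN.add (i1.const_mul (2 * r + 2))
    have i5 := (i2.add i3).const_mul (2 ^ (2 * r + 2))
    rw [← integral_const_mul, ← integral_add i2 i3, ← integral_const_mul,
      ← integral_add iN (i1.const_mul _)]
    refine le_of_le_of_eq ?_ (integral_add i4 i5)
    refine integral_mono ((hNm.add (hYm.mul hDm)).pow _).integrable (i4.add i5) fun ω => ?_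
    have h := add_pow_even_le (N ω) (Y ω * D ω) r
    refine h.trans (le_of_eq ?_)
    simp only [mul_pow, pow_one]
    ring
  rw [e1, e2, e3] at main
  have c2 : (∫ ω, N ω ^ (2 * r) * Y ω ^ 2 ∂P) * (d * gaussMoment 2)
      ≤ ((∫ ω, N ω ^ (2 * r + 2) ∂P) + L ^ (r + 1) * ∫ ω, Y ω ^ (2 * r + 2) ∂P)
        * (d / L * gaussMoment 2) := by
    calc _ = (L * ∫ ω, N ω ^ (2 * r) * Y ω ^ 2 ∂P) * (d / L * gaussMoment 2) := by
          field_simp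
      _ ≤ _ := by gcongr
  have c3 : (∫ ω, Y ω ^ (2 * r + 2) ∂P) * (d ^ (r + 1) * gaussMoment (2 * r + 2))
      ≤ ((∫ ω, N ω ^ (2 * r + 2) ∂P) + L ^ (r + 1) * ∫ ω, Y ω ^ (2 * r + 2) ∂P)
        * (d / L * gaussMoment (2 * r + 2)) := by
    calc _ ≤ (∫ ω, Y ω ^ (2 * r + 2) ∂P) * (d / L * L ^ (r + 1) * gaussMoment (2 * r + 2)) := by
          gcongr
      _ = (L ^ (r + 1) * ∫ ω, Y ω ^ (2 * r + 2) ∂P) * (d / L * gaussMoment (2 * r + 2)) := by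
          ring
      _ ≤ _ := by
          gcongr
          linarith
  refine main.trans ?_
  have h4 : (0 : ℝ) ≤ 2 ^ (2 * r + 2) := by positivity
  have h5 := mul_le_mul_of_nonneg_left (add_le_add c2 c3) h4
  linarith

end IsBrownianOn

end Brownian

/-! ### Processes with controlled moments and their trapezoidal sums -/

section HasMoments

variable {Ω : Type*} {mΩ : MeasurableSpace Ω} {T : ℝ} {P : Measure Ω}
  {F : Filtration (Time T) mΩ} {W : Time T → Ω → ℝ}

/-- An adapted process all of whose moments are bounded, and whose increments have the moments of
a `1/2`-Hölder process. -/
structure HasMoments (P : Measure Ω) (F : Filtration (Time T) mΩ) (Y : Time T → Ω → ℝ) :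
    Prop where
  adapted : StronglyAdapted F Y
  moments : ∀ t, AllMoments P (Y t)
  bound : ∀ r : ℕ, ∃ C, 0 ≤ C ∧ ∀ t, ∫ ω, Y t ω ^ (2 * r + 2) ∂P ≤ C
  incr : ∀ r : ℕ, ∃ C, 0 ≤ C ∧ ∀ s t : Time T, s ≤ t →
    ∫ ω, (Y t ω - Y s ω) ^ (2 * r + 2) ∂P ≤ C * ((t : ℝ) - s) ^ (r + 1)

theorem HasMoments.const [IsProbabilityMeasure P] (c : ℝ) :
    HasMoments P F fun _ _ => c where
  adapted := fun _ => stronglyMeasurable_const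
  moments := fun _ => AllMoments.const c
  bound := fun r => ⟨c ^ (2 * r + 2), (even_exponent r).pow_nonneg c, fun t => by simp⟩
  incr := fun r => ⟨0, le_rfl, fun s t _ => by simp⟩

/-- `Z` has the increments of a Brownian motion with drift. -/
def HasDriftIncr (W : Time T → Ω → ℝ) (a b : ℝ) (Z : Time T → Ω → ℝ) : Prop :=
  ∀ s t ω, Z t ω - Z s ω = a * ((t : ℝ) - s) + b * (W t ω - W s ω)

theorem HasDriftIncr.allMoments_incr [IsProbabilityMeasure P] (hW : IsBrownianOn P F W) {a b : ℝ}
    {Z : Time T → Ω → ℝ} (hZ : HasDriftIncr W a b Z) {s t : Time T} (hst : s ≤ t) :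
    AllMoments P fun ω => Z t ω - Z s ω := by
  simp only [hZ s t]
  exact (AllMoments.const _).add ((hW.allMoments_incr hst).const_mul b)

theorem Time.sub_le (s t : Time T) : (t : ℝ) - s ≤ T := by
  have := t.2.2
  have := s.2.1
  linarith

/-- The Brownian part scales like `(t - s) ^ (r + 1)`. The drift scales like the square of that, and
one factor is absorbed into `|T| ^ (r + 1)`. The constant is chosen before `Z`, so it serves all
processes with the same `a` and `b`. -/
theorem HasDriftIncr.integral_incr_pow_le [IsProbabilityMeasure P] (hW : IsBrownianOn P F W)
    (a b : ℝ) (r : ℕ) :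
    ∃ C, 0 ≤ C ∧ ∀ Z : Time T → Ω → ℝ, HasDriftIncr W a b Z → ∀ s t : Time T, s ≤ t →
      ∫ ω, (Z t ω - Z s ω) ^ (2 * r + 2) ∂P ≤ C * ((t : ℝ) - s) ^ (r + 1) := by
  have ha := (even_exponent r).pow_nonneg a
  have hb := (even_exponent r).pow_nonneg b
  have hg := gaussMoment_even_nonneg r
  refine ⟨2 ^ (2 * r + 1) * (a ^ (2 * r + 2) * |T| ^ (r + 1)
    + b ^ (2 * r + 2) * gaussMoment (2 * r + 2)), by positivity, fun Z hZ s t hst => ?_⟩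
  have hd0 : 0 ≤ (t : ℝ) - s := sub_nonneg.2 hst
  have hdT : (t : ℝ) - s ≤ |T| := (Time.sub_le s t).trans (le_abs_self T)
  have i1 := ((hW.allMoments_incr hst).pow (2 * r + 2)).integrable
  calc ∫ ω, (Z t ω - Z s ω) ^ (2 * r + 2) ∂P
      ≤ ∫ ω, 2 ^ (2 * r + 1) * ((a * ((t : ℝ) - s)) ^ (2 * r + 2)
          + b ^ (2 * r + 2) * (W t ω - W s ω) ^ (2 * r + 2)) ∂P := by
        refine integral_mono ((hZ.allMoments_incr hW hst).pow _).integrable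
          (((integrable_const _).add (i1.const_mul _)).const_mul _) fun ω => ?_
        have h := add_pow_even_le_two (a * ((t : ℝ) - s)) (b * (W t ω - W s ω)) r
        simpa only [hZ s t ω, mul_pow b] using h
    _ = 2 ^ (2 * r + 1) * (a ^ (2 * r + 2) * (((t : ℝ) - s) ^ (r + 1) * ((t : ℝ) - s) ^ (r + 1))
          + b ^ (2 * r + 2) * (((t : ℝ) - s) ^ (r + 1) * gaussMoment (2 * r + 2))) := by
        rw [integral_const_mul, integral_add (integrable_const _) (i1.const_mul _),
          integral_const_mul, hW.integral_incr_pow_even hst]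
        simp only [integral_const, probReal_univ, one_smul, mul_pow]
        rw [← pow_add]
        ring_nf
    _ ≤ 2 ^ (2 * r + 1) * (a ^ (2 * r + 2) * (|T| ^ (r + 1) * ((t : ℝ) - s) ^ (r + 1))
          + b ^ (2 * r + 2) * (((t : ℝ) - s) ^ (r + 1) * gaussMoment (2 * r + 2))) := by
        gcongr
    _ = _ := by ring

/-- A finite piece of a partition of `[0, T]` with `n` steps of equal length. -/
structure IsGrid (ρ : ℕ → Time T) (n : ℕ) (L : ℝ) : Prop where
  pos : 0 < n
  length_pos : 0 < L
  mono : Monotone ρ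
  step : ∀ k < n, (ρ (k + 1) : ℝ) - ρ k = L / n

/-- By Jensen the sum costs `n ^ (2r+1)` times `n` terms of size `(L / n) ^ (2r+2)`, so the powers
of `n` cancel. -/
theorem integral_sum_pow_le {n : ℕ} (hn : 0 < n) {L D : ℝ} {x : ℕ → Ω → ℝ} {r : ℕ}
    [IsProbabilityMeasure P]
    (hx : ∀ k < n, AllMoments P (x k))
    (hxb : ∀ k < n, ∫ ω, x k ω ^ (2 * r + 2) ∂P ≤ D * (L / n) ^ (2 * r + 2)) :
    ∫ ω, (∑ k ∈ Finset.range n, x k ω) ^ (2 * r + 2) ∂P ≤ D * L ^ (2 * r + 2) := by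
  have hn' : (0 : ℝ) < n := by exact_mod_cast hn
  have hi : ∀ k ∈ Finset.range n, Integrable (fun ω => x k ω ^ (2 * r + 2)) P := fun k hk =>
    ((hx k (Finset.mem_range.1 hk)).pow _).integrable
  calc ∫ ω, (∑ k ∈ Finset.range n, x k ω) ^ (2 * r + 2) ∂P
      ≤ ∫ ω, (n : ℝ) ^ (2 * r + 1) * ∑ k ∈ Finset.range n, x k ω ^ (2 * r + 2) ∂P := by
        refine integral_mono ((AllMoments.sum fun k hk => hx k (Finset.mem_range.1 hk)).pow
          _).integrable ((integrable_finsetSum _ hi).const_mul _) fun ω => ?_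
        exact sum_pow_le_card_pow_mul hn (fun k => x k ω) r
    _ = (n : ℝ) ^ (2 * r + 1) * ∑ k ∈ Finset.range n, ∫ ω, x k ω ^ (2 * r + 2) ∂P := by
        rw [integral_const_mul, integral_finsetSum _ hi]
    _ ≤ (n : ℝ) ^ (2 * r + 1) * ∑ k ∈ Finset.range n, D * (L / n) ^ (2 * r + 2) := by
        gcongr with k hk
        exact hxb k (Finset.mem_range.1 hk)
    _ = D * L ^ (2 * r + 2) := by
        rw [Finset.sum_const, Finset.card_range, nsmul_eq_mul, div_pow, pow_succ (n : ℝ) (2 * r + 1)]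
        field_simp

/-- Even moments of the left-point sums against Brownian motion. -/
theorem HasMoments.integral_ito_sum_le [IsProbabilityMeasure P] (hW : IsBrownianOn P F W)
    {Y : Time T → Ω → ℝ} (hY : HasMoments P F Y) (r : ℕ) {B : ℝ} (hB0 : 0 ≤ B)
    (hB : ∀ t, ∫ ω, Y t ω ^ (2 * r + 2) ∂P ≤ B) {ρ : ℕ → Time T} {n : ℕ} {L : ℝ}
    (hρ : IsGrid ρ n L) :
    ∫ ω, (∑ k ∈ Finset.range n, Y (ρ k) ω * (W (ρ (k + 1)) ω - W (ρ k) ω)) ^ (2 * r + 2) ∂P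
      ≤ L ^ (r + 1) * B
        * Real.exp (2 ^ (2 * r + 2) * (gaussMoment 2 + gaussMoment (2 * r + 2))) := by
  have hn := hρ.pos
  have hL := hρ.length_pos
  have hn' : (0 : ℝ) < n := by exact_mod_cast hn
  have g2 : 0 ≤ gaussMoment 2 := gaussMoment_even_nonneg 0
  have gr := gaussMoment_even_nonneg r
  set S : ℕ → Ω → ℝ := fun j ω =>
    ∑ k ∈ Finset.range j, Y (ρ k) ω * (W (ρ (k + 1)) ω - W (ρ k) ω) with hS
  have hSm : ∀ j, AllMoments P (S j) := fun j => AllMoments.sum fun k _ =>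
    (hY.moments _).mul (hW.allMoments_incr (hρ.mono (Nat.le_succ k)))
  have hSa : ∀ j, StronglyMeasurable[F (ρ j)] (S j) := by
    intro j
    refine Finset.stronglyMeasurable_fun_sum _ fun k hk => ?_
    have hk' : k + 1 ≤ j := Finset.mem_range.1 hk
    have m1 := (hY.adapted (ρ k)).mono (F.mono (hρ.mono (Nat.le_of_lt hk')))
    have m2 := (hW.adapted (ρ k)).mono (F.mono (hρ.mono (Nat.le_of_lt hk')))
    have m3 := (hW.adapted (ρ (k + 1))).mono (F.mono (hρ.mono hk'))
    exact m1.mul (m3.sub m2)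
  -- The moments of the partial sums satisfy the Gronwall recursion with `K = L ^ (r + 1) * B`; the
  -- empty sum starts it at zero.
  refine discrete_gronwall (a := fun j => ∫ ω, S j ω ^ (2 * r + 2) ∂P) (by positivity)
    (by positivity) hn (by simp [hS]) fun k hk => ?_
  have hstep := hρ.step k hk
  have hdiv : L / n / L = 1 / n := by field_simp
  have h := hW.moment_step (hρ.mono (Nat.le_succ k)) (hSa k) (hY.adapted (ρ k)) (hSm k)
    (hY.moments (ρ k)) hL (by
      rw [hstep]; exact div_le_self hL.le (by exact_mod_cast hn)) r
  rw [hstep, hdiv] at h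
  have e : ∀ ω, S (k + 1) ω = S k ω + Y (ρ k) ω * (W (ρ (k + 1)) ω - W (ρ k) ω) := fun ω => by
    simp only [hS, Finset.sum_range_succ]
  simp only [e]
  refine h.trans ?_
  rw [mul_one_div]
  gcongr
  exact hB _

/-- Even moments of the trapezoidal sums over a grid of length `L` are `O(L^(r+1))`, uniformly in
the grid. -/
theorem HasMoments.integral_trapezoid_sum_le [IsProbabilityMeasure P] (hW : IsBrownianOn P F W)
    {Y : Time T → Ω → ℝ} (hY : HasMoments P F Y) (a b : ℝ) (r : ℕ) :
    ∃ C, 0 ≤ C ∧ ∀ Z : Time T → Ω → ℝ, HasDriftIncr W a b Z →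
      ∀ (ρ : ℕ → Time T) (n : ℕ) (L : ℝ), IsGrid ρ n L → L ≤ T →
      ∫ ω, (∑ k ∈ Finset.range n, (Y (ρ k) ω + Y (ρ (k + 1)) ω) / 2
          * (Z (ρ (k + 1)) ω - Z (ρ k) ω)) ^ (2 * r + 2) ∂P ≤ C * L ^ (r + 1) := by
  obtain ⟨B, hB0, hB⟩ := hY.bound r
  -- The index `2r+1` gives moments of order `4r+4`, twice `2r+2`, as needed for products of
  -- increments of `Y` and `Z`.
  obtain ⟨CY, hCY0, hCY⟩ := hY.incr (2 * r + 1)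
  obtain ⟨CZ, hCZ0, hCZ⟩ := HasDriftIncr.integral_incr_pow_le hW a b (2 * r + 1)
  set E := Real.exp (2 ^ (2 * r + 2) * (gaussMoment 2 + gaussMoment (2 * r + 2))) with hE
  have hb := (even_exponent r).pow_nonneg b
  have ha := (even_exponent r).pow_nonneg a
  refine ⟨2 ^ (2 * r + 1) * (b ^ (2 * r + 2) * (B * E)
    + 2 ^ (2 * r + 1) * ((a ^ (2 * r + 2) * B + (CY + CZ)) * |T| ^ (r + 1))), by positivity,
    fun Z hZ ρ n L hρ hLT => ?_⟩
  have hn := hρ.pos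
  have hL := hρ.length_pos
  have hn' : (0 : ℝ) < n := by exact_mod_cast hn
  have hLT' : L ≤ |T| := hLT.trans (le_abs_self T)
  have hmono : ∀ k, ρ k ≤ ρ (k + 1) := fun k => hρ.mono (Nat.le_succ k)
  have mY : ∀ k, AllMoments P fun ω => Y (ρ (k + 1)) ω - Y (ρ k) ω := fun k =>
    (hY.moments _).sub (hY.moments _)
  have mZ : ∀ k, AllMoments P fun ω => Z (ρ (k + 1)) ω - Z (ρ k) ω := fun k =>
    hZ.allMoments_incr hW (hmono k)
  set S1 : Ω → ℝ := fun ω =>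
    ∑ k ∈ Finset.range n, Y (ρ k) ω * (W (ρ (k + 1)) ω - W (ρ k) ω) with hS1
  set S2 : Ω → ℝ := fun ω => ∑ k ∈ Finset.range n, (a * (L / n)) * Y (ρ k) ω with hS2
  set S3 : Ω → ℝ := fun ω => ∑ k ∈ Finset.range n,
    1 / 2 * ((Y (ρ (k + 1)) ω - Y (ρ k) ω) * (Z (ρ (k + 1)) ω - Z (ρ k) ω)) with hS3
  have m1 : AllMoments P S1 := AllMoments.sum fun k _ =>
    (hY.moments _).mul (hW.allMoments_incr (hmono k))
  have m2 : AllMoments P S2 := AllMoments.sum fun k _ => (hY.moments _).const_mul _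
  have m3 : AllMoments P S3 := AllMoments.sum fun k _ => ((mY k).mul (mZ k)).const_mul _
  -- Stratonovich to Itô at the discrete level: `S1` is the left-point sum against `W`, `S2` the
  -- drift, `S3` half the discrete bracket. The last two have moments of order `L ^ (2r+2)`, better
  -- than required.
  have hsplit : ∀ ω, ∑ k ∈ Finset.range n, (Y (ρ k) ω + Y (ρ (k + 1)) ω) / 2
      * (Z (ρ (k + 1)) ω - Z (ρ k) ω) = b * S1 ω + (S2 ω + S3 ω) := by
    intro ω
    simp only [hS1, hS2, hS3]
    rw [Finset.mul_sum, ← Finset.sum_add_distrib, ← Finset.sum_add_distrib]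
    refine Finset.sum_congr rfl fun k hk => ?_
    have h1 := hZ (ρ k) (ρ (k + 1)) ω
    rw [hρ.step k (Finset.mem_range.1 hk)] at h1
    have h2 : Y (ρ k) ω * (Z (ρ (k + 1)) ω - Z (ρ k) ω)
        = Y (ρ k) ω * (a * (L / n) + b * (W (ρ (k + 1)) ω - W (ρ k) ω)) := by rw [h1]
    linear_combination h2
  have b1 : ∫ ω, S1 ω ^ (2 * r + 2) ∂P ≤ L ^ (r + 1) * B * E :=
    hY.integral_ito_sum_le hW r hB0 hB hρ
  have b2 : ∫ ω, S2 ω ^ (2 * r + 2) ∂P ≤ (a ^ (2 * r + 2) * B) * L ^ (2 * r + 2) := by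
    refine integral_sum_pow_le hn (fun k _ => (hY.moments _).const_mul _) fun k _ => ?_
    simp only [mul_pow _ (Y (ρ k) _)]
    rw [integral_const_mul, mul_pow]
    calc _ ≤ a ^ (2 * r + 2) * (L / n) ^ (2 * r + 2) * B := by
          gcongr
          exact hB _
      _ = _ := by ring
  have b3 : ∫ ω, S3 ω ^ (2 * r + 2) ∂P ≤ (CY + CZ) * L ^ (2 * r + 2) := by
    refine integral_sum_pow_le hn (fun k _ => ((mY k).mul (mZ k)).const_mul _) fun k hk => ?_
    have iY := ((mY k).pow (2 * (2 * r + 1) + 2)).integrable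
    have iZ := ((mZ k).pow (2 * (2 * r + 1) + 2)).integrable
    have hY' := hCY _ _ (hmono k)
    have hZ' := hCZ Z hZ _ _ (hmono k)
    rw [hρ.step k hk] at hY' hZ'
    calc ∫ ω, (1 / 2 * ((Y (ρ (k + 1)) ω - Y (ρ k) ω) * (Z (ρ (k + 1)) ω - Z (ρ k) ω)))
          ^ (2 * r + 2) ∂P
        ≤ ∫ ω, (Y (ρ (k + 1)) ω - Y (ρ k) ω) ^ (2 * (2 * r + 1) + 2)
          + (Z (ρ (k + 1)) ω - Z (ρ k) ω) ^ (2 * (2 * r + 1) + 2) ∂P := by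
          refine integral_mono ((((mY k).mul (mZ k)).const_mul _).pow _).integrable (iY.add iZ)
            fun ω => ?_
          generalize Y (ρ (k + 1)) ω - Y (ρ k) ω = y
          generalize Z (ρ (k + 1)) ω - Z (ρ k) ω = z
          have h := young_pow (sq_nonneg y) (sq_nonneg z) (r + 1) (r + 1)
          have hh : (1 / 2 : ℝ) ^ (2 * r + 2) ≤ 1 := pow_le_one₀ (by norm_num) (by norm_num)
          have h0 : 0 ≤ (y ^ 2) ^ (r + 1) * (z ^ 2) ^ (r + 1) := by positivity
          calc (1 / 2 * (y * z)) ^ (2 * r + 2)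
              = (1 / 2) ^ (2 * r + 2) * ((y ^ 2) ^ (r + 1) * (z ^ 2) ^ (r + 1)) := by
                rw [← pow_mul, ← pow_mul, mul_pow, mul_pow, show 2 * (r + 1) = 2 * r + 2 by ring]
            _ ≤ (y ^ 2) ^ (r + 1) * (z ^ 2) ^ (r + 1) := mul_le_of_le_one_left h0 hh
            _ ≤ _ := h
            _ = _ := by
                rw [← pow_mul, ← pow_mul,
                  show 2 * (r + 1 + (r + 1)) = 2 * (2 * r + 1) + 2 by ring]
      _ = _ := integral_add iY iZ
      _ ≤ CY * (L / n) ^ (2 * r + 1 + 1) + CZ * (L / n) ^ (2 * r + 1 + 1) := add_le_add hY' hZ'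
      _ = _ := by ring
  have i1 := (m1.pow (2 * r + 2)).integrable
  have i2 := (m2.pow (2 * r + 2)).integrable
  have i3 := (m3.pow (2 * r + 2)).integrable
  have i23 := (i2.add i3).const_mul (2 ^ (2 * r + 1))
  simp only [hsplit]
  calc ∫ ω, (b * S1 ω + (S2 ω + S3 ω)) ^ (2 * r + 2) ∂P
      ≤ ∫ ω, 2 ^ (2 * r + 1) * (b ^ (2 * r + 2) * S1 ω ^ (2 * r + 2)
          + 2 ^ (2 * r + 1) * (S2 ω ^ (2 * r + 2) + S3 ω ^ (2 * r + 2))) ∂P := by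
        refine integral_mono (((m1.const_mul b).add (m2.add m3)).pow _).integrable
          (((i1.const_mul _).add i23).const_mul _) fun ω => ?_
        refine (add_pow_even_le_two (b * S1 ω) (S2 ω + S3 ω) r).trans ?_
        have := add_pow_even_le_two (S2 ω) (S3 ω) r
        simp only [mul_pow b (S1 ω)]
        gcongr
    _ = 2 ^ (2 * r + 1) * (b ^ (2 * r + 2) * (∫ ω, S1 ω ^ (2 * r + 2) ∂P)
          + 2 ^ (2 * r + 1) * ((∫ ω, S2 ω ^ (2 * r + 2) ∂P) + ∫ ω, S3 ω ^ (2 * r + 2) ∂P)) := by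
        rw [integral_const_mul]
        congr 1
        refine (integral_add (i1.const_mul _) i23).trans ?_
        rw [integral_const_mul]
        congr 1
        refine (integral_const_mul _ _).trans ?_
        congr 1
        exact integral_add i2 i3
    _ ≤ 2 ^ (2 * r + 1) * (b ^ (2 * r + 2) * (L ^ (r + 1) * B * E)
          + 2 ^ (2 * r + 1) * ((a ^ (2 * r + 2) * B) * L ^ (2 * r + 2)
            + (CY + CZ) * L ^ (2 * r + 2))) := by gcongr
    _ = 2 ^ (2 * r + 1) * (b ^ (2 * r + 2) * (L ^ (r + 1) * B * E)
          + 2 ^ (2 * r + 1) * ((a ^ (2 * r + 2) * B + (CY + CZ)) * (L ^ (r + 1) * L ^ (r + 1))))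
          := by
        rw [← pow_add, show r + 1 + (r + 1) = 2 * r + 2 by ring]
        ring
    _ ≤ 2 ^ (2 * r + 1) * (b ^ (2 * r + 2) * (L ^ (r + 1) * B * E)
          + 2 ^ (2 * r + 1) * ((a ^ (2 * r + 2) * B + (CY + CZ)) * (|T| ^ (r + 1) * L ^ (r + 1))))
          := by gcongr
    _ = _ := by ring

end HasMoments

namespace Market

variable {Ω : Type*} [mΩ : MeasurableSpace Ω] (m : Market Ω)

/-! ### Partitions containing two prescribed times -/

/-- The map that is `0` before `0`, `1` after `1`, and linear in between. -/
def ramp (x : ℝ) : ℝ := max 0 (min x 1)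

theorem ramp_of_nonpos {x : ℝ} (h : x ≤ 0) : ramp x = 0 :=
  max_eq_left ((min_le_left _ _).trans h)

theorem ramp_of_one_le {x : ℝ} (h : 1 ≤ x) : ramp x = 1 := by simp [ramp, h]

theorem ramp_of_mem {x : ℝ} (h0 : 0 ≤ x) (h1 : x ≤ 1) : ramp x = x := by simp [ramp, h0, h1]

theorem ramp_mono : Monotone ramp := fun x y h => by unfold ramp; gcongr

theorem ramp_nonneg (x : ℝ) : 0 ≤ ramp x := le_max_left _ _

theorem ramp_le_one (x : ℝ) : ramp x ≤ 1 := max_le zero_le_one (min_le_right _ _)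

theorem ramp_sub_le {x y : ℝ} (h : x ≤ y) : ramp y - ramp x ≤ y - x := by
  unfold ramp
  rcases le_total y 1 with h1 | h1 <;> rcases le_total x 1 with h2 | h2 <;>
  rcases le_total y 0 with h3 | h3 <;> rcases le_total x 0 with h4 | h4 <;>
  simp [h1, h2, h3, h4] <;> linarith

/-- The piecewise linear path through `0, s, t, T`, at the times `0, 1, 2, 3`. -/
def blockPath (s t : Time m.T) (x : ℝ) : ℝ :=
  s * ramp x + ((t : ℝ) - s) * ramp (x - 1) + (m.T - t) * ramp (x - 2)

theorem blockPath_mono {s t : Time m.T} (hst : s ≤ t) : Monotone (m.blockPath s t) := by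
  intro x y h
  have h1 : (0 : ℝ) ≤ s := s.2.1
  have h2 : (0 : ℝ) ≤ (t : ℝ) - s := sub_nonneg.2 hst
  have h3 : (0 : ℝ) ≤ m.T - t := sub_nonneg.2 t.2.2
  unfold blockPath
  gcongr <;> exact ramp_mono (by linarith)

theorem blockPath_mem {s t : Time m.T} (hst : s ≤ t) (x : ℝ) :
    m.blockPath s t x ∈ Set.Icc 0 m.T := by
  have h1 : (0 : ℝ) ≤ s := s.2.1
  have h2 : (0 : ℝ) ≤ (t : ℝ) - s := sub_nonneg.2 hst
  have h3 : (0 : ℝ) ≤ m.T - t := sub_nonneg.2 t.2.2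
  have e1 := ramp_nonneg x
  have e2 := ramp_nonneg (x - 1)
  have e3 := ramp_nonneg (x - 2)
  have f1 := mul_le_of_le_one_right h1 (ramp_le_one x)
  have f2 := mul_le_of_le_one_right h2 (ramp_le_one (x - 1))
  have f3 := mul_le_of_le_one_right h3 (ramp_le_one (x - 2))
  unfold blockPath
  exact ⟨by positivity, by linarith⟩

theorem blockPath_sub_le {s t : Time m.T} (hst : s ≤ t) {x y : ℝ} (h : x ≤ y) :
    m.blockPath s t y - m.blockPath s t x ≤ m.T * (y - x) := by
  have h1 : (0 : ℝ) ≤ s := s.2.1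
  have h2 : (0 : ℝ) ≤ (t : ℝ) - s := sub_nonneg.2 hst
  have h3 : (0 : ℝ) ≤ m.T - t := sub_nonneg.2 t.2.2
  have e1 := mul_le_mul_of_nonneg_left (ramp_sub_le h) h1
  have e2 := mul_le_mul_of_nonneg_left (ramp_sub_le (sub_le_sub_right h 1)) h2
  have e3 := mul_le_mul_of_nonneg_left (ramp_sub_le (sub_le_sub_right h 2)) h3
  unfold blockPath
  linarith

/-- The partition of `[0, T]` with `n + 1` equal steps in each of `[0, s]`, `[s, t]`, `[t, T]`. -/
def blockPartition {s t : Time m.T} (hst : s ≤ t) (n k : ℕ) : Time m.T :=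
  ⟨m.blockPath s t ((k : ℝ) / (n + 1 : ℕ)), m.blockPath_mem hst _⟩

theorem blockPartition_mono {s t : Time m.T} (hst : s ≤ t) (n : ℕ) :
    Monotone (m.blockPartition hst n) := fun k l h => by
  refine m.blockPath_mono hst ?_
  gcongr

theorem blockPartition_mid {s t : Time m.T} (hst : s ≤ t) (n : ℕ) {j : ℕ} (hj : j ≤ n + 1) :
    (m.blockPartition hst n (n + 1 + j) : ℝ) = s + ((t : ℝ) - s) * (j / (n + 1 : ℕ)) := by
  have hn : (0 : ℝ) < (n + 1 : ℕ) := by positivity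
  have hj' : (j : ℝ) / (n + 1 : ℕ) ≤ 1 := by
    rw [div_le_one hn]
    exact_mod_cast hj
  have hj0 : 0 ≤ (j : ℝ) / (n + 1 : ℕ) := by positivity
  have e : ((n + 1 + j : ℕ) : ℝ) / (n + 1 : ℕ) = 1 + j / (n + 1 : ℕ) := by
    rw [Nat.cast_add (n + 1) j, add_div, div_self hn.ne']
  change m.blockPath s t (((n + 1 + j : ℕ) : ℝ) / (n + 1 : ℕ)) = _
  rw [e]
  unfold blockPath
  rw [ramp_of_one_le (by linarith), ramp_of_mem (by linarith) (by linarith),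
    ramp_of_nonpos (by linarith)]
  ring

theorem blockPartition_left {s t : Time m.T} (hst : s ≤ t) (n : ℕ) :
    m.blockPartition hst n (n + 1) = s := by
  have h := m.blockPartition_mid hst n (Nat.zero_le (n + 1))
  exact Subtype.ext (by simpa using h)

theorem blockPartition_right {s t : Time m.T} (hst : s ≤ t) (n : ℕ) :
    m.blockPartition hst n (n + 1 + (n + 1)) = t := by
  have h := m.blockPartition_mid hst n (le_refl (n + 1))
  rw [div_self (by positivity)] at h
  exact Subtype.ext (by simpa using h)

theorem blockPartition_isPartition {s t : Time m.T} (hst : s ≤ t) (n : ℕ) :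
    m.IsPartition (m.blockPartition hst n) (n + 1 + (n + 1) + (n + 1)) := by
  refine ⟨m.blockPartition_mono hst n, Subtype.ext ?_, Subtype.ext ?_⟩
  · change m.blockPath s t (((0 : ℕ) : ℝ) / (n + 1 : ℕ)) = 0
    unfold blockPath
    rw [ramp_of_nonpos (by simp), ramp_of_nonpos (by simp), ramp_of_nonpos (by simp)]
    ring
  · change m.blockPath s t (((n + 1 + (n + 1) + (n + 1) : ℕ) : ℝ) / (n + 1 : ℕ)) = m.T
    have hn : ((n + 1 : ℕ) : ℝ) ≠ 0 := by positivity
    have e : ((n + 1 + (n + 1) + (n + 1) : ℕ) : ℝ) / (n + 1 : ℕ) = 3 := by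
      rw [Nat.cast_add, Nat.cast_add (n + 1) (n + 1)]
      field_simp
      norm_num
    rw [e]
    unfold blockPath
    rw [ramp_of_one_le (by norm_num), ramp_of_one_le (by norm_num), ramp_of_one_le (by norm_num)]
    ring

theorem blockPartition_mesh {s t : Time m.T} (hst : s ≤ t) (n k : ℕ) :
    (m.blockPartition hst n (k + 1) : ℝ) - m.blockPartition hst n k ≤ m.T * (1 / (n + 1 : ℕ)) := by
  have h : (k : ℝ) / (n + 1 : ℕ) ≤ ((k + 1 : ℕ) : ℝ) / (n + 1 : ℕ) := by gcongr; simp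
  refine (m.blockPath_sub_le hst h).trans (le_of_eq ?_)
  push_cast
  ring

theorem blockPartition_isGrid {s t : Time m.T} (hst : s < t) (n : ℕ) :
    IsGrid (fun k => m.blockPartition hst.le n (n + 1 + k)) (n + 1) ((t : ℝ) - s) where
  pos := Nat.succ_pos n
  length_pos := sub_pos.2 hst
  mono := fun k l h => m.blockPartition_mono hst.le n (by gcongr)
  step := fun k hk => by
    rw [m.blockPartition_mid hst.le n (by omega : k + 1 ≤ n + 1),
      m.blockPartition_mid hst.le n (by omega : k ≤ n + 1)]
    push_cast
    ring

theorem t0_le (t : Time m.T) : m.t0 ≤ t := t.2.1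

/-- The increment over `[s, t]` of the trapezoidal sums along a partition that contains `s` and
`t` is the trapezoidal sum over `[s, t]`. -/
theorem trapezoid_sub (Y Z : Time m.T → Ω → ℝ) {τ : ℕ → Time m.T} (hτ : Monotone τ) (N : ℕ)
    (ω : Ω) :
    m.trapezoid m.t0 Y Z τ (N + N + N) (τ (N + N)) ω - m.trapezoid m.t0 Y Z τ (N + N + N) (τ N) ω
      = ∑ k ∈ Finset.range N, (Y (τ (N + k)) ω + Y (τ (N + (k + 1))) ω) / 2
          * (Z (τ (N + (k + 1))) ω - Z (τ (N + k)) ω) := by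
  unfold trapezoid
  have hmax : ∀ t, max m.t0 t = t := fun t => max_eq_right (m.t0_le t)
  simp only [hmax]
  rw [Finset.sum_range_add _ (N + N) N, Finset.sum_range_add _ N N,
    Finset.sum_range_add _ (N + N) N, Finset.sum_range_add _ N N]
  have hle : ∀ {k l}, k ≤ l → min (τ k) (τ l) = τ k := fun h => min_eq_left (hτ h)
  have hge : ∀ {k l}, l ≤ k → min (τ k) (τ l) = τ l := fun h => min_eq_right (hτ h)
  -- Terms of the first block agree in the two sums, those of the second survive only for the later
  -- time, and those of the third vanish because both endpoints are stopped.
  have a1 : ∀ k ∈ Finset.range N,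
      (Y (min (τ k) (τ (N + N))) ω + Y (min (τ (k + 1)) (τ (N + N))) ω) / 2
          * (Z (min (τ (k + 1)) (τ (N + N))) ω - Z (min (τ k) (τ (N + N))) ω)
        = (Y (min (τ k) (τ N)) ω + Y (min (τ (k + 1)) (τ N)) ω) / 2
          * (Z (min (τ (k + 1)) (τ N)) ω - Z (min (τ k) (τ N)) ω) := by
    intro k hk
    have hk' := Finset.mem_range.1 hk
    rw [hle (by omega : k ≤ N + N), hle (by omega : k + 1 ≤ N + N), hle (by omega : k ≤ N),
      hle (by omega : k + 1 ≤ N)]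
  have a2 : ∀ k ∈ Finset.range N,
      (Y (min (τ (N + k)) (τ N)) ω + Y (min (τ (N + k + 1)) (τ N)) ω) / 2
          * (Z (min (τ (N + k + 1)) (τ N)) ω - Z (min (τ (N + k)) (τ N)) ω) = 0 := by
    intro k _
    rw [hge (by omega : N ≤ N + k), hge (by omega : N ≤ N + k + 1)]
    ring
  have a3 : ∀ l, l ≤ N + N → ∀ k ∈ Finset.range N,
      (Y (min (τ (N + N + k)) (τ l)) ω + Y (min (τ (N + N + k + 1)) (τ l)) ω) / 2
          * (Z (min (τ (N + N + k + 1)) (τ l)) ω - Z (min (τ (N + N + k)) (τ l)) ω) = 0 := by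
    intro l hl k _
    rw [hge (by omega : l ≤ N + N + k), hge (by omega : l ≤ N + N + k + 1)]
    ring
  have a4 : ∀ k ∈ Finset.range N,
      (Y (min (τ (N + k)) (τ (N + N))) ω + Y (min (τ (N + k + 1)) (τ (N + N))) ω) / 2
          * (Z (min (τ (N + k + 1)) (τ (N + N))) ω - Z (min (τ (N + k)) (τ (N + N))) ω)
        = (Y (τ (N + k)) ω + Y (τ (N + (k + 1))) ω) / 2
          * (Z (τ (N + (k + 1))) ω - Z (τ (N + k)) ω) := by
    intro k hk
    have hk' := Finset.mem_range.1 hk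
    rw [hle (by omega : N + k ≤ N + N), hle (by omega : N + k + 1 ≤ N + N), add_assoc]
  rw [Finset.sum_congr rfl a1, Finset.sum_eq_zero a2, Finset.sum_eq_zero (a3 _ le_rfl),
    Finset.sum_eq_zero (a3 N (by omega)), Finset.sum_congr rfl a4]
  ring

theorem trapezoid_t0 (Y Z : Time m.T → Ω → ℝ) (τ : ℕ → Time m.T) (N : ℕ) (ω : Ω) :
    m.trapezoid m.t0 Y Z τ N m.t0 ω = 0 := by
  unfold trapezoid
  simp [min_eq_right (m.t0_le _)]

/-! ### Stratonovich integrals have controlled moments -/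

/-- Two successive extractions make both sequences converge almost everywhere. A subsequence is
enough for the Fatou argument. -/
theorem tendstoInMeasure_sub {P : Measure Ω} [IsFiniteMeasure P] {f g : ℕ → Ω → ℝ} {f' g' : Ω → ℝ}
    (hf : TendstoInMeasure P f atTop f') (hg : TendstoInMeasure P g atTop g')
    (hfg : ∀ n, AEStronglyMeasurable (fun ω => f n ω - g n ω) P) :
    ∃ ns : ℕ → ℕ, TendstoInMeasure P (fun k ω => f (ns k) ω - g (ns k) ω) atTop
      fun ω => f' ω - g' ω := by
  obtain ⟨ns, hns, h1⟩ := hf.exists_seq_tendsto_ae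
  obtain ⟨ms, hms, h2⟩ := (hg.comp hns.tendsto_atTop).exists_seq_tendsto_ae
  refine ⟨fun k => ns (ms k), tendstoInMeasure_of_tendsto_ae (fun n => hfg _) ?_⟩
  filter_upwards [h1, h2] with ω e1 e2
  exact (e1.comp hms.tendsto_atTop).sub e2

/-- The partitions are chosen to contain `s` and `t` with equal steps between them, so that `I t - I
s` is a limit in probability of trapezoidal sums over grids of length `t - s`. Their moment bounds
are uniform in the grid and survive by Fatou's lemma. -/
theorem hasMoments_of_isStratonovich {Y Z I : Time m.T → Ω → ℝ} {a b : ℝ}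
    (hY : HasMoments m.P m.F Y) (hZ : HasDriftIncr m.W a b Z)
    (hI : m.IsStratonovich m.t0 Y Z I) : HasMoments m.P m.F I := by
  have hmeshlim : ∀ s t : Time m.T, ∀ hst : s ≤ t, ∀ δ : ℝ, 0 < δ → ∀ᶠ n in atTop,
      ∀ k < n + 1 + (n + 1) + (n + 1),
      ((m.blockPartition hst n (k + 1) : ℝ) - m.blockPartition hst n k) < δ := by
    intro s t hst δ hδ
    have hl : Tendsto (fun n : ℕ => m.T * (1 / ((n + 1 : ℕ) : ℝ))) atTop (𝓝 0) := by
      have := (tendsto_one_div_add_atTop_nhds_zero_nat (𝕜 := ℝ)).const_mul m.T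
      simpa using this
    filter_upwards [hl.eventually (gt_mem_nhds hδ)] with n hn k _
    exact (m.blockPartition_mesh hst n k).trans_lt hn
  have hlim : ∀ s t : Time m.T, ∀ hst : s ≤ t, ∀ r,
      TendstoInMeasure m.P (fun n => m.trapezoid m.t0 Y Z (m.blockPartition hst n)
        (n + 1 + (n + 1) + (n + 1)) r) atTop (I r) := fun s t hst r =>
    hI.limit (fun n => m.blockPartition hst n) (fun n => n + 1 + (n + 1) + (n + 1))
      (fun n => m.blockPartition_isPartition hst n) (hmeshlim s t hst) r
  -- The integral starts at zero almost surely, which turns bounds on increments into bounds on `I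
  -- t` itself.
  have hI0 : I m.t0 =ᵐ[m.P] fun _ => 0 := by
    refine tendstoInMeasure_ae_unique (hlim m.t0 m.t0 le_rfl m.t0) ?_
    have e : (fun n => m.trapezoid m.t0 Y Z (m.blockPartition (le_refl m.t0) n)
        (n + 1 + (n + 1) + (n + 1)) m.t0) = fun _ _ => 0 := by
      funext n ω
      exact m.trapezoid_t0 _ _ _ _ _
    rw [e]
    exact tendstoInMeasure_of_tendsto_ae (fun n => aestronglyMeasurable_const)
      (Eventually.of_forall fun ω => tendsto_const_nhds)
  have key : ∀ r : ℕ, ∃ C, 0 ≤ C ∧ ∀ s t : Time m.T, s ≤ t →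
      MemLp (fun ω => I t ω - I s ω) ((2 * r + 2 : ℕ) : ENNReal) m.P ∧
      ∫ ω, (I t ω - I s ω) ^ (2 * r + 2) ∂m.P ≤ C * ((t : ℝ) - s) ^ (r + 1) := by
    intro r
    obtain ⟨C, hC0, hC⟩ := hY.integral_trapezoid_sum_le m.brownian a b r
    refine ⟨C, hC0, fun s t hst => ?_⟩
    -- A grid has positive length, so `s = t` is treated separately.
    rcases hst.eq_or_lt with rfl | hlt
    · simp
    · set τ := fun n => m.blockPartition hst n with hτ
      have hdiff : ∀ n ω, m.trapezoid m.t0 Y Z (τ n) (n + 1 + (n + 1) + (n + 1)) t ω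
          - m.trapezoid m.t0 Y Z (τ n) (n + 1 + (n + 1) + (n + 1)) s ω
          = ∑ k ∈ Finset.range (n + 1), (Y (τ n (n + 1 + k)) ω + Y (τ n (n + 1 + (k + 1))) ω) / 2
            * (Z (τ n (n + 1 + (k + 1))) ω - Z (τ n (n + 1 + k)) ω) := by
        intro n ω
        have h := m.trapezoid_sub Y Z (m.blockPartition_mono hst n) (n + 1) ω
        rw [m.blockPartition_right hst n, m.blockPartition_left hst n] at h
        exact h
      have hmono : ∀ n, Monotone (τ n) := fun n => m.blockPartition_mono hst n
      have hmom : ∀ n, AllMoments m.P fun ω =>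
          m.trapezoid m.t0 Y Z (τ n) (n + 1 + (n + 1) + (n + 1)) t ω
          - m.trapezoid m.t0 Y Z (τ n) (n + 1 + (n + 1) + (n + 1)) s ω := by
        intro n
        simp only [hdiff]
        refine AllMoments.sum fun k _ => AllMoments.mul ?_
          (hZ.allMoments_incr m.brownian (hmono n (by omega)))
        have := ((hY.moments (τ n (n + 1 + k))).add (hY.moments (τ n (n + 1 + (k + 1))))).const_mul
          (1 / 2)
        convert this using 2
        ring
      obtain ⟨ns, hns⟩ := tendstoInMeasure_sub (hlim s t hst t) (hlim s t hst s)
        fun n => (hmom n).aestronglyMeasurable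
      refine memLp_of_tendstoInMeasure (fun n => hmom (ns n) _) (fun n => ?_) hns
      have h := hC Z hZ _ _ _ (m.blockPartition_isGrid hlt (ns n)) (Time.sub_le s t)
      calc _ = _ := by
            refine integral_congr_ae (Eventually.of_forall fun ω => ?_)
            simp only
            rw [hdiff]
        _ ≤ _ := h
  have hIt : ∀ t, (fun ω => I t ω - I m.t0 ω) =ᵐ[m.P] I t := fun t => by
    filter_upwards [hI0] with ω hω
    rw [hω, sub_zero]
  refine ⟨hI.adapted, fun t => ?_, fun r => ?_, fun r => ?_⟩
  · refine AllMoments.congr (AllMoments.of_even fun r => ?_) (hIt t)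
    obtain ⟨C, -, hC⟩ := key r
    exact (hC m.t0 t (m.t0_le t)).1
  · obtain ⟨C, hC0, hC⟩ := key r
    refine ⟨C * m.T ^ (r + 1), mul_nonneg hC0 (pow_nonneg m.T_pos.le _), fun t => ?_⟩
    have h1 : ∫ ω, I t ω ^ (2 * r + 2) ∂m.P = ∫ ω, (I t ω - I m.t0 ω) ^ (2 * r + 2) ∂m.P := by
      refine integral_congr_ae ?_
      filter_upwards [hIt t] with ω hω
      exact congrArg (· ^ (2 * r + 2)) hω.symm
    rw [h1]
    refine (hC m.t0 t (m.t0_le t)).2.trans ?_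
    have := Time.sub_le m.t0 t
    have h2 : 0 ≤ (t : ℝ) - m.t0 := sub_nonneg.2 (m.t0_le t)
    gcongr
  · obtain ⟨C, hC0, hC⟩ := key r
    exact ⟨C, hC0, fun s t hst => (hC s t hst).2⟩

/-! ### The signature of the unaffected price -/

theorem augmented_hasDriftIncr (hnu : m.nu = 0) (θ : Time m.T → Ω → ℝ) (i : Letter) :
    HasDriftIncr m.W (if i = time then 1 else m.mu) (if i = time then 0 else m.sigma)
      (m.augmented θ i) := by
  intro s t ω
  unfold augmented
  split_ifs
  · ring
  · simp only [Pr, S, hnu]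
    ring

/-- If the integral does not exist its default value is zero, which has controlled moments as well.
-/
theorem stratonovich_hasMoments {Y Z : Time m.T → Ω → ℝ} {a b : ℝ}
    (hY : HasMoments m.P m.F Y) (hZ : HasDriftIncr m.W a b Z) :
    HasMoments m.P m.F (m.stratonovich m.t0 Y Z) := by
  unfold stratonovich
  split_ifs with h
  · exact m.hasMoments_of_isStratonovich hY hZ h.choose_spec
  · exact HasMoments.const 0

theorem stratonovich_continuous (u : Time m.T) (Y Z : Time m.T → Ω → ℝ) (ω : Ω) :
    Continuous fun t => m.stratonovich u Y Z t ω := by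
  unfold stratonovich
  split_ifs with h
  · exact h.choose_spec.continuous ω
  · exact continuous_const

theorem sigWord_hasMoments (hnu : m.nu = 0) (θ : Time m.T → Ω → ℝ) (w : Word) :
    HasMoments m.P m.F (m.sigWord θ m.t0 w) := by
  induction w with
  | nil => exact HasMoments.const 1
  | cons i v ih => exact m.stratonovich_hasMoments ih (m.augmented_hasDriftIncr hnu θ i)

theorem sigWord_continuous (θ : Time m.T → Ω → ℝ) (u : Time m.T) (w : Word) (ω : Ω) :
    Continuous fun t => m.sigWord θ u w t ω := by
  cases w with
  | nil => exact continuous_const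
  | cons i v => exact m.stratonovich_continuous _ _ _ ω

/-- The augmented price does not involve the speed when `ν = 0`, and the version selected by
`stratonovich` is a function of its arguments. Hence the equality is exact, with no null set. -/
theorem sigWord_congr (hnu : m.nu = 0) (θ φ : Time m.T → Ω → ℝ) (u : Time m.T) (w : Word) :
    m.sigWord θ u w = m.sigWord φ u w := by
  have haug : ∀ i, m.augmented θ i = m.augmented φ i := by
    intro i
    funext t ω
    simp [augmented, Pr, hnu]
  induction w with
  | nil => rfl
  | cons i v ih =>
    change m.stratonovich u (m.sigWord θ u v) (m.augmented θ i)
      = m.stratonovich u (m.sigWord φ u v) (m.augmented φ i)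
    rw [ih, haug]

theorem delta_congr (hnu : m.nu = 0) (ξ : Tensor) (θ φ : Time m.T → Ω → ℝ) :
    m.delta ξ θ = m.delta ξ φ := by
  funext t ω
  have : m.sig θ m.t0 t ω = m.sig φ m.t0 t ω := by
    funext w
    simp only [sig, m.sigWord_congr hnu θ φ]
  simp only [delta, this]

end Market

/-! ### The coefficients of the frictionless delta -/

theorem tmul_smul (c d : ℝ) (l p : Tensor) : tmul (c • l) (d • p) = (c * d) • tmul l p := by
  funext w
  simp only [tmul, Pi.smul_apply, smul_eq_mul, Finset.mul_sum]
  exact Finset.sum_congr rfl fun k _ => by ring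

theorem tpow_smul (c : ℝ) (l : Tensor) (k : ℕ) : tpow (c • l) k = c ^ k • tpow l k := by
  induction k with
  | zero => simp [tpow]
  | succ k ih => rw [tpow, ih, tmul_smul, ← pow_succ, tpow]

/-- Without constant term every factor of the power consumes at least one letter. -/
theorem tpow_eq_zero {l : Tensor} (hl : l [] = 0) :
    ∀ (k : ℕ) (w : Word), w.length < k → tpow l k w = 0
  | 0, w, h => absurd h (Nat.not_lt_zero _)
  | k + 1, w, h => by
    simp only [tpow, tmul]
    refine Finset.sum_eq_zero fun j hj => ?_
    rw [Finset.mem_range] at hj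
    cases j with
    | zero => simp [hl]
    | succ j =>
      rw [tpow_eq_zero hl k _ (by rw [List.length_drop]; omega), zero_mul]

/-- The exponential series stops at the length of the word, so each coefficient is a polynomial in
`c`; this gives continuity in time of the expected signature. -/
theorem texp_smul_apply {l : Tensor} (hl : l [] = 0) (c : ℝ) (w : Word) :
    texp (c • l) w
      = ∑ k ∈ Finset.range (w.length + 1), c ^ k * tpow l k w / (k.factorial : ℝ) := by
  unfold texp
  rw [tsum_eq_sum (s := Finset.range (w.length + 1))]
  · simp only [tpow_smul, Pi.smul_apply, smul_eq_mul]
  · intro k hk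
    rw [Finset.mem_range, not_lt] at hk
    rw [tpow_smul, Pi.smul_apply, tpow_eq_zero hl k w hk, smul_zero, zero_div]

theorem finite_words (M : ℕ) : {w : Word | w.length ≤ M}.Finite := List.finite_length_le Letter M

/-- The words of length at most `M`. -/
def shortWords (M : ℕ) : Finset Word := (finite_words M).toFinset

theorem mem_shortWords {M : ℕ} {w : Word} : w ∈ shortWords M ↔ w.length ≤ M := by
  simp [shortWords]

namespace Market

variable {Ω : Type*} [mΩ : MeasurableSpace Ω] (m : Market Ω)

theorem continuous_expectedSig (w : Word) : Continuous fun r => m.expectedSig r w := by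
  have hl : (ofWord [time] + (m.sigma ^ 2 / 2) • ofWord [price, price]) [] = 0 := by
    simp [ofWord]
  unfold expectedSig
  simp only [texp_smul_apply hl]
  fun_prop

theorem deltaCoef_eq {ξ : Tensor} {M : ℕ} (hξ : IsTrunc M ξ) (t : Time m.T) (v : Word) :
    m.deltaCoef ξ t v
      = ∑ u ∈ shortWords M, ξ (u ++ ([price] ++ v)) * m.expectedSig (m.T - t) u := by
  refine tsum_eq_sum fun u hu => ?_
  rw [mem_shortWords, not_le] at hu
  rw [hξ _ (by rw [List.length_append]; omega), zero_mul]

theorem deltaCoef_eq_zero {ξ : Tensor} {M : ℕ} (hξ : IsTrunc M ξ) (t : Time m.T) {v : Word}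
    (hv : M < v.length) : m.deltaCoef ξ t v = 0 := by
  rw [m.deltaCoef_eq hξ]
  refine Finset.sum_eq_zero fun u _ => ?_
  rw [hξ _ (by simp only [List.length_append]; omega), zero_mul]

theorem continuous_deltaCoef {ξ : Tensor} {M : ℕ} (hξ : IsTrunc M ξ) (v : Word) :
    Continuous fun t => m.deltaCoef ξ t v := by
  simp only [m.deltaCoef_eq hξ]
  refine continuous_finsetSum _ fun u _ => continuous_const.mul ?_
  exact (m.continuous_expectedSig u).comp (continuous_const.sub continuous_subtype_val)

theorem delta_eq {ξ : Tensor} {M : ℕ} (hξ : IsTrunc M ξ) (θ : Time m.T → Ω → ℝ) (t : Time m.T)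
    (ω : Ω) :
    m.delta ξ θ t ω
      = ∑ w ∈ shortWords M, m.deltaCoef ξ t w * m.sigWord θ m.t0 w t ω := by
  refine tsum_eq_sum fun w hw => ?_
  rw [mem_shortWords, not_le] at hw
  rw [m.deltaCoef_eq_zero hξ t hw, zero_mul]

/-- Time times probability. -/
abbrev dtP : Measure (Time m.T × Ω) := (leb m.T).prod m.P

/-! ### Joint measurability and square integrability of the delta -/

variable {m}

/-- Progressive measurability is used at the terminal time, where `Set.Iic m.tT` is the whole
interval. -/
theorem stronglyMeasurable_of_progressive {f : Time m.T → Ω → ℝ}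
    (hf : IsStronglyProgressive m.F f) : StronglyMeasurable fun z : Time m.T × Ω => f z.1 z.2 := by
  have h := hf m.tT
  have hmeas : Measurable fun z : Time m.T × Ω => ((⟨z.1, z.1.2.2⟩, z.2) : Set.Iic m.tT × Ω) :=
    (measurable_fst.subtype_mk).prodMk measurable_snd
  have h2 : StronglyMeasurable fun p : Set.Iic m.tT × Ω => f p.1 p.2 := by
    refine h.mono ?_
    exact sup_le_sup le_rfl (MeasurableSpace.comap_mono (m.F.le _))
  exact h2.comp_measurable hmeas

theorem memLp_two_of_moment_bound {f : Time m.T → Ω → ℝ}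
    (hf : StronglyMeasurable fun z : Time m.T × Ω => f z.1 z.2)
    (hi : ∀ t, Integrable (fun ω => f t ω ^ 2) m.P) {C : ℝ} (hC : ∀ t, ∫ ω, f t ω ^ 2 ∂m.P ≤ C) :
    MemLp (fun z : Time m.T × Ω => f z.1 z.2) 2 m.dtP := by
  rw [memLp_two_iff_integrable_sq hf.aestronglyMeasurable]
  have hm2 : StronglyMeasurable fun z : Time m.T × Ω => f z.1 z.2 ^ 2 := hf.pow 2
  rw [integrable_prod_iff hm2.aestronglyMeasurable]
  refine ⟨Eventually.of_forall hi, ?_⟩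
  refine Integrable.of_bound hm2.norm.integral_prod_right.aestronglyMeasurable C
    (Eventually.of_forall fun t => ?_)
  simp only [Real.norm_eq_abs, abs_pow, sq_abs]
  rw [abs_of_nonneg (integral_nonneg fun _ => sq_nonneg _)]
  exact hC t

variable (m)

theorem sigWord_progressive (hnu : m.nu = 0) (θ : Time m.T → Ω → ℝ) (w : Word) :
    IsStronglyProgressive m.F (m.sigWord θ m.t0 w) :=
  (m.sigWord_hasMoments hnu θ w).adapted.isStronglyProgressive_of_continuous
    (m.sigWord_continuous θ m.t0 w)

theorem delta_stronglyMeasurable (hnu : m.nu = 0) {ξ : Tensor} {M : ℕ} (hξ : IsTrunc M ξ)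
    (θ : Time m.T → Ω → ℝ) : StronglyMeasurable fun z : Time m.T × Ω => m.delta ξ θ z.1 z.2 := by
  simp only [m.delta_eq hξ]
  refine Finset.stronglyMeasurable_fun_sum _ fun w _ => ?_
  exact ((m.continuous_deltaCoef hξ w).stronglyMeasurable.comp_measurable measurable_fst).mul
    (stronglyMeasurable_of_progressive (m.sigWord_progressive hnu θ w))

/-- The frictionless delta is square integrable when there is no permanent impact. -/
theorem delta_memLp (hnu : m.nu = 0) {ξ : Tensor} {M : ℕ} (hξ : IsTrunc M ξ)
    (θ : Time m.T → Ω → ℝ) : MemLp (fun z : Time m.T × Ω => m.delta ξ θ z.1 z.2) 2 m.dtP := by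
  simp only [m.delta_eq hξ]
  refine memLp_finsetSum _ fun w _ => ?_
  have hY := m.sigWord_hasMoments hnu θ w
  obtain ⟨C, hC0, hC⟩ := hY.bound 0
  -- The coefficient is continuous on the compact interval `[0, T]`, hence bounded.
  obtain ⟨A, hA⟩ := (isCompact_univ.image
    (continuous_abs.comp (m.continuous_deltaCoef hξ w))).bddAbove
  have hA' : ∀ t, |m.deltaCoef ξ t w| ≤ A := fun t => hA ⟨t, trivial, rfl⟩
  refine memLp_two_of_moment_bound (f := fun t ω => m.deltaCoef ξ t w * m.sigWord θ m.t0 w t ω)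
    (C := A ^ 2 * C) ?_ (fun t => (((hY.moments t).const_mul _).pow 2).integrable) fun t => ?_
  · exact ((m.continuous_deltaCoef hξ w).stronglyMeasurable.comp_measurable measurable_fst).mul
      (stronglyMeasurable_of_progressive (m.sigWord_progressive hnu θ w))
  · simp only [mul_pow]
    rw [integral_const_mul]
    have h1 : m.deltaCoef ξ t w ^ 2 ≤ A ^ 2 := sq_le_sq' (by linarith [abs_le.1 (hA' t)])
      (abs_le.1 (hA' t)).2
    have h2 : 0 ≤ ∫ ω, m.sigWord θ m.t0 w t ω ^ 2 ∂m.P := integral_nonneg fun _ => sq_nonneg _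
    exact mul_le_mul h1 (by simpa using hC t) h2 (sq_nonneg A)

end Market

/-! ### Primitives and tails of square integrable processes -/

section Processes

variable {Ω : Type*} {mΩ : MeasurableSpace Ω} {T : ℝ} {P : Measure Ω}

instance leb_nullSingleton (T : ℝ) : NullSingletonClass (leb T) where
  measure_singleton t := by
    unfold leb
    rw [(MeasurableEmbedding.subtype_coe measurableSet_Icc).comap_apply]
    simp

/-- The integral of `f` over `[0, t]`. -/
def prim (f : Time T → Ω → ℝ) (t : Time T) (ω : Ω) : ℝ := ∫ s in Set.Iic t, f s ω ∂(leb T)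

/-- The integral of `f` over `(t, T]`. -/
def tail (f : Time T → Ω → ℝ) (t : Time T) (ω : Ω) : ℝ := ∫ s in Set.Ioi t, f s ω ∂(leb T)

/-- The total mass of the time interval. -/
def lebMass (T : ℝ) : ℝ := (leb T).real Set.univ

theorem lebMass_nonneg (T : ℝ) : 0 ≤ lebMass T := measureReal_nonneg

/-- Joint strong measurability of a process. -/
abbrev JointSM {Ω : Type*} [MeasurableSpace Ω] {T : ℝ} (f : Time T → Ω → ℝ) : Prop :=
  StronglyMeasurable fun z : Time T × Ω => f z.1 z.2

/-- Square integrability of a process with respect to `dt ⊗ P`. -/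
abbrev SqInt {Ω : Type*} [MeasurableSpace Ω] {T : ℝ} (P : Measure Ω) (f : Time T → Ω → ℝ) : Prop :=
  MemLp (fun z : Time T × Ω => f z.1 z.2) 2 ((leb T).prod P)

theorem JointSM.section_left {f : Time T → Ω → ℝ} (hf : JointSM f) (ω : Ω) :
    StronglyMeasurable fun t => f t ω := hf.comp_measurable measurable_prodMk_right

theorem JointSM.section_right {f : Time T → Ω → ℝ} (hf : JointSM f) (t : Time T) :
    StronglyMeasurable (f t) := hf.comp_measurable measurable_prodMk_left

/-- The primitive is a parameter integral over the fixed space `Time T` once the upper limit is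
moved into an indicator. -/
theorem JointSM.prim {f : Time T → Ω → ℝ} (hf : JointSM f) : JointSM (prim f) := by
  have h : StronglyMeasurable fun q : (Time T × Ω) × Time T =>
      Set.indicator {q : (Time T × Ω) × Time T | q.2 ≤ q.1.1} (fun q => f q.2 q.1.2) q :=
    (hf.comp_measurable (measurable_snd.prodMk (measurable_snd.comp measurable_fst))).indicator
      (measurableSet_le measurable_snd (measurable_fst.comp measurable_fst))
  have h2 := h.integral_prod_right' (ν := leb T)
  refine (congrArg StronglyMeasurable (funext fun z => ?_)).mp h2
  rw [SigHedging.prim, ← integral_indicator measurableSet_Iic]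
  rfl

theorem JointSM.tail {f : Time T → Ω → ℝ} (hf : JointSM f) : JointSM (tail f) := by
  have h : StronglyMeasurable fun q : (Time T × Ω) × Time T =>
      Set.indicator {q : (Time T × Ω) × Time T | q.1.1 < q.2} (fun q => f q.2 q.1.2) q :=
    (hf.comp_measurable (measurable_snd.prodMk (measurable_snd.comp measurable_fst))).indicator
      (measurableSet_lt (measurable_fst.comp measurable_fst) measurable_snd)
  have h2 := h.integral_prod_right' (ν := leb T)
  refine (congrArg StronglyMeasurable (funext fun z => ?_)).mp h2
  rw [SigHedging.tail, ← integral_indicator measurableSet_Ioi]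
  rfl

/-- Cauchy–Schwarz against the constant function. -/
theorem sq_setIntegral_le {g : Time T → ℝ} (hg : MemLp g 2 (leb T)) (A : Set (Time T)) :
    (∫ s in A, g s ∂(leb T)) ^ 2 ≤ lebMass T * ∫ s, g s ^ 2 ∂(leb T) := by
  set ν := (leb T).restrict A with hν
  have hgA : MemLp g 2 ν := hg.restrict A
  have h2 : Integrable (fun s => g s ^ 2) ν := hgA.integrable_sq
  have h1 : Integrable g ν := hgA.integrable one_le_two
  set I := ∫ s, g s ∂ν with hI
  set k := ν.real Set.univ with hk
  have hk0 : 0 ≤ k := measureReal_nonneg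
  have hkm : k ≤ lebMass T := by
    simp only [hk, hν, lebMass, measureReal_restrict_apply MeasurableSet.univ]
    exact measureReal_mono (Set.inter_subset_left)
  have hsq : 0 ≤ ∫ s, g s ^ 2 ∂ν := integral_nonneg fun _ => sq_nonneg _
  have hsq' : ∫ s, g s ^ 2 ∂ν ≤ ∫ s, g s ^ 2 ∂(leb T) :=
    setIntegral_le_integral hg.integrable_sq (Eventually.of_forall fun _ => sq_nonneg _)
  -- This is `∫ (k g - I)² ≥ 0` expanded, with `k` the mass of `A`; division by `k` then gives
  -- Cauchy–Schwarz.
  have hexp : 0 ≤ k ^ 2 * (∫ s, g s ^ 2 ∂ν) - k * I ^ 2 := by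
    have h0 : 0 ≤ ∫ s, (k * g s - I) ^ 2 ∂ν := integral_nonneg fun _ => sq_nonneg _
    have e : ∫ s, (k * g s - I) ^ 2 ∂ν = k ^ 2 * (∫ s, g s ^ 2 ∂ν) - k * I ^ 2 := by
      have e1 : ∀ s, (k * g s - I) ^ 2 = k ^ 2 * g s ^ 2 - 2 * k * I * g s + I ^ 2 := fun s => by
        ring
      simp only [e1]
      have i1 := h2.const_mul (k ^ 2)
      have i2 := h1.const_mul (2 * k * I)
      refine (integral_add (i1.sub i2) (integrable_const _)).trans ?_
      refine (congrArg (· + _) (integral_sub i1 i2)).trans ?_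
      rw [integral_const_mul, integral_const_mul,
        integral_const, ← hI, ← hk, smul_eq_mul]
      ring
    rwa [e] at h0
  have hkI : I ^ 2 ≤ k * ∫ s, g s ^ 2 ∂ν := by
    rcases hk0.eq_or_lt with h | h
    · have hν0 : ν = 0 := by
        rw [hk] at h
        exact Measure.measure_univ_eq_zero.1 ((measureReal_eq_zero_iff).1 h.symm)
      simp [hI, hν0]
    · have : 0 ≤ k * (k * (∫ s, g s ^ 2 ∂ν) - I ^ 2) := by linarith
      linarith [nonneg_of_mul_nonneg_right this h]
  exact hkI.trans (mul_le_mul hkm hsq' hsq (lebMass_nonneg T))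

theorem ae_of_ae_forall {p : Time T × Ω → Prop} (h : ∀ᵐ ω ∂P, ∀ t, p (t, ω)) :
    ∀ᵐ z ∂((leb T).prod P), p z := by
  have h2 : ∀ᵐ z ∂((leb T).prod P), ∀ t, p (t, z.2) :=
    Measure.quasiMeasurePreserving_snd.ae h
  filter_upwards [h2] with z hz using hz z.1

variable [IsProbabilityMeasure P]

theorem ae_section {p : Time T × Ω → Prop} (h : ∀ᵐ z ∂((leb T).prod P), p z) :
    ∀ᵐ ω ∂P, ∀ᵐ t ∂(leb T), p (t, ω) := by
  have h2 : ∀ᵐ z ∂(P.prod (leb T)), p z.swap :=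
    (Measure.measurePreserving_swap (μ := P) (ν := leb T)).quasiMeasurePreserving.ae h
  exact Measure.ae_ae_of_ae_prod h2

theorem SqInt.ae_memLp {f : Time T → Ω → ℝ} (hj : JointSM f) (hf : SqInt P f) :
    ∀ᵐ ω ∂P, MemLp (fun t => f t ω) 2 (leb T) := by
  have h := hf.integrable_sq.swap.prod_right_ae
  filter_upwards [h] with ω hω
  rw [memLp_two_iff_integrable_sq (hj.section_left ω).aestronglyMeasurable]
  exact hω

/-- A process dominated by the square root of the time integral of the square of a square
integrable process is square integrable, also at each time. -/
theorem SqInt.of_dominated {f g : Time T → Ω → ℝ} (hf : SqInt P f) (hg : JointSM g) {c : ℝ}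
    (h : ∀ᵐ ω ∂P, ∀ t, g t ω ^ 2 ≤ c * ∫ s, f s ω ^ 2 ∂(leb T)) :
    SqInt P g ∧ ∀ t, MemLp (g t) 2 P := by
  have hi : Integrable (fun ω => c * ∫ s, f s ω ^ 2 ∂(leb T)) P :=
    (hf.integrable_sq.swap.integral_prod_left).const_mul c
  constructor
  · refine (memLp_two_iff_integrable_sq hg.aestronglyMeasurable).2 ?_
    refine Integrable.mono' (hi.comp_snd (leb T)) (hg.pow 2).aestronglyMeasurable ?_
    refine ae_of_ae_forall ?_
    filter_upwards [h] with ω hω t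
    rw [Real.norm_eq_abs, abs_of_nonneg (sq_nonneg _)]
    exact hω t
  · intro t
    refine (memLp_two_iff_integrable_sq (hg.section_right t).aestronglyMeasurable).2 ?_
    refine Integrable.mono' hi ((hg.section_right t).pow 2).aestronglyMeasurable ?_
    filter_upwards [h] with ω hω
    rw [Real.norm_eq_abs, abs_of_nonneg (sq_nonneg _)]
    exact hω t

theorem SqInt.sq_prim_le {f : Time T → Ω → ℝ} (hj : JointSM f) (hf : SqInt P f) :
    ∀ᵐ ω ∂P, ∀ t, prim f t ω ^ 2 ≤ lebMass T * ∫ s, f s ω ^ 2 ∂(leb T) := by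
  filter_upwards [hf.ae_memLp hj] with ω hω t using sq_setIntegral_le hω _

theorem SqInt.prim {f : Time T → Ω → ℝ} (hj : JointSM f) (hf : SqInt P f) :
    SqInt P (prim f) := (hf.of_dominated hj.prim (hf.sq_prim_le hj)).1

theorem SqInt.sq_tail_le {f : Time T → Ω → ℝ} (hj : JointSM f) (hf : SqInt P f) :
    ∀ᵐ ω ∂P, ∀ t, tail f t ω ^ 2 ≤ lebMass T * ∫ s, f s ω ^ 2 ∂(leb T) := by
  filter_upwards [hf.ae_memLp hj] with ω hω t using sq_setIntegral_le hω _

theorem SqInt.tail {f : Time T → Ω → ℝ} (hj : JointSM f) (hf : SqInt P f) :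
    SqInt P (tail f) := (hf.of_dominated hj.tail (hf.sq_tail_le hj)).1

theorem SqInt.tail_section {f : Time T → Ω → ℝ} (hj : JointSM f) (hf : SqInt P f) (t : Time T) :
    MemLp (SigHedging.tail f t) 2 P := (hf.of_dominated hj.tail (hf.sq_tail_le hj)).2 t

/-- The `L²` bound for primitives. -/
theorem SqInt.integral_sq_prim_le {f : Time T → Ω → ℝ} (hj : JointSM f) (hf : SqInt P f) :
    ∫ z, SigHedging.prim f z.1 z.2 ^ 2 ∂((leb T).prod P)
      ≤ lebMass T ^ 2 * ∫ z, f z.1 z.2 ^ 2 ∂((leb T).prod P) := by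
  have hi : Integrable (fun ω => lebMass T * ∫ s, f s ω ^ 2 ∂(leb T)) P :=
    (hf.integrable_sq.swap.integral_prod_left).const_mul _
  calc _ ≤ ∫ z : Time T × Ω, lebMass T * ∫ s, f s z.2 ^ 2 ∂(leb T) ∂((leb T).prod P) := by
        refine integral_mono_ae (hf.prim hj).integrable_sq (hi.comp_snd (leb T)) ?_
        exact ae_of_ae_forall (hf.sq_prim_le hj)
    _ = ∫ t, ∫ ω, lebMass T * ∫ s, f s ω ^ 2 ∂(leb T) ∂P ∂(leb T) :=
        integral_prod _ (hi.comp_snd (leb T))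
    _ = lebMass T * (lebMass T * ∫ ω, ∫ s, f s ω ^ 2 ∂(leb T) ∂P) := by
        rw [integral_const, integral_const_mul, smul_eq_mul, lebMass]
    _ = _ := by
        rw [integral_prod_symm _ hf.integrable_sq]
        ring

theorem prim_congr_ae {f g : Time T → Ω → ℝ}
    (h : ∀ᵐ z ∂((leb T).prod P), f z.1 z.2 = g z.1 z.2) :
    ∀ᵐ ω ∂P, ∀ t, prim f t ω = prim g t ω := by
  filter_upwards [ae_section h] with ω hω t
  exact integral_congr_ae (ae_restrict_of_ae hω)

theorem prim_lin {f g : Time T → Ω → ℝ} (hjf : JointSM f) (hf : SqInt P f) (hjg : JointSM g)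
    (hg : SqInt P g) (a b : ℝ) :
    ∀ᵐ ω ∂P, ∀ t, prim (fun t ω => a * f t ω + b * g t ω) t ω
      = a * prim f t ω + b * prim g t ω := by
  filter_upwards [hf.ae_memLp hjf, hg.ae_memLp hjg] with ω h1 h2 t
  have i1 := ((h1.integrable one_le_two).integrableOn (s := Set.Iic t)).const_mul a
  have i2 := ((h2.integrable one_le_two).integrableOn (s := Set.Iic t)).const_mul b
  unfold prim
  rw [integral_add i1 i2, integral_const_mul, integral_const_mul]

/-- Fubini on the triangle `t < s`. -/
theorem integral_mul_tail_section {f g : Time T → ℝ} (hf : Integrable f (leb T))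
    (hg : Integrable g (leb T)) :
    ∫ t, f t * ∫ s in Set.Ioi t, g s ∂(leb T) ∂(leb T)
      = ∫ s, g s * ∫ t in Set.Iic s, f t ∂(leb T) ∂(leb T) := by
  have hm : MeasurableSet {z : Time T × Time T | z.1 < z.2} :=
    measurableSet_lt measurable_fst measurable_snd
  have hi : Integrable (fun z : Time T × Time T =>
      Set.indicator {z : Time T × Time T | z.1 < z.2} (fun z => f z.1 * g z.2) z)
      ((leb T).prod (leb T)) := (hf.mul_prod hg).indicator hm
  have h := integral_integral_swap (f := fun t s =>
    Set.indicator {z : Time T × Time T | z.1 < z.2} (fun z => f z.1 * g z.2) (t, s)) hi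
  have e1 : ∀ t, ∫ s, Set.indicator {z : Time T × Time T | z.1 < z.2}
      (fun z => f z.1 * g z.2) (t, s) ∂(leb T) = f t * ∫ s in Set.Ioi t, g s ∂(leb T) := by
    intro t
    rw [← integral_const_mul, ← integral_indicator measurableSet_Ioi]
    rfl
  have e2 : ∀ s, ∫ t, Set.indicator {z : Time T × Time T | z.1 < z.2}
      (fun z => f z.1 * g z.2) (t, s) ∂(leb T) = g s * ∫ t in Set.Iic s, f t ∂(leb T) := by
    intro s
    -- The triangle is open, and closing it costs nothing since `leb T` has no atoms.
    rw [integral_Iic_eq_integral_Iio, ← integral_const_mul, ← integral_indicator measurableSet_Iio]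
    refine integral_congr_ae (Eventually.of_forall fun t => ?_)
    by_cases hts : t < s
    · simp [hts, mul_comm]
    · simp [hts]
  simp only [e1, e2] at h
  exact h

/-- Integration by parts between primitives and tails. -/
theorem integral_mul_tail {f g : Time T → Ω → ℝ} (hjf : JointSM f) (hf : SqInt P f)
    (hjg : JointSM g) (hg : SqInt P g) :
    ∫ z, f z.1 z.2 * tail g z.1 z.2 ∂((leb T).prod P)
      = ∫ z, g z.1 z.2 * prim f z.1 z.2 ∂((leb T).prod P) := by
  have i1 : Integrable (fun z : Time T × Ω => f z.1 z.2 * tail g z.1 z.2) ((leb T).prod P) :=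
    hf.integrable_mul (hg.tail hjg)
  have i2 : Integrable (fun z : Time T × Ω => g z.1 z.2 * prim f z.1 z.2) ((leb T).prod P) :=
    hg.integrable_mul (hf.prim hjf)
  rw [integral_prod_symm _ i1, integral_prod_symm _ i2]
  refine integral_congr_ae ?_
  filter_upwards [hf.ae_memLp hjf, hg.ae_memLp hjg] with ω h1 h2
  exact integral_mul_tail_section (h1.integrable one_le_two) (h2.integrable one_le_two)

end Processes

/-! ### The curve in `L¹` of a jointly measurable process -/

section Curve

variable {Ω : Type*} {mΩ : MeasurableSpace Ω} {α : Type*}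

open Classical in
/-- The class of `f t` in `L¹(P)`, set to zero if `f t` is not integrable. -/
def curve (P : Measure Ω) (f : α → Ω → ℝ) (t : α) : Ω →₁[P] ℝ :=
  if h : Integrable (f t) P then h.toL1 (f t) else 0

variable {P : Measure Ω}

theorem curve_of_integrable {f : α → Ω → ℝ} {t : α} (h : Integrable (f t) P) :
    curve P f t = h.toL1 (f t) := dif_pos h

theorem curve_of_not_integrable {f : α → Ω → ℝ} {t : α} (h : ¬ Integrable (f t) P) :
    curve P f t = 0 := dif_neg h

/-- The index types may differ, so that a class independent of time can be written as a curve over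
`Unit`. -/
theorem curve_congr {β : Type*} {f : α → Ω → ℝ} {g : β → Ω → ℝ} {t : α} {u : β}
    (h : f t = g u) : curve P f t = curve P g u := by
  classical
  have key : ∀ a b : Ω → ℝ, a = b → (if h : Integrable a P then h.toL1 a else 0)
      = if h : Integrable b P then h.toL1 b else 0 := by
    rintro a _ rfl
    rfl
  exact key _ _ h

theorem curve_zero (t : α) : curve P (fun _ _ => (0 : ℝ)) t = 0 := by
  rw [curve_of_integrable (f := fun _ _ => (0 : ℝ)) (integrable_zero Ω ℝ P)]
  exact Integrable.toL1_zero _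

theorem curve_coeFn {f : α → Ω → ℝ} {t : α} (h : Integrable (f t) P) :
    curve P f t =ᵐ[P] f t := by
  rw [curve_of_integrable h]
  exact h.coeFn_toL1

theorem curve_add {f g : α → Ω → ℝ} {t : α} (hf : Integrable (f t) P) (hg : Integrable (g t) P) :
    curve P (fun t ω => f t ω + g t ω) t = curve P f t + curve P g t := by
  have h : Integrable ((fun t ω => f t ω + g t ω) t) P := hf.add hg
  rw [curve_of_integrable hf, curve_of_integrable hg, curve_of_integrable h]
  exact Integrable.toL1_add _ _ hf hg

theorem curve_const_mul {f : α → Ω → ℝ} {t : α} (c : ℝ) (hf : Integrable (f t) P) :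
    curve P (fun t ω => c * f t ω) t = c • curve P f t := by
  have h : Integrable ((fun t ω => c * f t ω) t) P := hf.const_mul c
  rw [curve_of_integrable hf, curve_of_integrable h]
  exact Integrable.toL1_smul _ hf c

theorem norm_curve {f : α → Ω → ℝ} {t : α} (hf : Integrable (f t) P) :
    ‖curve P f t‖ = ∫ ω, |f t ω| ∂P := by
  rw [curve_of_integrable hf, L1.norm_eq_integral_norm]
  refine integral_congr_ae ?_
  filter_upwards [hf.coeFn_toL1] with ω hω
  rw [hω, Real.norm_eq_abs]

/-- Dominated convergence for curves. -/
theorem tendsto_curve {f : ℕ → α → Ω → ℝ} {g : α → Ω → ℝ} {G : Ω → ℝ} {t : α}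
    (hG : Integrable G P) (hf : ∀ n, AEStronglyMeasurable (f n t) P)
    (hb : ∀ n ω, |f n t ω| ≤ G ω) (hlim : ∀ ω, Tendsto (fun n => f n t ω) atTop (𝓝 (g t ω))) :
    Tendsto (fun n => curve P (f n) t) atTop (𝓝 (curve P g t)) := by
  have hfi : ∀ n, Integrable (f n t) P := fun n =>
    Integrable.mono' hG (hf n) (Eventually.of_forall (hb n))
  have hgm : AEStronglyMeasurable (g t) P :=
    aestronglyMeasurable_of_tendsto_ae atTop hf (Eventually.of_forall hlim)
  have hgb : ∀ ω, |g t ω| ≤ G ω := fun ω =>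
    le_of_tendsto ((hlim ω).abs) (Eventually.of_forall fun n => hb n ω)
  have hgi : Integrable (g t) P := Integrable.mono' hG hgm (Eventually.of_forall hgb)
  rw [tendsto_iff_norm_sub_tendsto_zero]
  have e : ∀ n, ‖curve P (f n) t - curve P g t‖ = ∫ ω, |f n t ω - g t ω| ∂P := by
    intro n
    rw [L1.norm_eq_integral_norm]
    refine integral_congr_ae ?_
    filter_upwards [Lp.coeFn_sub (curve P (f n) t) (curve P g t), curve_coeFn (hfi n),
      curve_coeFn hgi] with ω h1 h2 h3
    rw [h1, Pi.sub_apply, h2, h3, Real.norm_eq_abs]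
  simp only [e]
  have h := tendsto_integral_of_dominated_convergence (F := fun n ω => |f n t ω - g t ω|)
    (f := fun _ => 0) (fun ω => G ω + G ω) (fun n => ((hf n).sub hgm).norm) (hG.add hG)
    (fun n => Eventually.of_forall fun ω => by
      rw [Real.norm_eq_abs, abs_abs]
      exact (abs_sub _ _).trans (add_le_add (hb n ω) (hgb ω)))
    (Eventually.of_forall fun ω => by
      have := ((hlim ω).sub_const (g t ω)).abs
      simpa using this)
  simpa using h

/-- The continuous linear form `g ↦ ∫_A g dP` on `L¹(P)`. -/
def setIntegralForm (P : Measure Ω) (A : Set Ω) : (Ω →₁[P] ℝ) →L[ℝ] ℝ :=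
  LinearMap.mkContinuous
    { toFun := fun g => ∫ ω in A, g ω ∂P
      map_add' := fun g h => by
        rw [← integral_add (L1.integrable_coeFn g).integrableOn (L1.integrable_coeFn h).integrableOn]
        exact integral_congr_ae (ae_restrict_of_ae (Lp.coeFn_add g h))
      map_smul' := fun c g => by
        rw [RingHom.id_apply, smul_eq_mul, ← integral_const_mul]
        exact integral_congr_ae (ae_restrict_of_ae (Lp.coeFn_smul c g)) }
    1 fun g => by
      rw [one_mul, L1.norm_eq_integral_norm]
      refine (norm_integral_le_integral_norm _).trans ?_
      exact setIntegral_le_integral (L1.integrable_coeFn g).norm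
        (Eventually.of_forall fun _ => norm_nonneg _)

theorem setIntegralForm_apply (A : Set Ω) (g : Ω →₁[P] ℝ) :
    setIntegralForm P A g = ∫ ω in A, g ω ∂P := rfl

theorem setIntegralForm_curve (A : Set Ω) {f : α → Ω → ℝ} {t : α} (h : Integrable (f t) P) :
    setIntegralForm P A (curve P f t) = ∫ ω in A, f t ω ∂P :=
  integral_congr_ae (ae_restrict_of_ae (curve_coeFn h))

variable [MeasurableSpace α] [IsFiniteMeasure P]

/-- Separability of `L¹(P)` is not assumed, so strong measurability is not deduced from weak
measurability. The Dynkin argument starts from rectangles, whose curves take at most two values;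
complements are affine operations and disjoint unions are limits by dominated convergence. -/
theorem stronglyMeasurable_curve_indicator {S : Set (α × Ω)} (hS : MeasurableSet S) :
    StronglyMeasurable (curve P fun t ω => S.indicator (fun _ => (1 : ℝ)) (t, ω)) := by
  have hint : ∀ {S : Set (α × Ω)}, MeasurableSet S → ∀ t,
      Integrable (fun ω => S.indicator (fun _ => (1 : ℝ)) (t, ω)) P := by
    intro S hS t
    have hm : Measurable fun ω => S.indicator (fun _ => (1 : ℝ)) (t, ω) :=
      (measurable_const.indicator hS).comp measurable_prodMk_left
    refine Integrable.of_bound hm.aestronglyMeasurable 1 (Eventually.of_forall fun ω => ?_)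
    by_cases h : (t, ω) ∈ S <;> simp [h]
  induction S, hS using MeasurableSpace.induction_on_inter generateFrom_prod.symm
    isPiSystem_prod with
  | empty =>
    simp only [Set.indicator_empty]
    change StronglyMeasurable fun _ : α => curve P (fun (_ : Unit) (_ : Ω) => (0 : ℝ)) ()
    exact stronglyMeasurable_const
  | basic S hS =>
    obtain ⟨A, hA, B, hB, rfl⟩ := hS
    have e : (curve P fun t ω => (A ×ˢ B).indicator (fun _ => (1 : ℝ)) (t, ω))
        = A.indicator fun _ => curve P (fun (_ : Unit) ω => B.indicator (fun _ => (1 : ℝ)) ω) () := by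
      funext t
      by_cases ht : t ∈ A
      · rw [Set.indicator_of_mem ht]
        refine curve_congr (funext fun ω => ?_)
        by_cases hω : ω ∈ B <;> simp [ht, hω]
      · rw [Set.indicator_of_notMem ht, ← curve_zero (P := P) ()]
        refine curve_congr (funext fun ω => ?_)
        simp [ht]
    rw [e]
    exact stronglyMeasurable_const.indicator hA
  | compl S hS ih =>
    have e : (curve P fun t ω => Sᶜ.indicator (fun _ => (1 : ℝ)) (t, ω))
        = fun t => curve P (fun (_ : Unit) (_ : Ω) => (1 : ℝ)) ()
          + (-1 : ℝ) • curve P (fun t ω => S.indicator (fun _ => (1 : ℝ)) (t, ω)) t := by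
      funext t
      rw [← curve_const_mul (-1) (hint hS t)]
      have h1 : curve P (fun (_ : Unit) (_ : Ω) => (1 : ℝ)) ()
          = curve P (fun (_ : α) (_ : Ω) => (1 : ℝ)) t := rfl
      rw [h1, ← curve_add (integrable_const _) ((hint hS t).const_mul _)]
      refine curve_congr (funext fun ω => ?_)
      by_cases hω : (t, ω) ∈ S <;> simp [hω]
    rw [e]
    exact stronglyMeasurable_const.add (ih.const_smul (-1 : ℝ))
  | iUnion f hd hm ih =>
    have hsum : ∀ n : ℕ, StronglyMeasurable
        (curve P fun t ω => ∑ i ∈ Finset.range n, (f i).indicator (fun _ => (1 : ℝ)) (t, ω)) := by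
      intro n
      induction n with
      | zero =>
        simp only [Finset.range_zero, Finset.sum_empty]
        change StronglyMeasurable fun _ : α => curve P (fun (_ : Unit) (_ : Ω) => (0 : ℝ)) ()
        exact stronglyMeasurable_const
      | succ n ihn =>
        simp only [Finset.sum_range_succ]
        refine (congrArg StronglyMeasurable (funext fun t => ?_)).mpr (ihn.add (ih n))
        exact curve_add (integrable_finsetSum _ fun i _ => hint (hm i) t) (hint (hm n) t)
    -- By disjointness a point of the union lies in a single `f j`: the partial sums are 0 up to `n
    -- = j` and 1 afterwards, which gives both the bound by 1 and the limit.
    have hval : ∀ z, (∃ j, z ∈ f j ∧ ∀ n, ∑ i ∈ Finset.range n, (f i).indicator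
          (fun _ => (1 : ℝ)) z = if j < n then 1 else 0) ∨
        (z ∉ ⋃ i, f i) ∧ ∀ n, ∑ i ∈ Finset.range n, (f i).indicator (fun _ => (1 : ℝ)) z = 0 := by
      intro z
      by_cases hz : z ∈ ⋃ i, f i
      · obtain ⟨j, hj⟩ := Set.mem_iUnion.1 hz
        refine Or.inl ⟨j, hj, fun n => ?_⟩
        have : ∀ i, (f i).indicator (fun _ => (1 : ℝ)) z = if i = j then 1 else 0 := by
          intro i
          split_ifs with hij
          · rw [hij, Set.indicator_of_mem hj]
          · exact Set.indicator_of_notMem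
              (fun hi => Set.disjoint_left.1 (hd hij) hi hj) _
        simp [this]
      · refine Or.inr ⟨hz, fun n => Finset.sum_eq_zero fun i _ => ?_⟩
        exact Set.indicator_of_notMem (fun hi => hz (Set.mem_iUnion.2 ⟨i, hi⟩)) _
    refine stronglyMeasurable_of_tendsto atTop hsum (tendsto_pi_nhds.2 fun t => ?_)
    refine tendsto_curve (G := fun _ => 1) (integrable_const _)
      (fun n => (integrable_finsetSum _ fun i _ => hint (hm i) t).aestronglyMeasurable)
      (fun n ω => ?_) fun ω => ?_
    · rcases hval (t, ω) with ⟨j, -, h⟩ | ⟨-, h⟩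
      · rw [h]
        split_ifs <;> simp
      · simp [h]
    · rcases hval (t, ω) with ⟨j, hj, h⟩ | ⟨hz, h⟩
      · rw [Set.indicator_of_mem (Set.mem_iUnion.2 ⟨j, hj⟩)]
        refine tendsto_const_nhds.congr' ?_
        filter_upwards [eventually_gt_atTop j] with n hn
        rw [h, if_pos hn]
      · simp only [h, Set.indicator_of_notMem hz]
        exact tendsto_const_nhds

theorem SimpleFunc.integrable_section (F : SimpleFunc (α × Ω) ℝ) (t : α) :
    Integrable (fun ω => F (t, ω)) P := by
  obtain ⟨C, hC⟩ := F.exists_forall_norm_le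
  exact Integrable.of_bound (F.measurable.comp measurable_prodMk_left).aestronglyMeasurable C
    (Eventually.of_forall fun ω => hC _)

theorem stronglyMeasurable_curve_simpleFunc (F : SimpleFunc (α × Ω) ℝ) :
    StronglyMeasurable (curve P fun t ω => F (t, ω)) := by
  induction F using SimpleFunc.induction with
  | const c hs =>
    rename_i S
    refine (congrArg StronglyMeasurable (funext fun t => ?_)).mpr
      ((stronglyMeasurable_curve_indicator (P := P) hs).const_smul c)
    rw [Pi.smul_apply, ← curve_const_mul c]
    · refine curve_congr (funext fun ω => ?_)
      by_cases h : (t, ω) ∈ S <;> simp [h]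
    · have h := SimpleFunc.integrable_section (P := P) (SimpleFunc.piecewise S hs
        (SimpleFunc.const _ (1 : ℝ)) (SimpleFunc.const _ 0)) t
      refine h.congr (Eventually.of_forall fun ω => ?_)
      by_cases h : (t, ω) ∈ S <;> simp [h]
  | add _ hf hg =>
    refine (congrArg StronglyMeasurable (funext fun t => ?_)).mpr (hf.add hg)
    exact curve_add (SimpleFunc.integrable_section _ t) (SimpleFunc.integrable_section _ t)

theorem stronglyMeasurable_curve_of_forall {f : α → Ω → ℝ}
    (hf : StronglyMeasurable fun z : α × Ω => f z.1 z.2) (hi : ∀ t, Integrable (f t) P) :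
    StronglyMeasurable (curve P f) := by
  set F := fun n => SimpleFunc.approxOn (fun z : α × Ω => f z.1 z.2) hf.measurable Set.univ 0
    (Set.mem_univ 0) n with hF
  refine stronglyMeasurable_of_tendsto atTop
    (fun n => stronglyMeasurable_curve_simpleFunc (P := P) (F n)) (tendsto_pi_nhds.2 fun t => ?_)
  refine tendsto_curve (G := fun ω => |f t ω| + |f t ω|) ((hi t).abs.add (hi t).abs)
    (fun n => (SimpleFunc.integrable_section (F n) t).aestronglyMeasurable)
    (fun n ω => ?_) fun ω => ?_
  · exact SimpleFunc.norm_approxOn_zero_le hf.measurable (Set.mem_univ 0) (t, ω) n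
  · exact SimpleFunc.tendsto_approxOn hf.measurable (Set.mem_univ 0) (by simp)

open Classical in
/-- The curve in `L¹` of a jointly measurable process is strongly measurable. -/
theorem stronglyMeasurable_curve {f : α → Ω → ℝ}
    (hf : StronglyMeasurable fun z : α × Ω => f z.1 z.2) : StronglyMeasurable (curve P f) := by
  have hA : MeasurableSet {t | Integrable (f t) P} := measurableSet_integrable hf
  set g : α → Ω → ℝ := fun t ω => Set.indicator {t | Integrable (f t) P} (fun t => f t ω) t with hg
  have hgm : StronglyMeasurable fun z : α × Ω => g z.1 z.2 :=
    hf.indicator (hA.preimage measurable_fst)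
  have hgi : ∀ t, Integrable (g t) P := by
    intro t
    by_cases ht : Integrable (f t) P
    · simp [hg, Set.indicator, ht]
    · simp [hg, Set.indicator, ht]
  have e : curve P f = curve P g := by
    funext t
    by_cases ht : Integrable (f t) P
    · refine curve_congr (funext fun ω => ?_)
      simp [hg, ht]
    · rw [curve_of_not_integrable ht, ← curve_zero (P := P) ()]
      refine curve_congr (funext fun ω => ?_)
      simp [hg, ht]
  rw [e]
  exact stronglyMeasurable_curve_of_forall hgm hgi

theorem integrable_curve {μ : Measure α} [SFinite μ] {f : α → Ω → ℝ}
    (hf : StronglyMeasurable fun z : α × Ω => f z.1 z.2)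
    (hi : Integrable (fun z : α × Ω => f z.1 z.2) (μ.prod P)) :
    Integrable (curve P f) μ := by
  refine (integrable_norm_iff (stronglyMeasurable_curve hf).aestronglyMeasurable).1 ?_
  refine hi.integral_norm_prod_left.congr ?_
  filter_upwards [hi.prod_right_ae] with t ht
  exact (norm_curve ht).symm

/-- The Bochner integral of the curve of a process is the class of its pathwise integral. -/
theorem integral_curve {μ : Measure α} [SFinite μ] {f : α → Ω → ℝ}
    (hf : StronglyMeasurable fun z : α × Ω => f z.1 z.2)
    (hi : Integrable (fun z : α × Ω => f z.1 z.2) (μ.prod P)) :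
    (∫ t, curve P f t ∂μ : Ω →₁[P] ℝ) =ᵐ[P] fun ω => ∫ t, f t ω ∂μ := by
  -- Both sides are tested on sets `A`: `setIntegralForm` commutes with the Bochner integral on the
  -- left, and Fubini applies on the right.
  refine Integrable.ae_eq_of_forall_setIntegral_eq _ _ (L1.integrable_coeFn _)
    hi.integral_prod_right fun A hA _ => ?_
  have h1 := (setIntegralForm P A).integral_comp_comm (integrable_curve hf hi)
  rw [setIntegralForm_apply] at h1
  rw [← h1]
  have hiA : Integrable (fun z : α × Ω => f z.1 z.2) (μ.prod (P.restrict A)) := by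
    have := hi.integrableOn (s := Set.univ ×ˢ A)
    rwa [IntegrableOn, ← Measure.prod_restrict, Measure.restrict_univ] at this
  rw [← integral_integral_swap (f := f) hiA]
  refine integral_congr_ae ?_
  filter_upwards [hi.prod_right_ae] with t ht
  exact setIntegralForm_curve A ht

end Curve

/-! ### Lebesgue differentiation along a filtration -/

section Lebesgue

variable {Ω : Type*} {mΩ : MeasurableSpace Ω} {T : ℝ} {P : Measure Ω}

theorem map_leb (T : ℝ) : (leb T).map (Subtype.val : Time T → ℝ) = volume.restrict (Set.Icc 0 T) :=
  map_comap_subtype_coe measurableSet_Icc volume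

theorem ae_leb {T : ℝ} {p : ℝ → Prop} (h : ∀ᵐ x, p x) : ∀ᵐ t : Time T ∂(leb T), p (t : ℝ) := by
  have h2 : ∀ᵐ x ∂((leb T).map (Subtype.val : Time T → ℝ)), p x := by
    rw [map_leb]
    exact ae_restrict_of_ae h
  exact ae_of_ae_map measurable_subtype_coe.aemeasurable h2

theorem setIntegral_Icc_eq (a b : Time T) (ψ : ℝ → ℝ) :
    ∫ x in Set.Icc (a : ℝ) b, ψ x = ∫ t in Set.Icc a b, ψ t ∂(leb T) := by
  have hsub : Set.Icc (a : ℝ) b ⊆ Set.Icc 0 T := Set.Icc_subset_Icc a.2.1 b.2.2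
  have e : (volume : Measure ℝ).restrict (Set.Icc (a : ℝ) b)
      = ((leb T).map (Subtype.val : Time T → ℝ)).restrict (Set.Icc (a : ℝ) b) := by
    rw [map_leb, Measure.restrict_restrict measurableSet_Icc, Set.inter_eq_left.2 hsub]
  rw [e, (MeasurableEmbedding.subtype_coe measurableSet_Icc).setIntegral_map]
  rfl

/-- If the integrals of `D` over all rectangles `[a, b] × A` with `A ∈ F a` vanish, then for almost
all `t` the integrals of `D t` over all sets of `F t` vanish. -/
theorem ae_forall_setIntegral_eq_zero [IsFiniteMeasure P] (hT : 0 < T) {F : Filtration (Time T) mΩ}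
    {D : Time T → Ω → ℝ} (hD : JointSM D)
    (hi : Integrable (fun z : Time T × Ω => D z.1 z.2) ((leb T).prod P))
    (h : ∀ a b : Time T, a ≤ b → ∀ A, MeasurableSet[F a] A →
      ∫ t in Set.Icc a b, ∫ ω in A, D t ω ∂P ∂(leb T) = 0) :
    ∀ᵐ t ∂(leb T), ∀ A, MeasurableSet[F t] A → ∫ ω in A, D t ω ∂P = 0 := by
  -- The curve is extended by zero to the real line, where Lebesgue differentiation applies to
  -- `L¹(P)`-valued functions. Differentiating in `L¹(P)` yields one null set of times valid for all
  -- `A` at once.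
  set E : ℝ → (Ω →₁[P] ℝ) := (Set.Icc 0 T).indicator
    fun x => curve P D (Set.projIcc 0 T hT.le x) with hEdef
  have hEval : ∀ t : Time T, E t = curve P D t := fun t => by
    rw [hEdef, Set.indicator_of_mem t.2, Set.projIcc_val]
  have hE : Integrable E := by
    rw [hEdef, integrable_indicator_iff measurableSet_Icc, IntegrableOn, ← map_leb,
      (MeasurableEmbedding.subtype_coe measurableSet_Icc).integrable_map_iff]
    refine (integrable_curve hD hi).congr (Eventually.of_forall fun t => ?_)
    simp [Set.projIcc_val]
  have hleb : ∀ᵐ x : ℝ, ∀ w δ : ℕ → ℝ, Tendsto δ atTop (𝓝[>] 0) →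
      (∀ᶠ j in atTop, x ∈ Metric.closedBall (w j) (1 * δ j)) →
      Tendsto (fun j => ⨍ y in Metric.closedBall (w j) (δ j), E y) atTop (𝓝 (E x)) := by
    filter_upwards [IsUnifLocDoublingMeasure.ae_tendsto_average (volume : Measure ℝ)
      hE.locallyIntegrable 1] with x hx w δ using hx w δ
  have hne : ∀ᵐ x : ℝ, x ≠ T := by simp [ae_iff]
  filter_upwards [ae_leb (T := T) hleb, ae_leb (T := T) hne, hi.prod_right_ae] with t ht htT hti A hA
  have htlt : (t : ℝ) < T := lt_of_le_of_ne t.2.2 htT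
  -- The ball of radius `δ n` about `t + δ n` is `[t, t + 2 δ n]`: it stays below `T` and starts at
  -- `t`, so the hypothesis applies to it for every `A ∈ F t`.
  set δ : ℕ → ℝ := fun n => (T - t) / 2 * (1 / ((n : ℝ) + 1)) with hδ
  have hpos : ∀ n, 0 < δ n := fun n => by
    have : 0 < T - t := sub_pos.2 htlt
    positivity
  have hle : ∀ n, (t : ℝ) + 2 * δ n ≤ T := fun n => by
    have h1 : (1 : ℝ) / ((n : ℝ) + 1) ≤ 1 := by
      rw [div_le_one (by positivity)]
      linarith [(Nat.cast_nonneg n : (0 : ℝ) ≤ n)]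
    have h2 := mul_le_mul_of_nonneg_left h1 (by linarith : 0 ≤ (T - t) / 2)
    simp only [hδ]
    linarith
  have hδ0 : Tendsto δ atTop (𝓝[>] 0) := by
    refine tendsto_nhdsWithin_iff.2 ⟨?_, Eventually.of_forall hpos⟩
    simpa [hδ] using (tendsto_one_div_add_atTop_nhds_zero_nat (𝕜 := ℝ)).const_mul ((T - t) / 2)
  have hlim := ht (fun n => (t : ℝ) + δ n) δ hδ0 (Eventually.of_forall fun n => by
    rw [Metric.mem_closedBall, Real.dist_eq, one_mul]
    simp [abs_of_pos (hpos n)])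
  have hlim2 := ((setIntegralForm P A).continuous.tendsto (E t)).comp hlim
  have hzero : ∀ n, setIntegralForm P A (⨍ y in Metric.closedBall ((t : ℝ) + δ n) (δ n), E y) = 0 := by
    intro n
    have hball : Metric.closedBall ((t : ℝ) + δ n) (δ n)
        = Set.Icc (t : ℝ) ((⟨t + 2 * δ n, by linarith [t.2.1, hpos n], hle n⟩ : Time T) : ℝ) := by
      rw [Real.closedBall_eq_Icc]
      congr 1 <;> ring
    rw [setAverage_eq, map_smul, ← (setIntegralForm P A).integral_comp_comm hE.integrableOn, hball,
      setIntegral_Icc_eq]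
    simp only [hEval]
    have hcongr : ∀ᵐ s ∂(leb T), setIntegralForm P A (curve P D s) = ∫ ω in A, D s ω ∂P := by
      filter_upwards [hi.prod_right_ae] with s hs using setIntegralForm_curve A hs
    rw [integral_congr_ae (ae_restrict_of_ae hcongr), h t _ (by
      change (t : ℝ) ≤ t + 2 * δ n
      linarith [hpos n]) A hA, smul_zero]
  have hfin := tendsto_nhds_unique hlim2 (by
    simp only [Function.comp_def, hzero]
    exact tendsto_const_nhds)
  rw [hEval, setIntegralForm_curve A hti] at hfin
  exact hfin

end Lebesgue

/-! ### Integrals in time of conditional expectations -/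

namespace Market

variable {Ω : Type*} [mΩ : MeasurableSpace Ω] (m : Market Ω)

/-- Conditional expectation is a continuous linear map on `L¹(P)`, so it can be pulled out of the
Bochner integral, and the integral of the curve is the class of the pathwise integral. -/
theorem condInt_ae {Z : Time m.T → Ω → ℝ} (hj : JointSM Z)
    (hi : Integrable (fun z : Time m.T × Ω => Z z.1 z.2) m.dtP) (t : Time m.T) :
    m.condInt t Z =ᵐ[m.P] m.P[tail Z t | m.F t] := by
  -- At times where `Z s` is not integrable both sides take the default value zero.
  have e : ∀ s, condExpL1 (m.F.le t) m.P (Z s)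
      = condExpL1CLM ℝ (m.F.le t) m.P (curve m.P Z s) := by
    intro s
    by_cases hs : Integrable (Z s) m.P
    · rw [condExpL1_eq hs, curve_of_integrable hs]
    · rw [condExpL1_undef hs, curve_of_not_integrable hs, map_zero]
  have hir : Integrable (fun z : Time m.T × Ω => Z z.1 z.2)
      (((leb m.T).restrict (Set.Ioi t)).prod m.P) := by
    have := hi.integrableOn (s := Set.Ioi t ×ˢ Set.univ)
    rwa [IntegrableOn, dtP, ← Measure.prod_restrict, Measure.restrict_univ] at this
  have hG := integral_curve hj hir
  set G : Ω →₁[m.P] ℝ := ∫ s in Set.Ioi t, curve m.P Z s ∂(leb m.T) with hGdef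
  have e2 : m.condInt t Z = ⇑(condExpL1CLM ℝ (m.F.le t) m.P G) := by
    unfold condInt
    simp only [e]
    rw [(condExpL1CLM ℝ (m.F.le t) m.P).integral_comp_comm (integrable_curve hj hir)]
  have e3 : condExpL1CLM ℝ (m.F.le t) m.P G = condExpL1 (m.F.le t) m.P G := by
    rw [condExpL1_eq (L1.integrable_coeFn G), Integrable.toL1_coeFn]
  rw [e2, e3]
  exact (condExp_ae_eq_condExpL1 (m.F.le t) _).symm.trans (condExp_congr_ae hG)

end Market

/-! ### The Hilbert space of progressive square integrable processes -/

section Operator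

variable {Ω : Type*} {mΩ : MeasurableSpace Ω} {T : ℝ} {P : Measure Ω}

theorem inner_L2_eq {α : Type*} {mα : MeasurableSpace α} {μ : Measure α} (f g : Lp ℝ 2 μ) :
    inner ℝ f g = ∫ a, f a * g a ∂μ := by
  rw [L2.inner_def]
  refine integral_congr_ae (Eventually.of_forall fun a => ?_)
  simp [mul_comm]

theorem norm_sq_L2_eq {α : Type*} {mα : MeasurableSpace α} {μ : Measure α} (f : Lp ℝ 2 μ) :
    ‖f‖ ^ 2 = ∫ a, f a ^ 2 ∂μ := by
  rw [← real_inner_self_eq_norm_sq, inner_L2_eq]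
  simp only [sq]

/-- The process defined by a class in `L²(dt ⊗ P)`. -/
def procOf (f : Lp ℝ 2 ((leb T).prod P)) (t : Time T) (ω : Ω) : ℝ := f (t, ω)

theorem jointSM_procOf (f : Lp ℝ 2 ((leb T).prod P)) : JointSM (procOf f) :=
  Lp.stronglyMeasurable f

theorem sqInt_procOf (f : Lp ℝ 2 ((leb T).prod P)) : SqInt P (procOf f) := Lp.memLp f

variable [IsProbabilityMeasure P]

theorem sqInt_prim_procOf (f : Lp ℝ 2 ((leb T).prod P)) : SqInt P (prim (procOf f)) :=
  (sqInt_procOf f).prim (jointSM_procOf f)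

theorem toLp_prim_ae (f : Lp ℝ 2 ((leb T).prod P)) {θ : Time T → Ω → ℝ}
    (h : f =ᵐ[(leb T).prod P] fun z => θ z.1 z.2) :
    (sqInt_prim_procOf f).toLp =ᵐ[(leb T).prod P] fun z => prim θ z.1 z.2 := by
  have h2 : ∀ᵐ z ∂((leb T).prod P), prim (procOf f) z.1 z.2 = prim θ z.1 z.2 :=
    ae_of_ae_forall (prim_congr_ae (f := procOf f) h)
  filter_upwards [(sqInt_prim_procOf f).coeFn_toLp, h2] with z h3 h4
  rw [h3, h4]

theorem toLp_prim_lin (f g h : Lp ℝ 2 ((leb T).prod P)) (a b : ℝ)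
    (e : h =ᵐ[(leb T).prod P] fun z => a * f z + b * g z) :
    (sqInt_prim_procOf h).toLp
      = a • (sqInt_prim_procOf f).toLp + b • (sqInt_prim_procOf g).toLp := by
  refine Lp.ext ?_
  have h1 := toLp_prim_ae h (θ := fun t ω => a * procOf f t ω + b * procOf g t ω) e
  have h2 : ∀ᵐ z ∂((leb T).prod P), prim (fun t ω => a * procOf f t ω + b * procOf g t ω) z.1 z.2
      = a * prim (procOf f) z.1 z.2 + b * prim (procOf g) z.1 z.2 :=
    ae_of_ae_forall (prim_lin (jointSM_procOf f) (sqInt_procOf f) (jointSM_procOf g)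
      (sqInt_procOf g) a b)
  filter_upwards [h1, h2, (sqInt_prim_procOf f).coeFn_toLp, (sqInt_prim_procOf g).coeFn_toLp,
    Lp.coeFn_add (a • (sqInt_prim_procOf f).toLp) (b • (sqInt_prim_procOf g).toLp),
    Lp.coeFn_smul a (sqInt_prim_procOf f).toLp, Lp.coeFn_smul b (sqInt_prim_procOf g).toLp]
    with z e1 e2 e3 e4 e5 e6 e7
  rw [e1, e2, e5, Pi.add_apply, e6, e7, Pi.smul_apply, Pi.smul_apply, e3, e4, smul_eq_mul,
    smul_eq_mul]

/-- Integration in time, as an operator on `L²(dt ⊗ P)`. -/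
def primOp (T : ℝ) (P : Measure Ω) [IsProbabilityMeasure P] :
    Lp ℝ 2 ((leb T).prod P) →L[ℝ] Lp ℝ 2 ((leb T).prod P) :=
  LinearMap.mkContinuous
    { toFun := fun f => (sqInt_prim_procOf f).toLp
      map_add' := fun f g => by
        have := toLp_prim_lin f g (f + g) 1 1 (by
          filter_upwards [Lp.coeFn_add f g] with z hz
          rw [hz, Pi.add_apply, one_mul, one_mul])
        simpa using this
      map_smul' := fun c f => by
        have := toLp_prim_lin f f (c • f) c 0 (by
          filter_upwards [Lp.coeFn_smul c f] with z hz
          rw [hz, Pi.smul_apply, smul_eq_mul, zero_mul, add_zero])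
        simpa using this }
    (lebMass T) fun f => by
      refine abs_le_of_sq_le_sq' ?_ (mul_nonneg (lebMass_nonneg T) (norm_nonneg f)) |>.2
      rw [mul_pow, norm_sq_L2_eq, norm_sq_L2_eq]
      refine le_trans (le_of_eq (integral_congr_ae ?_))
        ((sqInt_procOf f).integral_sq_prim_le (jointSM_procOf f))
      filter_upwards [(sqInt_prim_procOf f).coeFn_toLp] with z hz
      exact congrArg (· ^ 2) hz

theorem primOp_ae (f : Lp ℝ 2 ((leb T).prod P)) {θ : Time T → Ω → ℝ}
    (h : f =ᵐ[(leb T).prod P] fun z => θ z.1 z.2) :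
    primOp T P f =ᵐ[(leb T).prod P] fun z => prim θ z.1 z.2 := toLp_prim_ae f h

/-- The classes of progressive processes. -/
def progSpace (F : Filtration (Time T) mΩ) (P : Measure Ω) :
    Submodule ℝ (Lp ℝ 2 ((leb T).prod P)) where
  carrier := {f | ∃ θ : Time T → Ω → ℝ, IsStronglyProgressive F θ ∧
    f =ᵐ[(leb T).prod P] fun z => θ z.1 z.2}
  add_mem' := by
    rintro f g ⟨θ, hθ, e⟩ ⟨φ, hφ, e'⟩
    refine ⟨fun t ω => θ t ω + φ t ω, fun i => (hθ i).add (hφ i), ?_⟩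
    filter_upwards [Lp.coeFn_add f g, e, e'] with z h1 h2 h3
    rw [h1, Pi.add_apply, h2, h3]
  zero_mem' := ⟨fun _ _ => 0, isStronglyProgressive_const F 0, Lp.coeFn_zero _ _ _⟩
  smul_mem' := by
    rintro c f ⟨θ, hθ, e⟩
    refine ⟨fun t ω => c * θ t ω, fun i => (hθ i).const_mul c, ?_⟩
    filter_upwards [Lp.coeFn_smul c f, e] with z h1 h2
    rw [h1, Pi.smul_apply, h2, smul_eq_mul]

/-- A subsequence converges almost everywhere, and the pointwise limit of progressive
representatives is progressive. Where the limit fails to exist, `limUnder` returns a default without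
spoiling measurability. -/
theorem isClosed_progSpace (F : Filtration (Time T) mΩ) (P : Measure Ω) :
    IsClosed (progSpace F P : Set (Lp ℝ 2 ((leb T).prod P))) := by
  refine IsSeqClosed.isClosed fun f g hf hfg => ?_
  choose θ hθ e using hf
  obtain ⟨ns, -, hns⟩ := (tendstoInMeasure_of_tendsto_Lp hfg).exists_seq_tendsto_ae
  refine ⟨fun t ω => limUnder atTop fun k => θ (ns k) t ω, fun i => ?_, ?_⟩
  · let _ : MeasurableSpace (Set.Iic i × Ω) := Subtype.instMeasurableSpace.prod (F i)
    exact StronglyMeasurable.limUnder fun k => hθ (ns k) i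
  · filter_upwards [hns, ae_all_iff.2 e] with z h1 h2
    simp only [h2] at h1
    exact h1.limUnder_eq.symm

/-- The Lax–Milgram theorem for the functional `c ‖v‖² + κ ‖K v‖² - 2 ⟪h, K v⟫`. -/
theorem exists_laxMilgram {V H : Type*} [NormedAddCommGroup V] [InnerProductSpace ℝ V]
    [CompleteSpace V] [NormedAddCommGroup H] [InnerProductSpace ℝ H] [CompleteSpace H]
    (K : V →L[ℝ] H) (h : H) {c κ : ℝ} (hc : 0 < c) (hκ : 0 ≤ κ) :
    ∃ v : V, ∀ w, c * inner ℝ v w + κ * inner ℝ (K v) (K w) = inner ℝ h (K w) := by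
  set B : V →L[ℝ] V →L[ℝ] ℝ := LinearMap.mkContinuous₂
    (LinearMap.mk₂ ℝ (fun v w : V => c * inner ℝ v w + κ * inner ℝ (K v) (K w))
      (fun v v' w => by simp only [map_add, inner_add_left]; ring)
      (fun a v w => by simp only [map_smul, real_inner_smul_left, smul_eq_mul]; ring)
      (fun v w w' => by simp only [map_add, inner_add_right]; ring)
      (fun a v w => by simp only [map_smul, real_inner_smul_right, smul_eq_mul]; ring))
    (c + κ * (‖K‖ * ‖K‖)) (fun v w => by
      rw [LinearMap.mk₂_apply]
      refine (norm_add_le _ _).trans ?_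
      rw [norm_mul, norm_mul, Real.norm_of_nonneg hc.le, Real.norm_of_nonneg hκ]
      have h1 := norm_inner_le_norm (𝕜 := ℝ) v w
      have h2 := norm_inner_le_norm (𝕜 := ℝ) (K v) (K w)
      have h3 := mul_le_mul (K.le_opNorm v) (K.le_opNorm w) (norm_nonneg _) (by positivity)
      have h4 := mul_le_mul_of_nonneg_left h1 hc.le
      have h5 := mul_le_mul_of_nonneg_left (h2.trans h3) hκ
      linarith) with hB
  have hBapp : ∀ v w, B v w = c * inner ℝ v w + κ * inner ℝ (K v) (K w) := fun v w => rfl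
  have hcoer : IsCoercive B := by
    refine ⟨c, hc, fun v => ?_⟩
    rw [hBapp, real_inner_self_eq_norm_sq, real_inner_self_eq_norm_sq]
    have := mul_nonneg hκ (sq_nonneg ‖K v‖)
    linarith
  -- The right-hand side is the inner product of `w` with the adjoint of `K` applied to `h`;
  -- coercivity makes the operator representing `B` invertible.
  refine ⟨hcoer.continuousLinearEquivOfBilin.symm (K.adjoint h), fun w => ?_⟩
  rw [← hBapp, ← hcoer.continuousLinearEquivOfBilin_apply,
    ContinuousLinearEquiv.apply_symm_apply, ContinuousLinearMap.adjoint_inner_left]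

/-- Solvability of the Euler equation of the control problem. -/
theorem exists_euler (F : Filtration (Time T) mΩ) {c κ : ℝ} (hc : 0 < c) (hκ : 0 ≤ κ)
    {h : Time T → Ω → ℝ} (hh : SqInt P h) :
    ∃ θ : Time T → Ω → ℝ, IsStronglyProgressive F θ ∧ SqInt P θ ∧
      ∀ u : Time T → Ω → ℝ, IsStronglyProgressive F u → SqInt P u →
        c * ∫ z, θ z.1 z.2 * u z.1 z.2 ∂((leb T).prod P)
          + κ * ∫ z, prim θ z.1 z.2 * prim u z.1 z.2 ∂((leb T).prod P)
        = ∫ z, h z.1 z.2 * prim u z.1 z.2 ∂((leb T).prod P) := by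
  have : CompleteSpace (progSpace F P) := (isClosed_progSpace F P).completeSpace_coe
  obtain ⟨v, heq⟩ := exists_laxMilgram ((primOp T P).comp (progSpace F P).subtypeL) hh.toLp hc hκ
  obtain ⟨θ, hθ, e⟩ := v.2
  refine ⟨θ, hθ, (memLp_congr_ae e).1 (Lp.memLp (v : Lp ℝ 2 ((leb T).prod P))), fun u hu hu2 => ?_⟩
  have h1 := heq ⟨hu2.toLp, u, hu, hu2.coeFn_toLp⟩
  have eu := hu2.coeFn_toLp
  have eKv := primOp_ae _ e
  have eKw := primOp_ae _ eu
  simp only [ContinuousLinearMap.comp_apply, Submodule.subtypeL_apply, Submodule.coe_inner,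
    inner_L2_eq] at h1
  have i1 := integral_congr_ae (e.mul eu)
  have i2 := integral_congr_ae (eKv.mul eKw)
  have i3 := integral_congr_ae (hh.coeFn_toLp.mul eKw)
  simp only [Pi.mul_apply] at i1 i2 i3
  rw [i1, i2, i3] at h1
  exact h1

end Operator

namespace Market

variable {Ω : Type*} [mΩ : MeasurableSpace Ω] {m : Market Ω}

/-! ### The problem without permanent impact -/

theorem exponent_eq_two (hnu : m.nu = 0) (ξ : Tensor) : m.exponent ξ = 2 := by
  simp [exponent, hnu]

theorem admissible_iff (hnu : m.nu = 0) {ξ : Tensor} {θ : Time m.T → Ω → ℝ} :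
    m.Admissible ξ θ ↔ IsStronglyProgressive m.F θ ∧ SqInt m.P θ := by
  unfold Admissible
  rw [exponent_eq_two hnu]
  rfl

theorem admNorm_sq (hnu : m.nu = 0) {ξ : Tensor} {θ : Time m.T → Ω → ℝ}
    (h : m.Admissible ξ θ) : m.admNorm ξ θ ^ 2 = ∫ z, θ z.1 z.2 ^ 2 ∂m.dtP := by
  have h2 := ((admissible_iff hnu).1 h).2
  unfold admNorm
  rw [exponent_eq_two hnu, dtP, integral_prod_symm _ h2.integrable_sq, Nat.cast_ofNat,
    ← Real.sqrt_eq_rpow]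
  exact Real.sq_sqrt (integral_nonneg fun ω => integral_nonneg fun t => sq_nonneg _)

theorem admissible_lin (hnu : m.nu = 0) {ξ : Tensor} {θ φ : Time m.T → Ω → ℝ}
    (hθ : m.Admissible ξ θ) (hφ : m.Admissible ξ φ) (a b : ℝ) :
    m.Admissible ξ fun t ω => a * θ t ω + b * φ t ω := by
  rw [admissible_iff hnu] at *
  exact ⟨fun i => ((hθ.1 i).const_mul a).add ((hφ.1 i).const_mul b),
    (hθ.2.const_mul a).add (hφ.2.const_mul b)⟩

theorem admissible_sub (hnu : m.nu = 0) {ξ : Tensor} {θ φ : Time m.T → Ω → ℝ}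
    (hθ : m.Admissible ξ θ) (hφ : m.Admissible ξ φ) :
    m.Admissible ξ fun t ω => θ t ω - φ t ω := by
  convert admissible_lin hnu hθ hφ 1 (-1) using 3
  ring

/-- The tracked delta of the inactive trader, which is that of every trader when there is no
permanent impact. -/
abbrev freeDelta (m : Market Ω) (ξ : Tensor) : Time m.T → Ω → ℝ := m.delta ξ fun _ _ => 0

section Tracking

variable {ξ : Tensor} {M : ℕ} {θ φ u : Time m.T → Ω → ℝ}

theorem jointSM_of_admissible (h : m.Admissible ξ θ) : JointSM θ :=
  stronglyMeasurable_of_progressive h.1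

theorem sqInt_of_admissible (hnu : m.nu = 0) (h : m.Admissible ξ θ) : SqInt m.P θ :=
  ((admissible_iff hnu).1 h).2

theorem jointSM_X (h : m.Admissible ξ θ) : JointSM (m.X θ) :=
  (stronglyMeasurable_const (b := m.X0)).add (jointSM_of_admissible h).prim

theorem sqInt_X (hnu : m.nu = 0) (h : m.Admissible ξ θ) : SqInt m.P (m.X θ) :=
  (memLp_const m.X0).add ((sqInt_of_admissible hnu h).prim (jointSM_of_admissible h))

theorem jointSM_freeDelta (hnu : m.nu = 0) (hξ : IsTrunc M ξ) : JointSM (m.freeDelta ξ) :=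
  m.delta_stronglyMeasurable hnu hξ _

theorem sqInt_freeDelta (hnu : m.nu = 0) (hξ : IsTrunc M ξ) : SqInt m.P (m.freeDelta ξ) :=
  m.delta_memLp hnu hξ _

/-- The marginal value of inventory, pathwise. -/
def marginal (m : Market Ω) (ξ : Tensor) (θ : Time m.T → Ω → ℝ) (t : Time m.T) (ω : Ω) : ℝ :=
  m.mu - m.lam * m.sigma ^ 2 * (m.X θ t ω - m.freeDelta ξ t ω)

theorem jointSM_marginal (hnu : m.nu = 0) (hξ : IsTrunc M ξ) (h : m.Admissible ξ θ) :
    JointSM (m.marginal ξ θ) :=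
  stronglyMeasurable_const.sub
    (((jointSM_X h).sub (jointSM_freeDelta hnu hξ)).const_mul _)

theorem sqInt_marginal (hnu : m.nu = 0) (hξ : IsTrunc M ξ) (h : m.Admissible ξ θ) :
    SqInt m.P (m.marginal ξ θ) :=
  (memLp_const m.mu).sub (((sqInt_X hnu h).sub (sqInt_freeDelta hnu hξ)).const_mul _)

/-- The gradient of `J` before conditioning. -/
def rawGrad (m : Market Ω) (ξ : Tensor) (θ : Time m.T → Ω → ℝ) (t : Time m.T) (ω : Ω) : ℝ :=
  -2 * m.eta * θ t ω + tail (m.marginal ξ θ) t ω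

theorem jointSM_rawGrad (hnu : m.nu = 0) (hξ : IsTrunc M ξ) (h : m.Admissible ξ θ) :
    JointSM (m.rawGrad ξ θ) :=
  ((jointSM_of_admissible h).const_mul _).add (jointSM_marginal hnu hξ h).tail

theorem sqInt_rawGrad (hnu : m.nu = 0) (hξ : IsTrunc M ξ) (h : m.Admissible ξ θ) :
    SqInt m.P (m.rawGrad ξ θ) :=
  ((sqInt_of_admissible hnu h).const_mul _).add
    ((sqInt_marginal hnu hξ h).tail (jointSM_marginal hnu hξ h))

/-- The derivative of `J` at `θ` in the direction `u`. -/
theorem integral_rawGrad_mul (hnu : m.nu = 0) (hξ : IsTrunc M ξ) (h : m.Admissible ξ θ)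
    (hu : m.Admissible ξ u) :
    ∫ z, m.rawGrad ξ θ z.1 z.2 * u z.1 z.2 ∂m.dtP
      = ∫ z, (m.marginal ξ θ z.1 z.2 * prim u z.1 z.2
          - 2 * m.eta * θ z.1 z.2 * u z.1 z.2) ∂m.dtP := by
  have su := sqInt_of_admissible hnu hu
  have ju := jointSM_of_admissible hu
  have sθ := sqInt_of_admissible hnu h
  have sm := sqInt_marginal hnu hξ h
  have jm := jointSM_marginal hnu hξ h
  have i1 : Integrable (fun z : Time m.T × Ω => 2 * m.eta * θ z.1 z.2 * u z.1 z.2) m.dtP :=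
    (sθ.const_mul _).integrable_mul su
  have i2 : Integrable (fun z : Time m.T × Ω => u z.1 z.2 * tail (m.marginal ξ θ) z.1 z.2) m.dtP :=
    su.integrable_mul (sm.tail jm)
  have i3 : Integrable (fun z : Time m.T × Ω => m.marginal ξ θ z.1 z.2 * prim u z.1 z.2) m.dtP :=
    sm.integrable_mul (su.prim ju)
  have e : ∀ z : Time m.T × Ω, m.rawGrad ξ θ z.1 z.2 * u z.1 z.2
      = u z.1 z.2 * tail (m.marginal ξ θ) z.1 z.2 - 2 * m.eta * θ z.1 z.2 * u z.1 z.2 := fun z => by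
    unfold rawGrad
    ring
  simp only [e]
  rw [integral_sub i2 i1, integral_sub i3 i1, integral_mul_tail ju su jm sm]

/-- The Euler equation. -/
def Euler (m : Market Ω) (ξ : Tensor) (θ : Time m.T → Ω → ℝ) : Prop :=
  ∀ u, m.Admissible ξ u → ∫ z, m.rawGrad ξ θ z.1 z.2 * u z.1 z.2 ∂m.dtP = 0

/-- The part of the marginal value that does not contain `θ` becomes the data `h`; what is left is
the bilinear form with `c = 2η` and `κ = λσ²`. -/
theorem exists_euler_admissible (hnu : m.nu = 0) (hξ : IsTrunc M ξ) :
    ∃ θ, m.Admissible ξ θ ∧ m.Euler ξ θ := by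
  have hκ : 0 ≤ m.lam * m.sigma ^ 2 := mul_nonneg m.lam_pos.le (sq_nonneg _)
  have hh : SqInt m.P fun t ω => m.mu - m.lam * m.sigma ^ 2 * (m.X0 - m.freeDelta ξ t ω) :=
    (memLp_const m.mu).sub (((memLp_const m.X0).sub (sqInt_freeDelta hnu hξ)).const_mul _)
  obtain ⟨θ, hθ, hθ2, hE⟩ := exists_euler (P := m.P) m.F (c := 2 * m.eta)
    (by linarith [m.eta_pos]) hκ hh
  have hadm : m.Admissible ξ θ := (admissible_iff hnu).2 ⟨hθ, hθ2⟩
  refine ⟨θ, hadm, fun u hu => ?_⟩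
  have su := sqInt_of_admissible hnu hu
  have ju := jointSM_of_admissible hu
  have jθ := jointSM_of_admissible hadm
  have h1 := hE u hu.1 su
  rw [integral_rawGrad_mul hnu hξ hadm hu]
  have i1 : Integrable (fun z : Time m.T × Ω => θ z.1 z.2 * u z.1 z.2) m.dtP :=
    hθ2.integrable_mul su
  have i2 : Integrable (fun z : Time m.T × Ω => prim θ z.1 z.2 * prim u z.1 z.2) m.dtP :=
    (hθ2.prim jθ).integrable_mul (su.prim ju)
  have i3 : Integrable (fun z : Time m.T × Ω =>
      (m.mu - m.lam * m.sigma ^ 2 * (m.X0 - m.freeDelta ξ z.1 z.2)) * prim u z.1 z.2) m.dtP :=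
    hh.integrable_mul (su.prim ju)
  have e : ∀ z : Time m.T × Ω, m.marginal ξ θ z.1 z.2 * prim u z.1 z.2
      - 2 * m.eta * θ z.1 z.2 * u z.1 z.2
      = (m.mu - m.lam * m.sigma ^ 2 * (m.X0 - m.freeDelta ξ z.1 z.2)) * prim u z.1 z.2
        - (2 * m.eta * (θ z.1 z.2 * u z.1 z.2)
          + m.lam * m.sigma ^ 2 * (prim θ z.1 z.2 * prim u z.1 z.2)) := fun z => by
    simp only [marginal, X, prim]
    ring
  simp only [e]
  have j1 := i1.const_mul (2 * m.eta)
  have j2 := i2.const_mul (m.lam * m.sigma ^ 2)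
  refine (integral_sub i3 (j1.add j2)).trans ?_
  rw [← h1, ← integral_const_mul, ← integral_const_mul, sub_eq_zero]
  exact (integral_add j1 j2).symm

/-! ### Strong concavity and optimality -/

theorem reward_eq (hnu : m.nu = 0) (ξ : Tensor) (θ : Time m.T → Ω → ℝ) (t : Time m.T) (ω : Ω) :
    m.reward ξ θ t ω = m.mu * (m.X θ t ω - m.freeDelta ξ t ω) - m.eta * θ t ω ^ 2
      - m.lam / 2 * m.sigma ^ 2 * (m.X θ t ω - m.freeDelta ξ t ω) ^ 2 := by
  rw [reward, m.delta_congr hnu ξ θ fun _ _ => 0, hnu, zero_mul, add_zero]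

theorem integrable_reward (hnu : m.nu = 0) (hξ : IsTrunc M ξ) (h : m.Admissible ξ θ) :
    Integrable (fun z : Time m.T × Ω => m.reward ξ θ z.1 z.2) m.dtP := by
  have sZ : MemLp (fun z : Time m.T × Ω => m.X θ z.1 z.2 - m.freeDelta ξ z.1 z.2) 2 m.dtP :=
    (sqInt_X hnu h).sub (sqInt_freeDelta hnu hξ)
  simp only [reward_eq hnu]
  exact (((sZ.integrable one_le_two).const_mul _).sub
    ((sqInt_of_admissible hnu h).integrable_sq.const_mul _)).sub (sZ.integrable_sq.const_mul _)

theorem J_eq (hnu : m.nu = 0) (hξ : IsTrunc M ξ) (h : m.Admissible ξ θ) :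
    m.J ξ θ = ∫ z, m.reward ξ θ z.1 z.2 ∂m.dtP :=
  (integral_prod_symm _ (integrable_reward hnu hξ h)).symm

theorem X_lin (hnu : m.nu = 0) (hθ : m.Admissible ξ θ) (hφ : m.Admissible ξ φ) (a b : ℝ) :
    ∀ᵐ z ∂m.dtP, prim (fun t ω => a * θ t ω + b * φ t ω) z.1 z.2
      = a * prim θ z.1 z.2 + b * prim φ z.1 z.2 :=
  ae_of_ae_forall (prim_lin (jointSM_of_admissible hθ) (sqInt_of_admissible hnu hθ)
    (jointSM_of_admissible hφ) (sqInt_of_admissible hnu hφ) a b)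

theorem prim_sub_ae (hnu : m.nu = 0) (hθ : m.Admissible ξ θ) (hφ : m.Admissible ξ φ) :
    ∀ᵐ z ∂m.dtP, prim (fun t ω => θ t ω - φ t ω) z.1 z.2
      = prim θ z.1 z.2 - prim φ z.1 z.2 := by
  have e : (fun t ω => θ t ω - φ t ω) = fun t ω => 1 * θ t ω + (-1) * φ t ω := by
    funext t ω
    ring
  rw [e]
  filter_upwards [X_lin hnu hθ hφ 1 (-1)] with z hz
  rw [hz]
  ring

/-- The inventory is affine in the speed, so the concavity gap of the reward is exactly `α(1-α)`
times `η(θ-φ)²` plus `λσ²/2` times the squared difference of inventories. The second part is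
dropped, and `ε / 2 ≤ η` bounds the first. -/
theorem stronglyConcaveJ (hnu : m.nu = 0) (hξ : IsTrunc M ξ) {ε : ℝ} (hε : ε ≤ 2 * m.eta) :
    m.StronglyConcaveJ ξ ε := by
  intro θ φ hθ hφ α hα0 hα1
  have hmix := admissible_lin hnu hθ hφ α (1 - α)
  have hsub := admissible_sub hnu hθ hφ
  have iu := (sqInt_of_admissible hnu hsub).integrable_sq
  have iθ := integrable_reward hnu hξ hθ
  have iφ := integrable_reward hnu hξ hφ
  have hc : 0 ≤ α * (1 - α) := mul_nonneg hα0 (by linarith)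
  have hκ : 0 ≤ m.lam * m.sigma ^ 2 := mul_nonneg m.lam_pos.le (sq_nonneg _)
  rw [admNorm_sq hnu hsub, J_eq hnu hξ hθ, J_eq hnu hξ hφ, J_eq hnu hξ hmix,
    ← integral_const_mul, ← integral_const_mul, ← integral_const_mul,
    ← integral_add (iθ.const_mul _) (iφ.const_mul _)]
  refine le_of_eq_of_le (integral_add ((iθ.const_mul α).add (iφ.const_mul (1 - α)))
    (iu.const_mul _)).symm ?_
  refine integral_mono_ae (((iθ.const_mul _).add (iφ.const_mul _)).add (iu.const_mul _))
    (integrable_reward hnu hξ hmix) ?_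
  filter_upwards [X_lin hnu hθ hφ α (1 - α)] with z hz
  simp only [reward_eq hnu, X]
  change α * (m.mu * (m.X0 + prim θ z.1 z.2 - m.freeDelta ξ z.1 z.2) - m.eta * θ z.1 z.2 ^ 2
      - m.lam / 2 * m.sigma ^ 2 * (m.X0 + prim θ z.1 z.2 - m.freeDelta ξ z.1 z.2) ^ 2)
    + (1 - α) * (m.mu * (m.X0 + prim φ z.1 z.2 - m.freeDelta ξ z.1 z.2) - m.eta * φ z.1 z.2 ^ 2
      - m.lam / 2 * m.sigma ^ 2 * (m.X0 + prim φ z.1 z.2 - m.freeDelta ξ z.1 z.2) ^ 2)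
    + ε * α * (1 - α) / 2 * (θ z.1 z.2 - φ z.1 z.2) ^ 2
    ≤ m.mu * (m.X0 + prim (fun t ω => α * θ t ω + (1 - α) * φ t ω) z.1 z.2
        - m.freeDelta ξ z.1 z.2)
      - m.eta * (α * θ z.1 z.2 + (1 - α) * φ z.1 z.2) ^ 2
      - m.lam / 2 * m.sigma ^ 2 * (m.X0 + prim (fun t ω => α * θ t ω + (1 - α) * φ t ω) z.1 z.2
        - m.freeDelta ξ z.1 z.2) ^ 2
  rw [hz]
  have h1 : 0 ≤ α * (1 - α) * (m.eta - ε / 2) * (θ z.1 z.2 - φ z.1 z.2) ^ 2 :=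
    mul_nonneg (mul_nonneg hc (by linarith)) (sq_nonneg _)
  have h2 : 0 ≤ α * (1 - α) * (m.lam * m.sigma ^ 2 / 2)
      * (prim θ z.1 z.2 - prim φ z.1 z.2) ^ 2 :=
    mul_nonneg (mul_nonneg hc (by linarith)) (sq_nonneg _)
  linarith

/-- The reward of `φ` lies below the tangent at `θ`, pointwise up to a null set, and the linear term
of the tangent integrates to zero by the Euler equation. -/
theorem Euler.isOptimal (hnu : m.nu = 0) (hξ : IsTrunc M ξ) (hθ : m.Admissible ξ θ)
    (hE : m.Euler ξ θ) : m.IsOptimal ξ θ := by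
  refine ⟨hθ, fun φ hφ => ?_⟩
  have hu := admissible_sub hnu hφ hθ
  have su := sqInt_of_admissible hnu hu
  have ju := jointSM_of_admissible hu
  have hκ : 0 ≤ m.lam * m.sigma ^ 2 := mul_nonneg m.lam_pos.le (sq_nonneg _)
  have i1 := integrable_reward hnu hξ hθ
  have i2 : Integrable (fun z : Time m.T × Ω =>
      m.marginal ξ θ z.1 z.2 * prim (fun t ω => φ t ω - θ t ω) z.1 z.2
        - 2 * m.eta * θ z.1 z.2 * (φ z.1 z.2 - θ z.1 z.2)) m.dtP :=
    ((sqInt_marginal hnu hξ hθ).integrable_mul (su.prim ju)).sub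
      (((sqInt_of_admissible hnu hθ).const_mul _).integrable_mul su)
  have h0 := hE _ hu
  rw [integral_rawGrad_mul hnu hξ hθ hu] at h0
  rw [J_eq hnu hξ hθ, J_eq hnu hξ hφ, ← add_zero (∫ z, m.reward ξ θ z.1 z.2 ∂m.dtP), ← h0,
    ← integral_add i1 i2]
  refine integral_mono_ae (integrable_reward hnu hξ hφ) (i1.add i2) ?_
  filter_upwards [prim_sub_ae hnu hφ hθ] with z hz
  simp only [hz]
  simp only [reward_eq hnu, marginal, X]
  change m.mu * (m.X0 + prim φ z.1 z.2 - m.freeDelta ξ z.1 z.2) - m.eta * φ z.1 z.2 ^ 2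
      - m.lam / 2 * m.sigma ^ 2 * (m.X0 + prim φ z.1 z.2 - m.freeDelta ξ z.1 z.2) ^ 2
    ≤ m.mu * (m.X0 + prim θ z.1 z.2 - m.freeDelta ξ z.1 z.2) - m.eta * θ z.1 z.2 ^ 2
      - m.lam / 2 * m.sigma ^ 2 * (m.X0 + prim θ z.1 z.2 - m.freeDelta ξ z.1 z.2) ^ 2
      + ((m.mu - m.lam * m.sigma ^ 2 * (m.X0 + prim θ z.1 z.2 - m.freeDelta ξ z.1 z.2))
          * (prim φ z.1 z.2 - prim θ z.1 z.2)
        - 2 * m.eta * θ z.1 z.2 * (φ z.1 z.2 - θ z.1 z.2))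
  have h1 : 0 ≤ m.eta * (φ z.1 z.2 - θ z.1 z.2) ^ 2 := mul_nonneg m.eta_pos.le (sq_nonneg _)
  have h2 : 0 ≤ m.lam * m.sigma ^ 2 / 2 * (prim φ z.1 z.2 - prim θ z.1 z.2) ^ 2 :=
    mul_nonneg (by linarith) (sq_nonneg _)
  linarith

theorem IsOptimal.sameSpeed (hnu : m.nu = 0) (hξ : IsTrunc M ξ) (hθ : m.IsOptimal ξ θ)
    (hφ : m.IsOptimal ξ φ) : m.SameSpeed φ θ := by
  have hη := m.eta_pos
  have hsub := admissible_sub hnu hφ.1 hθ.1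
  have hmix := admissible_lin hnu hφ.1 hθ.1 (1 / 2) (1 - 1 / 2)
  -- At the midpoint, with modulus `η`, the value of `J` would exceed the maximum by `η/8` times the
  -- squared norm of the difference.
  have h1 := stronglyConcaveJ hnu hξ (ε := m.eta) (by linarith) φ θ hφ.1 hθ.1 (1 / 2)
    (by norm_num) (by norm_num)
  have h2 := hθ.2 _ hmix
  have h3 := hφ.2 _ hθ.1
  rw [admNorm_sq hnu hsub] at h1
  have iu := (sqInt_of_admissible hnu hsub).integrable_sq
  have h4 : ∫ z, (φ z.1 z.2 - θ z.1 z.2) ^ 2 ∂m.dtP = 0 := by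
    refine le_antisymm ?_ (integral_nonneg fun _ => sq_nonneg _)
    nlinarith
  rw [integral_eq_zero_iff_of_nonneg (fun _ => sq_nonneg _) iu] at h4
  filter_upwards [h4] with z hz
  exact sub_eq_zero.1 (pow_eq_zero_iff two_ne_zero |>.1 hz)

end Tracking

end Market

/-! ### Tails and conditional expectations -/

section Tails

variable {Ω : Type*} {mΩ : MeasurableSpace Ω} {T : ℝ} {P : Measure Ω} [IsProbabilityMeasure P]

theorem tail_lin {f g : Time T → Ω → ℝ} (hjf : JointSM f) (hf : SqInt P f) (hjg : JointSM g)
    (hg : SqInt P g) (a b : ℝ) :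
    ∀ᵐ ω ∂P, ∀ t, tail (fun t ω => a * f t ω + b * g t ω) t ω
      = a * tail f t ω + b * tail g t ω := by
  filter_upwards [hf.ae_memLp hjf, hg.ae_memLp hjg] with ω h1 h2 t
  have i1 := ((h1.integrable one_le_two).integrableOn (s := Set.Ioi t)).const_mul a
  have i2 := ((h2.integrable one_le_two).integrableOn (s := Set.Ioi t)).const_mul b
  unfold tail
  rw [integral_add i1 i2, integral_const_mul, integral_const_mul]

theorem tail_const (c : ℝ) (t : Time T) (ω : Ω) :
    tail (fun _ _ => c) t ω = c * (T - t) := by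
  have e : (Subtype.val : Time T → ℝ) '' Set.Ioi t = Set.Ioc (t : ℝ) T := by
    ext x
    constructor
    · rintro ⟨y, hy, rfl⟩
      exact ⟨hy, y.2.2⟩
    · intro hx
      exact ⟨⟨x, t.2.1.trans hx.1.le, hx.2⟩, hx.1, rfl⟩
  have h : (leb T).real (Set.Ioi t) = T - t := by
    unfold leb
    rw [measureReal_def, (MeasurableEmbedding.subtype_coe measurableSet_Icc).comap_apply, e,
      Real.volume_Ioc, ENNReal.toReal_ofReal (by linarith [t.2.2])]
  rw [tail, setIntegral_const, h, smul_eq_mul, mul_comm]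

end Tails

/-- The measurable factor is pulled inside the conditional expectation, whose integral is that of
the product. -/
theorem integral_condExp_mul {Ω : Type*} {mΩ : MeasurableSpace Ω} {P : Measure Ω}
    [IsFiniteMeasure P] {G : MeasurableSpace Ω} (hG : G ≤ mΩ) {f v : Ω → ℝ} (hf : Integrable f P)
    (hv : StronglyMeasurable[G] v) (hfv : Integrable (fun ω => f ω * v ω) P) :
    ∫ ω, (P[f | G]) ω * v ω ∂P = ∫ ω, f ω * v ω ∂P := by
  rw [← integral_condExp (m := G) (f := fun ω => f ω * v ω) hG]
  exact integral_congr_ae (condExp_mul_of_stronglyMeasurable_right hv hfv hf).symm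

/-! ### The gradient, the first-order condition and monotonicity -/

namespace Market

variable {Ω : Type*} [mΩ : MeasurableSpace Ω] {m : Market Ω}

/-- The pairing with an adapted process sees a process only through its optional projection. -/
theorem pairing_eq_of_ae_condExp {f g u : Time m.T → Ω → ℝ}
    (hu : ∀ t, StronglyMeasurable[m.F t] (u t)) (hf : Integrable (fun z => f z.1 z.2) m.dtP)
    (hfu : Integrable (fun z => f z.1 z.2 * u z.1 z.2) m.dtP)
    (hg : ∀ᵐ t ∂leb m.T, g t =ᵐ[m.P] m.P[f t | m.F t]) :
    m.pairing g u = ∫ z, f z.1 z.2 * u z.1 z.2 ∂m.dtP := by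
  rw [pairing, dtP, integral_prod _ hfu]
  refine integral_congr_ae ?_
  filter_upwards [hg, hf.prod_right_ae, hfu.prod_right_ae] with t h1 h2 h3
  rw [← integral_condExp_mul (m.F.le t) h2 (hu t) h3]
  refine integral_congr_ae ?_
  filter_upwards [h1] with ω hω
  rw [hω]

section Tracking

variable {ξ : Tensor} {M : ℕ} {θ φ : Time m.T → Ω → ℝ}

theorem Admissible.stronglyMeasurable (h : m.Admissible ξ θ) (t : Time m.T) :
    StronglyMeasurable[m.F t] (θ t) := h.1.stronglyAdapted t

theorem opB_eq (hnu : m.nu = 0) (t : Time m.T) (ω : Ω) :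
    m.opB ξ θ t ω = m.condInt t (m.X θ) ω
      + m.condInt t (fun s ω' => -m.freeDelta ξ s ω') ω := by
  simp only [opB, hnu, zero_mul, sub_zero, mul_one, mul_zero, zero_sub,
    m.delta_congr hnu ξ θ fun _ _ => 0]

theorem opC_eq (hnu : m.nu = 0) (t : Time m.T) (ω : Ω) :
    m.opC ξ θ t ω = (m.T - t) - m.condInt t (fun _ _ => 0) ω := by
  simp only [opC, hnu, zero_mul]

theorem opC_ae (hnu : m.nu = 0) (t : Time m.T) :
    ∀ᵐ ω ∂m.P, m.opC ξ θ t ω = m.T - t := by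
  filter_upwards [m.condInt_ae (Z := fun _ _ => 0) stronglyMeasurable_const
    (integrable_const _) t] with ω hω
  have e : (tail (fun _ _ => 0) t : Ω → ℝ) = 0 := by
    funext ω
    simp [tail]
  rw [opC_eq hnu, hω, e, condExp_zero, Pi.zero_apply, sub_zero]

theorem opB_ae (hnu : m.nu = 0) (hξ : IsTrunc M ξ) (h : m.Admissible ξ θ) (t : Time m.T) :
    m.opB ξ θ t
      =ᵐ[m.P] m.P[fun ω => tail (m.X θ) t ω - tail (m.freeDelta ξ) t ω | m.F t] := by
  have jX := jointSM_X h
  have sX := sqInt_X hnu h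
  have jD := jointSM_freeDelta hnu hξ
  have sD := sqInt_freeDelta hnu hξ
  have eD : tail (fun s ω' => -m.freeDelta ξ s ω') t = -tail (m.freeDelta ξ) t := by
    funext ω
    exact integral_neg _
  have h1 := m.condInt_ae jX (sX.integrable one_le_two) t
  have h2 := m.condInt_ae (Z := fun s ω' => -m.freeDelta ξ s ω') jD.neg
    (sD.neg.integrable one_le_two) t
  rw [eD] at h2
  filter_upwards [h1, h2, condExp_sub ((sX.tail_section jX t).integrable one_le_two)
    ((sD.tail_section jD t).integrable one_le_two) (m.F t),
    condExp_neg (μ := m.P) (tail (m.freeDelta ξ) t) (m.F t)] with ω e1 e2 e3 e4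
  rw [opB_eq hnu, e1, e2, e4, Pi.neg_apply, ← sub_eq_add_neg]
  exact e3.symm

theorem condExp_adapted_add {t : Time m.T} {g : Ω → ℝ} (h : m.Admissible ξ θ)
    (hθ : Integrable (θ t) m.P) (hg : Integrable g m.P) (c d : ℝ) :
    ∀ᵐ ω ∂m.P, (m.P[fun ω => c * θ t ω + d * g ω | m.F t]) ω
      = c * θ t ω + d * (m.P[g | m.F t]) ω := by
  have e1 : m.P[fun ω => c * θ t ω | m.F t] = fun ω => c * θ t ω :=
    condExp_of_stronglyMeasurable (m.F.le t) ((h.stronglyMeasurable t).const_mul c)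
      (hθ.const_mul c)
  filter_upwards [condExp_add (hθ.const_mul c) (hg.const_mul d) (m.F t),
    condExp_smul (μ := m.P) d g (m.F t)] with ω h1 h2
  refine h1.trans ?_
  rw [Pi.add_apply, e1]
  exact congrArg (c * θ t ω + ·) h2

/-- The gradient of `J` is the optional projection of its pathwise version. -/
theorem gradJ_ae (hnu : m.nu = 0) (hξ : IsTrunc M ξ) (h : m.Admissible ξ θ) :
    ∀ᵐ t ∂leb m.T, m.gradJ ξ θ t =ᵐ[m.P] m.P[m.rawGrad ξ θ t | m.F t] := by
  have sθ := sqInt_of_admissible hnu h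
  have jX := jointSM_X h
  have sX := sqInt_X hnu h
  have jD := jointSM_freeDelta hnu hξ
  have sD := sqInt_freeDelta hnu hξ
  -- Only almost every `t` is reached: pulling `θ t` out of the conditional expectation uses its
  -- integrability.
  filter_upwards [(sθ.integrable one_le_two).prod_right_ae] with t ht
  have iX := (sX.tail_section jX t).integrable one_le_two
  have iD := (sD.tail_section jD t).integrable one_le_two
  have iZ : Integrable (fun ω => tail (m.X θ) t ω - tail (m.freeDelta ξ) t ω) m.P := iX.sub iD
  have hraw : m.rawGrad ξ θ t =ᵐ[m.P] fun ω => (-2 * m.eta * θ t ω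
      + -(m.lam * m.sigma ^ 2) * (tail (m.X θ) t ω - tail (m.freeDelta ξ) t ω))
      + m.mu * (m.T - t) := by
    have l1 := tail_lin jX sX jD sD 1 (-1)
    have l2 := tail_lin (f := fun _ _ => m.mu)
      (g := fun t ω => m.X θ t ω - m.freeDelta ξ t ω) (P := m.P) stronglyMeasurable_const (memLp_const _)
      (jX.sub jD) (sX.sub sD) 1 (-(m.lam * m.sigma ^ 2))
    filter_upwards [l1, l2] with ω h1 h2
    have e1 : m.marginal ξ θ = fun t ω => 1 * m.mu
        + -(m.lam * m.sigma ^ 2) * (m.X θ t ω - m.freeDelta ξ t ω) := by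
      funext t ω
      simp only [marginal]
      ring
    have e2 : (fun t ω => 1 * m.X θ t ω + -1 * m.freeDelta ξ t ω)
        = fun t ω => m.X θ t ω - m.freeDelta ξ t ω := by
      funext t ω
      ring
    have h1' := h1 t
    rw [e2] at h1'
    have h2' := h2 t
    rw [rawGrad, e1, h2', h1', tail_const]
    ring
  have hc : m.P[fun _ : Ω => m.mu * (m.T - t) | m.F t] = fun _ => m.mu * (m.T - t) :=
    condExp_const (m.F.le t) _
  filter_upwards [condExp_congr_ae (m := m.F t) hraw, opB_ae hnu hξ h t,
    opC_ae (ξ := ξ) (θ := θ) hnu t,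
    condExp_adapted_add h ht iZ (-2 * m.eta) (-(m.lam * m.sigma ^ 2)),
    condExp_add ((ht.const_mul (-2 * m.eta)).add (iZ.const_mul (-(m.lam * m.sigma ^ 2))))
      (integrable_const (m.mu * (m.T - t))) (m.F t)] with ω e1 e2 e3 e4 e5
  rw [e1]
  refine Eq.trans ?_ e5.symm
  rw [Pi.add_apply, hc, gradJ, hnu, e2, e3]
  refine Eq.trans ?_ (congrArg (· + m.mu * (m.T - t)) e4.symm)
  ring

/-- Admissible directions are adapted, so pairing with the gradient is the same as pairing with its
pathwise version. -/
theorem FirstOrder.euler (hnu : m.nu = 0) (hξ : IsTrunc M ξ) (h : m.Admissible ξ θ)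
    (hF : m.FirstOrder ξ θ) : m.Euler ξ θ := by
  intro u hu
  have sR := sqInt_rawGrad hnu hξ h
  rw [← pairing_eq_of_ae_condExp hu.stronglyMeasurable (sR.integrable one_le_two)
    (sR.integrable_mul (sqInt_of_admissible hnu hu)) (gradJ_ae hnu hξ h), pairing]
  refine integral_eq_zero_of_ae ?_
  filter_upwards [hF] with t ht
  refine integral_eq_zero_of_ae ?_
  filter_upwards [ht] with ω hω
  rw [hω, zero_mul, Pi.zero_apply]

/-- The indicator of `[a, b] × A`. -/
def block (a b : Time m.T) (A : Set Ω) (t : Time m.T) (ω : Ω) : ℝ :=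
  (Set.Icc a b ×ˢ A).indicator (fun _ => 1) (t, ω)

/-- Before `a` the process is zero, and from `a` on `A` belongs to the filtration: this is where `A
∈ F a` is needed. -/
theorem admissible_block (hnu : m.nu = 0) (a b : Time m.T) {A : Set Ω}
    (hA : MeasurableSet[m.F a] A) : m.Admissible ξ (block a b A) := by
  refine (admissible_iff hnu).2 ⟨fun i => ?_, ?_⟩
  · by_cases hi : a ≤ i
    · have hAi : MeasurableSet[m.F i] A := m.F.mono hi A hA
      have hs : MeasurableSet[Subtype.instMeasurableSpace.prod (m.F i)]
          ((fun p : Set.Iic i × Ω => (p.1 : Time m.T)) ⁻¹' Set.Icc a b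
            ∩ (fun p : Set.Iic i × Ω => p.2) ⁻¹' A) := by
        refine MeasurableSet.inter ?_ ?_
        · exact (measurable_subtype_coe.comp (@measurable_fst _ _ _ (m.F i))) measurableSet_Icc
        · exact (@measurable_snd _ _ _ (m.F i)) hAi
      exact (@stronglyMeasurable_const _ _ (Subtype.instMeasurableSpace.prod (m.F i)) _
        (1 : ℝ)).indicator hs
    · have e : (fun p : Set.Iic i × Ω => block a b A (p.1 : Time m.T) p.2) = fun _ => 0 := by
        funext p
        refine Set.indicator_of_notMem (fun hp => hi ?_) _
        exact hp.1.1.trans p.1.2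
      rw [e]
      exact @stronglyMeasurable_const _ _ (Subtype.instMeasurableSpace.prod (m.F i)) _ (0 : ℝ)
  · exact (memLp_const (1 : ℝ)).indicator (measurableSet_Icc.prod (m.F.le a A hA))

/-- Testing with blocks gives vanishing integrals over all `[a, b] × A`; differentiation in time
then shows that the conditional expectation of `rawGrad` given `F t` is zero for almost every `t`.
-/
theorem Euler.firstOrder (hnu : m.nu = 0) (hξ : IsTrunc M ξ) (h : m.Admissible ξ θ)
    (hE : m.Euler ξ θ) : m.FirstOrder ξ θ := by
  have iR := (sqInt_rawGrad hnu hξ h).integrable one_le_two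
  have key := ae_forall_setIntegral_eq_zero (F := m.F) m.T_pos (jointSM_rawGrad hnu hξ h) iR
    fun a b _ A hA => by
      have h0 := hE _ (admissible_block hnu a b hA)
      have e : ∀ z : Time m.T × Ω, m.rawGrad ξ θ z.1 z.2 * block a b A z.1 z.2
          = (Set.Icc a b ×ˢ A).indicator (fun z => m.rawGrad ξ θ z.1 z.2) z := fun z => by
        by_cases hz : z ∈ Set.Icc a b ×ˢ A
        · simp [block, hz]
        · simp [block, hz]
      simp only [e] at h0
      rw [integral_indicator (measurableSet_Icc.prod (m.F.le a A hA)), dtP,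
        setIntegral_prod _ iR.integrableOn] at h0
      exact h0
  filter_upwards [key, gradJ_ae hnu hξ h, iR.prod_right_ae] with t h1 h2 h3
  have h4 : (0 : Ω → ℝ) =ᵐ[m.P] m.P[m.rawGrad ξ θ t | m.F t] := by
    refine ae_eq_condExp_of_forall_setIntegral_eq (m.F.le t) h3
      (fun _ _ _ => integrableOn_zero) (fun s hs _ => ?_) aestronglyMeasurable_zero
    rw [h1 s hs]
    simp
  filter_upwards [h2, h4] with ω e1 e2
  rw [e1, ← e2, Pi.zero_apply]

/-- For exponent 2 the regularizing term is linear, `ε (θ - φ)`; the term in `A` has factor zero and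
the term in `C` does not depend on the speed. Only `-(2η - ε) u` and the term in `B` remain, and the
latter pairs with `u` to a negative square after exchanging tail and primitive. -/
theorem monotonicityCondition (hnu : m.nu = 0) (hξ : IsTrunc M ξ) {ε : ℝ} (hε : ε ≤ 2 * m.eta) :
    m.MonotonicityCondition ξ ε := by
  intro θ φ hθ hφ
  set u : Time m.T → Ω → ℝ := fun t ω => θ t ω - φ t ω with hu_def
  have hu : m.Admissible ξ u := admissible_sub hnu hθ hφ
  have su := sqInt_of_admissible hnu hu
  have ju := jointSM_of_admissible hu
  have jp := ju.prim
  have sp := su.prim ju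
  have hκ : 0 ≤ m.lam * m.sigma ^ 2 := mul_nonneg m.lam_pos.le (sq_nonneg _)
  have jD := jointSM_freeDelta hnu hξ
  have sD := sqInt_freeDelta hnu hξ
  -- The pathwise version of the left entry of the pairing, whose conditional expectations are that
  -- entry.
  set f : Time m.T → Ω → ℝ := fun t ω =>
    -(2 * m.eta - ε) * u t ω + -(m.lam * m.sigma ^ 2) * tail (prim u) t ω with hf_def
  have sf : SqInt m.P f := (su.const_mul _).add ((sp.tail jp).const_mul _)
  have htail : ∀ᵐ ω ∂m.P, ∀ t,
      tail (prim u) t ω = tail (m.X θ) t ω - tail (m.X φ) t ω := by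
    have e : (fun t ω => 1 * θ t ω + -1 * φ t ω) = u := by
      funext t ω
      simp only [hu_def]
      ring
    have l1 := prim_lin (jointSM_of_admissible hθ) (sqInt_of_admissible hnu hθ)
      (jointSM_of_admissible hφ) (sqInt_of_admissible hnu hφ) 1 (-1)
    rw [e] at l1
    filter_upwards [l1, tail_lin (jointSM_X hθ) (sqInt_X hnu hθ) (jointSM_X hφ)
      (sqInt_X hnu hφ) 1 (-1)] with ω h1 h2 t
    have e2 : tail (prim u) t ω = tail (fun t ω => 1 * m.X θ t ω + -1 * m.X φ t ω) t ω := by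
      unfold tail
      congr 1
      funext s
      change prim u s ω = 1 * (m.X0 + prim θ s ω) + -1 * (m.X0 + prim φ s ω)
      rw [h1 s]
      ring
    rw [e2, h2 t]
    ring
  have hpair := pairing_eq_of_ae_condExp (f := f) (u := u) (g := fun t ω =>
        -2 * m.eta * (θ t ω - φ t ω)
        + ε * (m.admNorm ξ θ ^ (2 - (m.exponent ξ : ℤ)) * θ t ω ^ (m.exponent ξ - 1)
            - m.admNorm ξ φ ^ (2 - (m.exponent ξ : ℤ)) * φ t ω ^ (m.exponent ξ - 1))
        + m.nu * (m.opA ξ θ t ω - m.opA ξ φ t ω)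
        - m.lam * m.sigma ^ 2 * (m.opB ξ θ t ω - m.opB ξ φ t ω)
        + m.mu * (m.opC ξ θ t ω - m.opC ξ φ t ω)) hu.stronglyMeasurable
    (sf.integrable one_le_two) (sf.integrable_mul su) <| by
    filter_upwards [(su.integrable one_le_two).prod_right_ae] with t ht
    have iD := (sD.tail_section jD t).integrable one_le_two
    have iθ := ((sqInt_X hnu hθ).tail_section (jointSM_X hθ) t).integrable one_le_two
    have iφ := ((sqInt_X hnu hφ).tail_section (jointSM_X hφ) t).integrable one_le_two
    have hcongr : tail (prim u) t =ᵐ[m.P]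
        (fun ω => tail (m.X θ) t ω - tail (m.freeDelta ξ) t ω)
          - fun ω => tail (m.X φ) t ω - tail (m.freeDelta ξ) t ω := by
      filter_upwards [htail] with ω hω
      rw [hω t, Pi.sub_apply]
      ring
    filter_upwards [opB_ae hnu hξ hθ t, opB_ae hnu hξ hφ t, condExp_congr_ae (m := m.F t) hcongr,
      condExp_sub (iθ.sub iD) (iφ.sub iD) (m.F t),
      condExp_adapted_add hu ht ((sp.tail_section jp t).integrable one_le_two)
        (-(2 * m.eta - ε)) (-(m.lam * m.sigma ^ 2))] with ω e1 e2 e3 e4 e5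
    have e6 : (m.P[tail (prim u) t | m.F t]) ω = m.opB ξ θ t ω - m.opB ξ φ t ω := by
      rw [e1, e2, e3]
      exact e4
    refine Eq.trans ?_ e5.symm
    -- The norms carry the integer exponent zero, hence equal one even for a vanishing speed, and
    -- the two values of `opC` cancel identically.
    rw [e6, exponent_eq_two hnu, opC_eq hnu, opC_eq hnu, hnu]
    norm_num
    ring
  refine hpair.trans_le ?_
  have i1 : Integrable (fun z : Time m.T × Ω => -(2 * m.eta - ε) * u z.1 z.2 ^ 2) m.dtP :=
    su.integrable_sq.const_mul _
  have i2 : Integrable (fun z : Time m.T × Ω =>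
      -(m.lam * m.sigma ^ 2) * (u z.1 z.2 * tail (prim u) z.1 z.2)) m.dtP :=
    (su.integrable_mul (sp.tail jp)).const_mul _
  have e : ∀ z : Time m.T × Ω, f z.1 z.2 * u z.1 z.2 = -(2 * m.eta - ε) * u z.1 z.2 ^ 2
      + -(m.lam * m.sigma ^ 2) * (u z.1 z.2 * tail (prim u) z.1 z.2) := fun z => by
    simp only [hf_def]
    ring
  simp only [e]
  -- Integration by parts turns `∫ u · tail (prim u)` into `∫ (prim u)²`.
  rw [integral_add i1 i2, integral_const_mul, integral_const_mul,
    integral_mul_tail ju su jp sp]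
  have h1 : 0 ≤ ∫ z, u z.1 z.2 ^ 2 ∂m.dtP := integral_nonneg fun _ => sq_nonneg _
  have h2 : 0 ≤ ∫ z, prim u z.1 z.2 * prim u z.1 z.2 ∂m.dtP :=
    integral_nonneg fun _ => mul_self_nonneg _
  have h3 := mul_nonneg (sub_nonneg.2 hε) h1
  have h4 := mul_nonneg hκ h2
  linarith

end Tracking

end Market

end SigHedging

end

theorem proposition5p3 {Ω : Type*} [MeasurableSpace Ω] (m : SigHedging.Market Ω)
    (ξ : SigHedging.Tensor) (M : ℕ) (hξ : SigHedging.IsTrunc M ξ) (hnu : m.nu = 0) :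
    (∀ θ, m.Admissible ξ θ →
      MeasureTheory.Integrable (fun z : SigHedging.Time m.T × Ω => m.reward ξ θ z.1 z.2)
        ((SigHedging.leb m.T).prod m.P)) ∧
    (∀ ε : ℝ, 0 < ε → ε < 2 * m.eta →
      m.MonotonicityCondition ξ ε ∧ m.StronglyConcaveJ ξ ε) ∧
    ∃ θopt, m.IsOptimal ξ θopt ∧ m.FirstOrder ξ θopt ∧
      (∀ φ, m.IsOptimal ξ φ → m.SameSpeed φ θopt) ∧
      (∀ φ, m.Admissible ξ φ → m.FirstOrder ξ φ → m.SameSpeed φ θopt) := by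
  -- The Euler equation is the hinge: its solution is optimal and satisfies the first-order
  -- condition, and any other critical point is brought back through it to optimality, where
  -- uniqueness holds.
  obtain ⟨θ, hθ, hE⟩ := SigHedging.Market.exists_euler_admissible hnu hξ
  have hopt := hE.isOptimal hnu hξ hθ
  exact ⟨fun φ hφ => SigHedging.Market.integrable_reward hnu hξ hφ,
    fun ε _ hε => ⟨SigHedging.Market.monotonicityCondition hnu hξ hε.le,
      SigHedging.Market.stronglyConcaveJ hnu hξ hε.le⟩,
    θ, hopt, hE.firstOrder hnu hξ hθ, fun φ hφ => hopt.sameSpeed hnu hξ hφ,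
    fun φ hφ hF => hopt.sameSpeed hnu hξ ((hF.euler hnu hξ hφ).isOptimal hnu hξ hφ)⟩
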